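/- Let $k$ be an algebraically closed field of characteristic $0$, and let $B=\bigoplus_{i\ge 0}B_i$ be a (left and right) noetherian $\mathbb N$-graded $k$-algebra with all $B_i$ finite dimensional and with $B_0\cong k^n$; let $e_1,\dots,e_n\in B_0$ be the corresponding primitive orthogonal idempotents. For graded right $B$-modules, $\underline{\mathrm{Hom}}_B(M,M')=\bigoplus_{\ell\in\mathbb Z}\mathrm{Hom}^\ell_B(M,M')$ is the direct sum over $\ell$ of the spaces of homomorphisms that are homogeneous of degree $\ell$, $\underline{\mathrm{Ext}}{}^i_B$ denotes its right derived functors, and $M[\ell]_m=M_{\ell+m}$. Assume that $B$ and $B^{\mathrm{op}}$ satisfy the $\chi$-condition: for $R=B$ and $R=B^{\mathrm{op}}$, $\underline{\mathrm{Ext}}{}^j_R(R/R_{\ge1},M)$ is nonzero in only finitely many degrees for every $j$ and every finitely generated graded right $R$-module $M$. Assume further that $B$ is generalized Gorenstein: the right module $B$ has finite injective dimension $N$, and there are a permutation $\sigma$ of $\{1,\dots,n\}$ and integers $\ell_1,\dots,\ell_n$ such that, for all $j$, $\underline{\mathrm{Ext}}{}^i_B(S_j,B)=0$ for $i\ne N$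 and $\underline{\mathrm{Ext}}{}^N_B(S_j,B)\cong S^\vee_{\sigma(j)}[\ell_j]$ as graded left $B$-modules, where $S_j=e_jB/(e_jB)_{\ge1}$ and $S_j^\vee=Be_j/(Be_j)_{\ge1}$. Put $\mathfrak r=B_{\ge1}$ and $H^i_{\mathfrak r}(B)=\varinjlim_r\underline{\mathrm{Ext}}{}^i_B(B/B_{\ge r},B)$, a graded right $B$-module through the left multiplication on $B/B_{\ge r}$. Then $H^i_{\mathfrak r}(B)=0$ for $i\neq N$, and $$H^N_{\mathfrak r}(B)\cong\bigoplus_{b=1}^n e_bB^\vee[\ell_b]$$ as graded right $B$-modules, where $e_bB^\vee=\underline{\mathrm{Hom}}_k(Be_b,k)$, with $(e_bB^\vee)_m=\mathrm{Hom}_k(B_{-m}e_b,k)$, is the graded Matlis dual of $Be_b$. In particular, $B$ is AS-Cohen–Macaulay: there is an integer $N'$ such that, for all $i\ne N'$, $\varinjlim_r\underline{\mathrm{Ext}}{}^i_R(R/\mathfrak u^r,R)=0$ both for $R=B$ and for $R=B^{\mathrm{op}}$, where $\mathfrak u=R_{\ge1}$. -/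

import Mathlib

/- Conventions.  `B` is an algebra over a field `k` with an `ℕ`-grading `𝒜`.  A right `B`-module is a
module over `Bᵐᵒᵖ`, so that `m · b` is `MulOpposite.op b • m`.  A `ℤ`-grading of a module `M` is a
family `ℳ : ℤ → Submodule k M`. -/

set_option linter.unusedSectionVars false

noncomputable section

open MulOpposite

namespace GradedExt

section Cochains

variable {k B : Type*} [Field k] [Ring B] [Algebra k B]
variable {M N M' N' : Type*}
  [AddCommGroup M] [Module k M] [Module Bᵐᵒᵖ M]
  [AddCommGroup N] [Module k N] [Module Bᵐᵒᵖ N] [IsScalarTower k Bᵐᵒᵖ N]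
  [AddCommGroup M'] [Module k M'] [Module Bᵐᵒᵖ M'] [IsScalarTower k Bᵐᵒᵖ M']
  [AddCommGroup N'] [Module k N'] [Module Bᵐᵒᵖ N'] [IsScalarTower k Bᵐᵒᵖ N']

/-- The differential of the complex `Hom_B(Bar_•(M), N)`, where `Bar_q(M) = M ⊗ B^{⊗ q} ⊗ B` (tensor
products over `k`) is the bar resolution of the right module `M` by free right modules and
`Hom_B(M ⊗ B^{⊗ q} ⊗ B, N) = Hom_k(M ⊗ B^{⊗ q}, N)`:
`(d f)(m; b₁, …, b_{q+1}) = f(m b₁; b₂, …) + ∑_j (-1)^j f(m; …, b_j b_{j+1}, …)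
  + (-1)^{q+1} f(m; b₁, …, b_q) b_{q+1}`.
It is written on all functions; the multilinear ones are singled out in `cochains`. -/
def barDifferential (k : Type*) {B M N : Type*} [Field k] [Ring B] [Algebra k B]
    [AddCommGroup M] [Module Bᵐᵒᵖ M]
    [AddCommGroup N] [Module k N] [Module Bᵐᵒᵖ N] [IsScalarTower k Bᵐᵒᵖ N] (q : ℕ) :
    (M → (Fin q → B) → N) →ₗ[k] (M → (Fin (q + 1) → B) → N) where
  toFun f m g :=
    f (op (g 0) • m) (Fin.tail g)
      + ∑ j : Fin q, (-1 : ℤ) ^ ((j : ℕ) + 1) • f m (Fin.contractNth j.castSucc (· * ·) g)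
      + (-1 : ℤ) ^ (q + 1) • (op (g (Fin.last q)) • f m (Fin.init g))
  map_add' f f' := by
    funext m g
    simp only [Pi.add_apply, smul_add, Finset.sum_add_distrib]
    abel
  map_smul' c f := by
    funext m g
    simp only [Pi.smul_apply, RingHom.id_apply, smul_add, Finset.smul_sum]
    congr 1
    · congr 1
      exact Finset.sum_congr rfl fun j _ => smul_comm _ _ _
    · rw [smul_comm c, ← algebraMap_smul Bᵐᵒᵖ c (f m (Fin.init g)),
        ← algebraMap_smul Bᵐᵒᵖ c (_ • f m (Fin.init g)), smul_smul, smul_smul,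
        Algebra.commutes]

variable (𝒜 : ℕ → Submodule k B) (ℳ : ℤ → Submodule k M) (𝒩 : ℤ → Submodule k N)
  (ℳ' : ℤ → Submodule k M') (𝒩' : ℤ → Submodule k N')

/-- The `k`-multilinear maps `M × B^q → N` that are homogeneous of degree `ℓ`, that is, the right
module homomorphisms `Bar_q(M) → N` that are homogeneous of degree `ℓ`. -/
def cochains (q : ℕ) (ℓ : ℤ) : Submodule k (M → (Fin q → B) → N) where
  carrier := {f |
    (∃ φ : M →ₗ[k] MultilinearMap k (fun _ : Fin q => B) N, ∀ m g, f m g = φ m g) ∧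
    ∀ (i : ℤ) (m : M) (d : Fin q → ℕ) (g : Fin q → B), m ∈ ℳ i → (∀ t, g t ∈ 𝒜 (d t)) →
      f m g ∈ 𝒩 (i + ∑ t, (d t : ℤ) + ℓ)}
  zero_mem' := ⟨⟨0, fun _ _ => rfl⟩, fun _ _ _ _ _ _ => Submodule.zero_mem _⟩
  add_mem' := by
    rintro f f' ⟨⟨φ, hφ⟩, h⟩ ⟨⟨φ', hφ'⟩, h'⟩
    exact ⟨⟨φ + φ', fun m g => by simp [hφ, hφ']⟩,
      fun i m d g hm hg => Submodule.add_mem _ (h i m d g hm hg) (h' i m d g hm hg)⟩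
  smul_mem' := by
    rintro c f ⟨⟨φ, hφ⟩, h⟩
    exact ⟨⟨c • φ, fun m g => by simp [hφ]⟩,
      fun i m d g hm hg => Submodule.smul_mem _ c (h i m d g hm hg)⟩

/-- Homogeneous cocycles of degree `ℓ`. -/
def cocycles (q : ℕ) (ℓ : ℤ) : Submodule k (M → (Fin q → B) → N) :=
  cochains 𝒜 ℳ 𝒩 q ℓ ⊓ LinearMap.ker (barDifferential k q)

/-- Homogeneous coboundaries of degree `ℓ`. -/
def coboundaries : (q : ℕ) → (ℓ : ℤ) → Submodule k (M → (Fin q → B) → N)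
  | 0, _ => ⊥
  | q + 1, ℓ => (cochains 𝒜 ℳ 𝒩 q ℓ).map (barDifferential k q)

/-- The homogeneous component of degree `ℓ` of the graded `Ext` group `\underline{Ext}^q_B(M, N)` of
graded right modules: the `q`-th cohomology of the complex of homogeneous homomorphisms of degree `ℓ`
from the bar resolution of `M` (a resolution by graded free modules, as `k` is a field) to `N`. -/
abbrev GExt (q : ℕ) (ℓ : ℤ) : Type _ :=
  ↥(cocycles 𝒜 ℳ 𝒩 q ℓ) ⧸ (coboundaries 𝒜 ℳ 𝒩 q ℓ).submoduleOf (cocycles 𝒜 ℳ 𝒩 q ℓ)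

/-- The cochain map `f ↦ β ∘ f ∘ α`. -/
def cochainMap (α : M' →ₗ[Bᵐᵒᵖ] M) (β : N →ₗ[Bᵐᵒᵖ] N') (q : ℕ) :
    (M → (Fin q → B) → N) →ₗ[k] (M' → (Fin q → B) → N') where
  toFun f m g := β (f (α m) g)
  map_add' f f' := by funext m g; simp
  map_smul' c f := by funext m g; exact (β.restrictScalars k).map_smul c _

variable {𝒜 ℳ 𝒩 ℳ' 𝒩'}

theorem cochainMap_barDifferential (α : M' →ₗ[Bᵐᵒᵖ] M) (β : N →ₗ[Bᵐᵒᵖ] N') (q : ℕ)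
    (f : M → (Fin q → B) → N) :
    cochainMap (k := k) α β (q + 1) (barDifferential k q f)
      = barDifferential k q (cochainMap (k := k) α β q f) := by
  funext m g
  simp [cochainMap, barDifferential, map_sum]

variable [IsScalarTower k Bᵐᵒᵖ M]

theorem cochainMap_mem_cochains (α : M' →ₗ[Bᵐᵒᵖ] M) (β : N →ₗ[Bᵐᵒᵖ] N') {a c ℓ ℓ' : ℤ}
    (hα : ∀ i, ∀ m ∈ ℳ' i, α m ∈ ℳ (i + a)) (hβ : ∀ i, ∀ x ∈ 𝒩 i, β x ∈ 𝒩' (i + c))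
    (hℓ : ℓ + a + c = ℓ') (q : ℕ) {f : M → (Fin q → B) → N} (hf : f ∈ cochains 𝒜 ℳ 𝒩 q ℓ) :
    cochainMap (k := k) α β q f ∈ cochains 𝒜 ℳ' 𝒩' q ℓ' := by
  obtain ⟨⟨φ, hφ⟩, h⟩ := hf
  refine ⟨⟨{ toFun := fun m => (β.restrictScalars k).compMultilinearMap (φ (α m))
             map_add' := fun x y => by ext g; simp
             map_smul' := fun t x => by
               ext g
               have : α (t • x) = t • α x := (α.restrictScalars k).map_smul t x
               simp [this] }, fun m g => by simp [cochainMap, hφ]⟩, ?_⟩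
  intro i m d g hm hg
  have h1 := hβ _ _ (h _ _ d g (hα i m hm) hg)
  have h2 : i + a + ∑ t, (d t : ℤ) + ℓ + c = i + ∑ t, (d t : ℤ) + ℓ' := by rw [← hℓ]; ring
  rw [h2] at h1
  exact h1

theorem cochainMap_mem_cocycles (α : M' →ₗ[Bᵐᵒᵖ] M) (β : N →ₗ[Bᵐᵒᵖ] N') {a c ℓ ℓ' : ℤ}
    (hα : ∀ i, ∀ m ∈ ℳ' i, α m ∈ ℳ (i + a)) (hβ : ∀ i, ∀ x ∈ 𝒩 i, β x ∈ 𝒩' (i + c))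
    (hℓ : ℓ + a + c = ℓ') (q : ℕ) :
    ∀ f ∈ cocycles 𝒜 ℳ 𝒩 q ℓ, cochainMap (k := k) α β q f ∈ cocycles 𝒜 ℳ' 𝒩' q ℓ' := by
  rintro f ⟨hf, hd⟩
  refine ⟨cochainMap_mem_cochains α β hα hβ hℓ q hf, ?_⟩
  rw [SetLike.mem_coe, LinearMap.mem_ker] at hd ⊢
  rw [← cochainMap_barDifferential, hd, map_zero]

theorem cochainMap_mem_coboundaries (α : M' →ₗ[Bᵐᵒᵖ] M) (β : N →ₗ[Bᵐᵒᵖ] N') {a c ℓ ℓ' : ℤ}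
    (hα : ∀ i, ∀ m ∈ ℳ' i, α m ∈ ℳ (i + a)) (hβ : ∀ i, ∀ x ∈ 𝒩 i, β x ∈ 𝒩' (i + c))
    (hℓ : ℓ + a + c = ℓ') (q : ℕ) :
    ∀ f ∈ coboundaries 𝒜 ℳ 𝒩 q ℓ,
      cochainMap (k := k) α β q f ∈ coboundaries 𝒜 ℳ' 𝒩' q ℓ' := by
  intro f hf
  cases q with
  | zero =>
    have hf0 : f = 0 := hf
    rw [hf0, map_zero]
    exact Submodule.zero_mem _
  | succ q =>
    obtain ⟨f', hf', rfl⟩ := hf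
    exact ⟨_, cochainMap_mem_cochains α β hα hβ hℓ q hf', (cochainMap_barDifferential α β q f').symm⟩

/-- Functoriality of graded `Ext`: a homogeneous homomorphism `α : M' → M` of degree `a` and a
homogeneous homomorphism `β : N → N'` of degree `c` induce
`\underline{Ext}^q(M, N)_ℓ → \underline{Ext}^q(M', N')_{ℓ + a + c}`. -/
def GExt.map (α : M' →ₗ[Bᵐᵒᵖ] M) (β : N →ₗ[Bᵐᵒᵖ] N') {a c ℓ ℓ' : ℤ}
    (hα : ∀ i, ∀ m ∈ ℳ' i, α m ∈ ℳ (i + a)) (hβ : ∀ i, ∀ x ∈ 𝒩 i, β x ∈ 𝒩' (i + c))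
    (hℓ : ℓ + a + c = ℓ') (q : ℕ) :
    GExt 𝒜 ℳ 𝒩 q ℓ →ₗ[k] GExt 𝒜 ℳ' 𝒩' q ℓ' :=
  Submodule.mapQ _ _
    ((cochainMap α β q).restrict (cochainMap_mem_cocycles α β hα hβ hℓ q))
    (fun f hf => cochainMap_mem_coboundaries α β hα hβ hℓ q f.1 hf)

end Cochains

section Gradings

variable {k B : Type*} [Field k] [Ring B] [Algebra k B] (𝒜 : ℕ → Submodule k B)

/-- The grading of `B` regarded as a `ℤ`-graded module over itself. -/
def intGrading : ℤ → Submodule k B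
  | Int.ofNat n => 𝒜 n
  | Int.negSucc _ => ⊥

/-- The induced grading of a submodule. -/
def subGrading {R M : Type*} [Ring R] [Algebra k R] [AddCommGroup M] [Module k M] [Module R M]
    [IsScalarTower k R M] (ℳ : ℤ → Submodule k M) (P : Submodule R M) : ℤ → Submodule k P :=
  fun i => (ℳ i).comap (P.subtype.restrictScalars k)

/-- The induced grading of a quotient module. -/
def quotGrading {R M : Type*} [Ring R] [Algebra k R] [AddCommGroup M] [Module k M] [Module R M]
    [IsScalarTower k R M] (ℳ : ℤ → Submodule k M) (P : Submodule R M) :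
    ℤ → Submodule k (M ⧸ P) :=
  fun i => (ℳ i).map (P.mkQ.restrictScalars k)

/-- `(M, ℳ)` is a `ℤ`-graded right `B`-module. -/
structure IsGradedRightModule {M : Type*} [AddCommGroup M] [Module k M] [Module Bᵐᵒᵖ M]
    (ℳ : ℤ → Submodule k M) : Prop where
  isInternal : DirectSum.IsInternal ℳ
  smul_mem : ∀ (n : ℕ) (i : ℤ) (b : B) (m : M), b ∈ 𝒜 n → m ∈ ℳ i → op b • m ∈ ℳ (i + n)

/-- The grading of the opposite algebra. -/
def opGrading (n : ℕ) : Submodule k Bᵐᵒᵖ :=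
  (𝒜 n).map (opLinearEquiv k : B ≃ₗ[k] Bᵐᵒᵖ).toLinearMap

variable [GradedAlgebra 𝒜]

instance opGrading.gradedMonoid : SetLike.GradedMonoid (opGrading 𝒜) where
  one_mem := ⟨1, SetLike.GradedOne.one_mem, rfl⟩
  mul_mem := by
    rintro i j _ _ ⟨x, hx, rfl⟩ ⟨y, hy, rfl⟩
    refine ⟨y * x, ?_, rfl⟩
    rw [add_comm]
    exact SetLike.GradedMul.mul_mem hy hx

/-- The identification of `𝒜 n` with the degree `n` part of `Bᵐᵒᵖ`. -/
def opPiece (n : ℕ) : 𝒜 n →ₗ[k] opGrading 𝒜 n :=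
  ((opLinearEquiv k : B ≃ₗ[k] Bᵐᵒᵖ).toLinearMap ∘ₗ (𝒜 n).subtype).codRestrict _
    fun x => ⟨x, x.2, rfl⟩

instance opGrading.gradedAlgebra : GradedAlgebra (opGrading 𝒜) where
  toDecomposition := DirectSum.Decomposition.ofLinearMap (opGrading 𝒜)
    ((DirectSum.toModule k ℕ _ fun i => DirectSum.lof k ℕ (fun n => opGrading 𝒜 n) i ∘ₗ opPiece 𝒜 i)
      ∘ₗ (DirectSum.decomposeLinearEquiv 𝒜).toLinearMap
      ∘ₗ (opLinearEquiv k : B ≃ₗ[k] Bᵐᵒᵖ).symm.toLinearMap)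
    (by
      refine LinearMap.ext fun x => ?_
      obtain ⟨b, rfl⟩ := op_surjective x
      induction b using DirectSum.Decomposition.inductionOn 𝒜 with
      | zero => simp
      | @homogeneous i m =>
        simp only [LinearMap.comp_apply, LinearEquiv.coe_coe, coe_opLinearEquiv_symm, unop_op,
          DirectSum.decomposeLinearEquiv_apply, DirectSum.decompose_coe]
        rw [← DirectSum.lof_eq_of k, DirectSum.toModule_lof]
        simp only [LinearMap.comp_apply, DirectSum.coeLinearMap_lof]
        rfl
      | add m m' h h' => rw [op_add, map_add, h, h', map_add])
    (by
      refine DirectSum.linearMap_ext _ fun i => LinearMap.ext fun x => ?_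
      obtain ⟨_, m, hm, rfl⟩ := x
      simp only [LinearMap.comp_apply, LinearEquiv.coe_coe, DirectSum.coeLinearMap_lof,
        coe_opLinearEquiv_symm, coe_opLinearEquiv, unop_op, LinearMap.id_apply,
        DirectSum.decomposeLinearEquiv_apply, DirectSum.decompose_of_mem _ hm]
      rw [← DirectSum.lof_eq_of k, DirectSum.toModule_lof]
      rfl)

theorem mul_component_eq_zero (x y : B) (i : ℕ)
    (h : (∀ j ≤ i, (DirectSum.decompose 𝒜 x j : B) = 0) ∨
      (∀ j ≤ i, (DirectSum.decompose 𝒜 y j : B) = 0)) :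
    (DirectSum.decompose 𝒜 (x * y) i : B) = 0 := by
  rw [DirectSum.decompose_mul, DirectSum.coe_mul_apply_eq_sum_antidiagonal]
  refine Finset.sum_eq_zero fun p hp => ?_
  have hp' := Finset.HasAntidiagonal.mem_antidiagonal.1 hp
  rcases h with h | h
  · rw [h p.1 (by omega), zero_mul]
  · rw [h p.2 (by omega), mul_zero]

/-- The ideal `B_{≥ r}`: all homogeneous components of degree less than `r` vanish. -/
def tailIdeal (r : ℕ) : Ideal B where
  carrier := {x | ∀ i < r, (DirectSum.decompose 𝒜 x i : B) = 0}
  zero_mem' := fun i _ => by simp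
  add_mem' := fun {x y} hx hy i hi => by simp [hx i hi, hy i hi]
  smul_mem' := fun c x hx i hi => mul_component_eq_zero 𝒜 c x i
    (Or.inr fun j hj => hx j (lt_of_le_of_lt hj hi))

instance tailIdeal.isTwoSided (r : ℕ) : (tailIdeal 𝒜 r).IsTwoSided where
  mul_mem_of_left := fun {x} c hx i hi => mul_component_eq_zero 𝒜 x c i
    (Or.inl fun j hj => hx j (lt_of_le_of_lt hj hi))

theorem tailIdeal_antitone : Antitone (tailIdeal 𝒜) :=
  fun _ _ h _ hx i hi => hx i (lt_of_lt_of_le hi h)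

theorem mul_mem_intGrading (a : ℕ) (b : B) (hb : b ∈ 𝒜 a) (i : ℤ) (x : B)
    (hx : x ∈ intGrading 𝒜 i) : b * x ∈ intGrading 𝒜 (i + a) := by
  cases i with
  | ofNat n =>
    have h : b * x ∈ 𝒜 (a + n) := SetLike.GradedMul.mul_mem hb hx
    rw [add_comm] at h
    exact h
  | negSucc n =>
    have hx0 : x = 0 := hx
    rw [hx0, mul_zero]
    exact Submodule.zero_mem _

/-- Left multiplication by `b`, as an endomorphism of the right module `B`. -/
def leftMul (b : B) : B →ₗ[Bᵐᵒᵖ] B where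
  toFun x := b * x
  map_add' := mul_add b
  map_smul' c x := (mul_assoc b x c.unop).symm

/-- A two-sided ideal as a right submodule of `B`. -/
def toRight (I : Ideal B) [I.IsTwoSided] : Submodule Bᵐᵒᵖ B where
  carrier := I
  zero_mem' := I.zero_mem
  add_mem' := I.add_mem
  smul_mem' c _ hx := I.mul_mem_right c.unop hx

/-- Left multiplication by `b` on the right module `B / I`, for a two-sided ideal `I`. -/
def leftMulQuot (I : Ideal B) [I.IsTwoSided] (b : B) : (B ⧸ toRight I) →ₗ[Bᵐᵒᵖ] (B ⧸ toRight I) :=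
  (toRight I).mapQ (toRight I) (leftMul b) fun _ hx => I.mul_mem_left b hx

/-- The projection `B / J → B / I` for `J ≤ I`. -/
def quotFactor (J I : Ideal B) [J.IsTwoSided] [I.IsTwoSided] (h : J ≤ I) :
    (B ⧸ toRight J) →ₗ[Bᵐᵒᵖ] (B ⧸ toRight I) :=
  (toRight J).mapQ (toRight I) LinearMap.id fun _ hx => h hx

theorem leftMulQuot_mem (I : Ideal B) [I.IsTwoSided] (a : ℕ) (b : B) (hb : b ∈ 𝒜 a) (i : ℤ)
    (x : B ⧸ toRight I) (hx : x ∈ quotGrading (intGrading 𝒜) (toRight I) i) :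
    leftMulQuot I b x ∈ quotGrading (intGrading 𝒜) (toRight I) (i + a) := by
  obtain ⟨y, hy, rfl⟩ := hx
  exact ⟨b * y, mul_mem_intGrading 𝒜 a b hb i y hy, rfl⟩

theorem quotFactor_mem (J I : Ideal B) [J.IsTwoSided] [I.IsTwoSided] (h : J ≤ I) (i : ℤ)
    (x : B ⧸ toRight J) (hx : x ∈ quotGrading (intGrading 𝒜) (toRight J) i) :
    quotFactor J I h x ∈ quotGrading (intGrading 𝒜) (toRight I) (i + 0) := by
  obtain ⟨y, hy, rfl⟩ := hx
  rw [add_zero]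
  exact ⟨y, hy, rfl⟩

theorem id_mem {M : Type*} [AddCommGroup M] [Module k M] [Module Bᵐᵒᵖ M] (ℳ : ℤ → Submodule k M)
    (i : ℤ) (x : M) (hx : x ∈ ℳ i) : (LinearMap.id : M →ₗ[Bᵐᵒᵖ] M) x ∈ ℳ (i + 0) := by
  rw [add_zero]
  exact hx

end Gradings

section LocalCohomology

variable {k B : Type*} [Field k] [Ring B] [Algebra k B] (𝒜 : ℕ → Submodule k B) [GradedAlgebra 𝒜]
variable (I : ℕ → Ideal B) [∀ r, (I r).IsTwoSided] (hI : Antitone I)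
variable {M : Type*} [AddCommGroup M] [Module k M] [Module Bᵐᵒᵖ M] [IsScalarTower k Bᵐᵒᵖ M]
  (ℳ : ℤ → Submodule k M)

/-- The transition map `\underline{Ext}^q(B / I_r, M)_ℓ → \underline{Ext}^q(B / I_s, M)_ℓ`. -/
def transition (q : ℕ) (ℓ : ℤ) (r s : ℕ) (h : r ≤ s) :
    GExt 𝒜 (quotGrading (intGrading 𝒜) (toRight (I r))) ℳ q ℓ →ₗ[k]
      GExt 𝒜 (quotGrading (intGrading 𝒜) (toRight (I s))) ℳ q ℓ :=
  GExt.map (quotFactor (I s) (I r) (hI h)) LinearMap.id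
    (quotFactor_mem 𝒜 (I s) (I r) (hI h)) (id_mem ℳ) (by ring) q

/-- The degree `ℓ` component of `H^q(M) = \varinjlim_r \underline{Ext}^q_B(B / I_r, M)`, for a
descending chain of two-sided ideals `I_r`. -/
abbrev LocalCohomology (q : ℕ) (ℓ : ℤ) : Type _ :=
  Module.DirectLimit (fun r => GExt 𝒜 (quotGrading (intGrading 𝒜) (toRight (I r))) ℳ q ℓ)
    (transition 𝒜 I hI ℳ q ℓ)

/-- The right `B`-module structure of `H^q(M)`: a homogeneous `b ∈ B` of degree `a` acts through left
multiplication by `b` on the bimodules `B / I_r`. -/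
def LocalCohomology.act (q : ℕ) (ℓ : ℤ) (a : ℕ) (b : B) (hb : b ∈ 𝒜 a) :
    LocalCohomology 𝒜 I hI ℳ q ℓ →ₗ[k] LocalCohomology 𝒜 I hI ℳ q (ℓ + a) :=
  Module.DirectLimit.map
    (fun r => GExt.map (leftMulQuot (I r) b) LinearMap.id (leftMulQuot_mem 𝒜 (I r) a b hb)
      (id_mem ℳ) (by ring) q)
    (by
      intro r s h
      refine LinearMap.ext fun x => ?_
      obtain ⟨f, rfl⟩ := Submodule.Quotient.mk_surjective _ x
      refine congrArg (Submodule.Quotient.mk) (Subtype.ext ?_)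
      funext m g
      obtain ⟨y, rfl⟩ := Submodule.Quotient.mk_surjective _ m
      rfl)

end LocalCohomology

end GradedExt

open GradedExt

section Notions

variable {k B : Type*} [Field k] [Ring B] [Algebra k B] (𝒜 : ℕ → Submodule k B) [GradedAlgebra 𝒜]

/-- The graded simple right module `eB / (eB)_{≥ 1}`. -/
abbrev RightSimple (e : B) : Type _ :=
  ↥(Submodule.span Bᵐᵒᵖ {e}) ⧸
    (toRight (tailIdeal 𝒜 1)).submoduleOf (Submodule.span Bᵐᵒᵖ {e})

def rightSimpleGrading (e : B) : ℤ → Submodule k (RightSimple 𝒜 e) :=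
  quotGrading (subGrading (intGrading 𝒜) (Submodule.span Bᵐᵒᵖ {e})) _

/-- The graded simple left module `Be / (Be)_{≥ 1}`. -/
abbrev LeftSimple (e : B) : Type _ :=
  ↥(Submodule.span B {e}) ⧸ Submodule.submoduleOf (tailIdeal 𝒜 1) (Submodule.span B {e})

def leftSimpleGrading (e : B) : ℤ → Submodule k (LeftSimple 𝒜 e) :=
  quotGrading (subGrading (intGrading 𝒜) (Submodule.span B {e})) _

/-- The degree `m` component of the graded Matlis dual `\underline{Hom}_k(Be, k)`: linear forms on
`Be` that vanish on all homogeneous components `(Be)_i` with `i ≠ -m`. -/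
def matlisDual (e : B) (m : ℤ) : Submodule k (Module.Dual k ↥(Submodule.span B {e})) where
  carrier := {ψ | ∀ i, i ≠ -m → ∀ x ∈ subGrading (intGrading 𝒜) (Submodule.span B {e}) i, ψ x = 0}
  zero_mem' := fun _ _ _ _ => rfl
  add_mem' := fun {ψ ψ'} h h' i hi x hx => by
    rw [LinearMap.add_apply, h i hi x hx, h' i hi x hx, add_zero]
  smul_mem' := fun c ψ h i hi x hx => by
    rw [LinearMap.smul_apply, h i hi x hx, smul_zero]

/-- The `χ`-condition for right modules: `\underline{Ext}^j_B(B / B_{≥ 1}, M)` is bounded for all `j`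
and all finitely generated graded right modules `M`. -/
def ChiCondition.{v} {k : Type*} {B : Type v} [Field k] [Ring B] [Algebra k B]
    (𝒜 : ℕ → Submodule k B) [GradedAlgebra 𝒜] : Prop :=
  ∀ (M : Type v) [AddCommGroup M] [Module k M] [Module Bᵐᵒᵖ M] [IsScalarTower k Bᵐᵒᵖ M]
    (ℳ : ℤ → Submodule k M), IsGradedRightModule 𝒜 ℳ → Module.Finite Bᵐᵒᵖ M →
    ∀ j : ℕ, ∃ c : ℤ, ∀ ℓ : ℤ, c ≤ |ℓ| →
      Subsingleton (GExt 𝒜 (quotGrading (intGrading 𝒜) (toRight (tailIdeal 𝒜 1))) ℳ j ℓ)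

/-- `B` is generalized Gorenstein with respect to the idempotents `e j ∈ B_0`, of injective dimension
`N`, with permutation `σ` and shifts `s`: the right module `B` has injective dimension `N`, and
`\underline{Ext}^i_B(S_j, B)` vanishes for `i ≠ N` and is isomorphic, as a graded left `B`-module, to
`S^∨_{σ(j)}[s_j]` for `i = N`.  Here `B` acts on `\underline{Ext}^i_B(S_j, B)` through left
multiplication on the second argument. -/
structure IsGeneralizedGorenstein {n : ℕ} (e : Fin n → B) (N : ℕ) (σ : Equiv.Perm (Fin n))
    (s : Fin n → ℤ) : Prop where
  injdim : CategoryTheory.injectiveDimension (ModuleCat.of Bᵐᵒᵖ B) = N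
  ext_of_ne : ∀ (j : Fin n) (i : ℕ) (ℓ : ℤ), i ≠ N →
    Subsingleton (GExt 𝒜 (rightSimpleGrading 𝒜 (e j)) (intGrading 𝒜) i ℓ)
  ext_iso : ∀ j : Fin n,
    ∃ φ : (ℓ : ℤ) → GExt 𝒜 (rightSimpleGrading 𝒜 (e j)) (intGrading 𝒜) N ℓ ≃ₗ[k]
        leftSimpleGrading 𝒜 (e (σ j)) (s j + ℓ),
      ∀ (ℓ : ℤ) (a : ℕ) (b : B) (hb : b ∈ 𝒜 a)
        (x : GExt 𝒜 (rightSimpleGrading 𝒜 (e j)) (intGrading 𝒜) N ℓ),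
        (φ (ℓ + a) (GExt.map LinearMap.id (leftMul b) (id_mem _) (mul_mem_intGrading 𝒜 a b hb)
            (by ring) N x) : LeftSimple 𝒜 (e (σ j)))
          = b • (φ ℓ x : LeftSimple 𝒜 (e (σ j)))

/-- The degree `ℓ` component of `H^q_𝔯(B) = \varinjlim_r \underline{Ext}^q_B(B / B_{≥ r}, B)`. -/
abbrev TailCohomology (q : ℕ) (ℓ : ℤ) : Type _ :=
  LocalCohomology 𝒜 (tailIdeal 𝒜) (tailIdeal_antitone 𝒜) (intGrading 𝒜) q ℓ

/-- The degree `ℓ` component of `\varinjlim_r \underline{Ext}^q_B(B / 𝔲^r, B)`, `𝔲 = B_{≥ 1}`. -/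
abbrev PowCohomology (q : ℕ) (ℓ : ℤ) : Type _ :=
  LocalCohomology 𝒜 (fun r => tailIdeal 𝒜 1 ^ r) (fun _ _ h => Ideal.pow_le_pow_right h)
    (intGrading 𝒜) q ℓ

/-- The AS-Cohen-Macaulay condition. -/
def IsASCohenMacaulay : Prop :=
  ∃ N : ℤ, ∀ i : ℕ, (i : ℤ) ≠ N →
    (∀ ℓ : ℤ, Subsingleton (PowCohomology 𝒜 i ℓ)) ∧
      ∀ ℓ : ℤ, Subsingleton (PowCohomology (opGrading 𝒜) i ℓ)

end Notions

end

set_option linter.unusedSectionVars false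

noncomputable section

open MulOpposite

universe w w₁ w₂ w₃ w₄ w₅

namespace GradedExt

/-! ### The bar complex: recursion on the first algebra argument. -/

section Bar

variable {k B : Type*} [Field k] [Ring B] [Algebra k B]
variable {M N : Type*}
  [AddCommGroup M] [Module k M] [Module Bᵐᵒᵖ M]
  [AddCommGroup N] [Module k N] [Module Bᵐᵒᵖ N] [IsScalarTower k Bᵐᵒᵖ N]

/-! Filter `B / B_{≥ r}` by the layers `B_{≥ t} / B_{≥ t+1}`, `t < r`. Each layer is a finite sum of
shifted simples `S_j`, because `B_{≥ 1}` kills it and `B_0 = k^n`. The Gorenstein hypothesis enters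
through one consequence: `Ext^i(S_j, B)` vanishes for `i ≠ N` and is a line in degree `-s_j` for `i
= N` (`IsExtConcentrated`). Long exact sequences give `Ext^i(B / B_{≥ r}, B) = 0` for `i ≠ N`, hence
the vanishing of `H^i`. They also show that the transition maps on `Ext^N` are injective, and that
every `Ext^N` class on the layer `B_{≥ r} / B_{≥ r+1}` extends to `B / B_{≥ r+1}`.

The isomorphism with the Matlis dual comes from a pairing. The generator of `Ext^N(S_j, B)` survives
in `H^N`, so there is a linear form `f_j` on `H^N` in degree `-s_j` with value 1 on it. Send `x` to
the family of forms `y ↦ f_b(x y)` on `B e_b`. Associativity makes this right linear. The pairing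
with elements of `B_r e_j` reads off exactly the restriction of a class to the layer `B_{≥ r} / B_{≥
r+1}` (`simpleLevel_restrict`, `pairing_mul_idempotent`). Injectivity (`level_eq_zero`) and
surjectivity (`exists_level_pairing`) then follow by induction along the filtration.

For the Cohen–Macaulay statement over `B`, the powers of `B_{≥ 1}` are cofinal with the ideals `B_{≥
r}`, as `B` is noetherian. Over the opposite algebra `A`, vanishing is transferred from `B` by a
double complex with coefficients in the bimodule `B` (`subsingleton_of_comparison`). Cochains in two
variables attached to `A / A_{≥ r}` and `B / B_{≥ t}` compare with those attached to `(A / A_{≥ r},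
B)`, which compute `Ext_A(A / A_{≥ r}, B)`, and with those attached to `(A, B / B_{≥ t})`, which
compute `Ext_B(B / B_{≥ t}, B)`. The error terms involve `B_{≥ t}` and `A_{≥ r}`. They are acyclic
in the range needed once `t` and `r` are large, because the relevant `Ext` groups vanish in high
degrees: over `A` by the χ-condition, over `B` by the Gorenstein hypothesis. So `Ext_A^n(A / A_{≥
r}, B)` in degree `ℓ` vanishes whenever `Ext_B^n(B / B_{≥ t}, B)` in degree `ℓ` does. -/

theorem contractNth_succ_castSucc_cons {q : ℕ} (j : Fin q) (b : B) (g : Fin (q + 1) → B) :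
    Fin.contractNth j.succ.castSucc (· * ·) (Fin.cons b g : Fin (q + 2) → B)
      = Fin.cons b (Fin.contractNth j.castSucc (· * ·) g) := by
  funext t
  refine Fin.cases ?_ (fun t => ?_) t
  · rw [Fin.contractNth_apply_of_lt _ _ _ _ (by simp)]
    rfl
  · rw [Fin.cons_succ]
    rcases lt_trichotomy (t : ℕ) (j : ℕ) with h | h | h
    · rw [Fin.contractNth_apply_of_lt _ _ _ _ (by simpa using h),
        Fin.contractNth_apply_of_lt _ _ _ _ (by simpa using h)]
      rfl
    · rw [Fin.contractNth_apply_of_eq _ _ _ _ (by simpa using h),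
        Fin.contractNth_apply_of_eq _ _ _ _ (by simpa using h)]
      rfl
    · rw [Fin.contractNth_apply_of_gt _ _ _ _ (by simpa using h),
        Fin.contractNth_apply_of_gt _ _ _ _ (by simpa using h)]
      rfl

theorem contractNth_zero_cons {q : ℕ} (b : B) (g : Fin (q + 1) → B) :
    Fin.contractNth (0 : Fin (q + 1)).castSucc (· * ·) (Fin.cons b g : Fin (q + 2) → B)
      = Fin.cons (b * g 0) (Fin.tail g) := by
  funext t
  refine Fin.cases ?_ (fun t => ?_) t
  · rw [Fin.contractNth_apply_of_eq _ _ _ _ (by simp)]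
    rfl
  · rw [Fin.contractNth_apply_of_gt _ _ _ _ (by simp)]
    rfl

theorem init_cons_succ {q : ℕ} (b : B) (g : Fin (q + 1) → B) :
    Fin.init (Fin.cons b g : Fin (q + 2) → B) = Fin.cons b (Fin.init g) := by
  funext t
  refine Fin.cases ?_ (fun t => ?_) t <;> rfl

variable (k)

/-- Fixing the module argument of a cochain, its first algebra argument becomes the module
argument. -/
def slice {q : ℕ} (f : M → (Fin (q + 1) → B) → N) (m : M) : B → (Fin q → B) → N :=
  fun b g => f m (Fin.cons b g)

theorem barDifferential_zero (f : M → (Fin 0 → B) → N) (m : M) (g : Fin 1 → B) :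
    barDifferential k 0 f m g = f (op (g 0) • m) Fin.elim0 - op (g 0) • f m Fin.elim0 := by
  have h : ∀ g' : Fin 0 → B, g' = Fin.elim0 := fun g' => Subsingleton.elim _ _
  simp [barDifferential, h (Fin.tail g), h (Fin.init g), sub_eq_add_neg]

/-- The recursion behind all inductions on the bar complex: freezing `m` turns a cochain on `M` into
one on the regular module with one argument fewer. Proofs about arbitrary `M` thereby reduce to `M =
B`, where the induction closes. -/
theorem barDifferential_cons {q : ℕ} (f : M → (Fin (q + 1) → B) → N) (m : M) (b : B)
    (g : Fin (q + 1) → B) :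
    barDifferential k (q + 1) f m (Fin.cons b g)
      = f (op b • m) g - barDifferential k q (slice f m) b g := by
  simp only [barDifferential, LinearMap.coe_mk, AddHom.coe_mk, Fin.cons_zero, Fin.tail_cons, slice]
  rw [Fin.sum_univ_succ, contractNth_zero_cons, init_cons_succ]
  simp only [contractNth_succ_castSucc_cons]
  have hl : (Fin.cons b g : Fin (q + 2) → B) (Fin.last (q + 1)) = g (Fin.last q) := rfl
  rw [hl]
  have hs : ∀ j : Fin q, (-1 : ℤ) ^ (((j.succ : Fin (q + 1)) : ℕ) + 1) •
      f m (Fin.cons b (Fin.contractNth j.castSucc (· * ·) g))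
      = -((-1 : ℤ) ^ ((j : ℕ) + 1) •
        f m (Fin.cons b (Fin.contractNth j.castSucc (· * ·) g))) := by
    intro j
    rw [Fin.val_succ, pow_succ (-1 : ℤ) (_ + 1), mul_neg_one, neg_smul]
  simp only [hs, Finset.sum_neg_distrib]
  have hb : op (g 0) • b = b * g 0 := rfl
  rw [hb, pow_succ (-1 : ℤ) (q + 1), mul_neg_one, neg_smul]
  simp
  abel

theorem slice_barDifferential {q : ℕ} (f : M → (Fin (q + 1) → B) → N) (m : M) :
    slice (barDifferential k (q + 1) f) m
      = (fun b => f (op b • m)) - barDifferential k q (slice f m) := by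
  funext b g
  exact barDifferential_cons k f m b g

theorem barDifferential_comp_smul {q : ℕ} (f : M → (Fin q → B) → N) (m : M) :
    barDifferential k q (fun b : B => f (op b • m)) = fun b => barDifferential k q f (op b • m) := by
  funext b g
  simp only [barDifferential, LinearMap.coe_mk, AddHom.coe_mk]
  have : op (op (g 0) • b) • m = op (g 0) • op b • m := by
    rw [smul_smul]; rfl
  rw [this]

theorem barDifferential_comp_self_zero (f : M → (Fin 0 → B) → N) :
    barDifferential k 1 (barDifferential k 0 f) = 0 := by
  funext m g
  obtain ⟨b, g, rfl⟩ : ∃ b g', g = Fin.cons b g' := ⟨g 0, Fin.tail g, (Fin.cons_self_tail g).symm⟩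
  rw [barDifferential_cons, barDifferential_zero, barDifferential_zero]
  simp only [slice, barDifferential_zero, Fin.cons_zero]
  have : op (op (g 0) • b) • m = op (g 0) • op b • m := by
    rw [smul_smul]; rfl
  rw [this]
  have : op (op (g 0) • b) • f m Fin.elim0 = op (g 0) • op b • f m Fin.elim0 := by
    rw [smul_smul]; rfl
  rw [this, smul_sub]
  simp

/-- The orbit map `b ↦ m b` is right linear, so `d` commutes with pulling back along it. In the
recursion for `d (d f)` the two pulled-back terms cancel, and only `d d` of the slice remains. -/
theorem barDifferential_step {q : ℕ} (f : M → (Fin (q + 1) → B) → N)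
    (h : ∀ m, barDifferential k (q + 1) (barDifferential k q (slice f m)) = 0) :
    barDifferential k (q + 2) (barDifferential k (q + 1) f) = 0 := by
  funext m g
  obtain ⟨b, g, rfl⟩ : ∃ b g', g = Fin.cons b g' := ⟨g 0, Fin.tail g, (Fin.cons_self_tail g).symm⟩
  rw [barDifferential_cons, slice_barDifferential, map_sub, h m, barDifferential_comp_smul]
  simp

theorem barDifferential_comp_self_regular (q : ℕ) (f : B → (Fin q → B) → N) :
    barDifferential k (q + 1) (barDifferential k q f) = 0 := by
  induction q with
  | zero => exact barDifferential_comp_self_zero k f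
  | succ q ih => exact barDifferential_step k f fun m => ih _

/-- The bar differential squares to zero. -/
theorem barDifferential_comp_self (q : ℕ) (f : M → (Fin q → B) → N) :
    barDifferential k (q + 1) (barDifferential k q f) = 0 := by
  cases q with
  | zero => exact barDifferential_comp_self_zero k f
  | succ q => exact barDifferential_step k f fun m => barDifferential_comp_self_regular k q _

/-- The contracting homotopy of the bar complex of the regular module. -/
theorem barDifferential_slice_one {q : ℕ} (f : B → (Fin (q + 1) → B) → N) :
    barDifferential k q (slice f 1) = f - slice (barDifferential k (q + 1) f) 1 := by
  rw [slice_barDifferential]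
  have : (fun b : B => f (op b • (1 : B))) = f := by
    funext b
    have : op b • (1 : B) = b := one_mul b
    rw [this]
  rw [this]
  abel

variable {k} [IsScalarTower k Bᵐᵒᵖ M]

theorem op_smul_smul_comm (c : k) (b : B) (x : M) : op b • c • x = c • op b • x := by
  rw [← algebraMap_smul Bᵐᵒᵖ c x, ← algebraMap_smul Bᵐᵒᵖ c (op b • x), smul_smul, smul_smul,
    Algebra.commutes]

/-- The map `b ↦ m b`. -/
def orbitMap (k : Type*) {B M : Type*} [Field k] [Ring B] [Algebra k B] [AddCommGroup M]
    [Module k M] [Module Bᵐᵒᵖ M] [IsScalarTower k Bᵐᵒᵖ M] (m : M) : B →ₗ[k] M where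
  toFun b := op b • m
  map_add' x y := by rw [op_add, add_smul]
  map_smul' c x := by rw [op_smul, RingHom.id_apply, smul_assoc]

theorem exists_multilinear_zero (φ : M →ₗ[k] MultilinearMap k (fun _ : Fin 0 => B) N) :
    ∃ φ' : M →ₗ[k] MultilinearMap k (fun _ : Fin 1 => B) N,
      ∀ m g, φ' m g = barDifferential k 0 (fun m g => φ m g) m g := by
  let L : M → B →ₗ[k] N := fun m =>
    { toFun := fun b => φ (op b • m) Fin.elim0 - op b • φ m Fin.elim0
      map_add' := fun x y => by
        rw [op_add, add_smul, add_smul, map_add, add_apply]; abel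
      map_smul' := fun c x => by
        rw [op_smul, smul_assoc, smul_assoc, map_smul, smul_apply,
          RingHom.id_apply, smul_sub] }
  have hL : ∀ m b, L m b = φ (op b • m) Fin.elim0 - op b • φ m Fin.elim0 := fun _ _ => rfl
  refine ⟨⟨⟨fun m => (MultilinearMap.ofSubsingleton k B N (0 : Fin 1)) (L m), fun x y => ?_⟩,
    fun c x => ?_⟩, fun m g => ?_⟩
  · ext g
    simp only [MultilinearMap.ofSubsingleton_apply_apply, add_apply, hL]
    rw [smul_add, map_add, map_add, add_apply, add_apply, smul_add]
    abel
  · ext g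
    simp only [MultilinearMap.ofSubsingleton_apply_apply, smul_apply, hL,
      RingHom.id_apply]
    rw [op_smul_smul_comm, φ.map_smul, φ.map_smul, smul_apply, smul_apply, op_smul_smul_comm, smul_sub]
  · rw [barDifferential_zero]
    rfl

theorem exists_multilinear_step {q : ℕ}
    (ih : ∀ φ : B →ₗ[k] MultilinearMap k (fun _ : Fin q => B) N,
      ∃ φ' : B →ₗ[k] MultilinearMap k (fun _ : Fin (q + 1) => B) N,
      ∀ m g, φ' m g = barDifferential k q (fun m g => φ m g) m g)
    (φ : M →ₗ[k] MultilinearMap k (fun _ : Fin (q + 1) => B) N) :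
    ∃ φ' : M →ₗ[k] MultilinearMap k (fun _ : Fin (q + 2) => B) N,
      ∀ m g, φ' m g = barDifferential k (q + 1) (fun m g => φ m g) m g := by
  -- The witnesses `ψ m` are chosen for each `m` separately; linearity in `m` is recovered
  -- afterwards from the explicit values in `hval`.
  choose ψ hψ using fun m => ih (φ m).curryLeft
  have hval : ∀ (m : M) (g : Fin (q + 2) → B),
      (LinearMap.uncurryLeft (φ.comp (orbitMap k (B := B) m) - ψ m) :
        MultilinearMap k (fun _ : Fin (q + 2) => B) N) g
      = barDifferential k (q + 1) (fun m g => φ m g) m g := by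
    intro m g
    obtain ⟨b, g, rfl⟩ : ∃ b g', g = Fin.cons b g' :=
      ⟨g 0, Fin.tail g, (Fin.cons_self_tail g).symm⟩
    rw [barDifferential_cons, LinearMap.uncurryLeft_apply]
    simp only [Fin.cons_zero, Fin.tail_cons, LinearMap.sub_apply, _root_.sub_apply, hψ]
    rfl
  refine ⟨⟨⟨fun m => (LinearMap.uncurryLeft (φ.comp (orbitMap k (B := B) m) - ψ m) :
      MultilinearMap k (fun _ : Fin (q + 2) => B) N), fun x y => ?_⟩,
    fun c x => ?_⟩, hval⟩
  · ext g
    obtain ⟨b, g, rfl⟩ : ∃ b g', g = Fin.cons b g' :=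
      ⟨g 0, Fin.tail g, (Fin.cons_self_tail g).symm⟩
    rw [add_apply, hval, hval, hval]
    simp only [barDifferential_cons]
    have : slice (fun m g => φ m g) (x + y)
        = slice (fun m g => φ m g) x + slice (fun m g => φ m g) y := by
      funext b g
      simp [slice]
    rw [this, map_add, smul_add, map_add]
    simp only [add_apply, Pi.add_apply]
    abel
  · ext g
    obtain ⟨b, g, rfl⟩ : ∃ b g', g = Fin.cons b g' :=
      ⟨g 0, Fin.tail g, (Fin.cons_self_tail g).symm⟩
    rw [RingHom.id_apply, smul_apply, hval, hval]
    simp only [barDifferential_cons]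
    have : slice (fun m g => φ m g) (c • x) = c • slice (fun m g => φ m g) x := by
      funext b g
      simp [slice]
    rw [this, (barDifferential k q).map_smul, op_smul_smul_comm, φ.map_smul]
    simp only [smul_apply, Pi.smul_apply, smul_sub]

theorem exists_multilinear_regular (q : ℕ)
    (φ : B →ₗ[k] MultilinearMap k (fun _ : Fin q => B) N) :
    ∃ φ' : B →ₗ[k] MultilinearMap k (fun _ : Fin (q + 1) => B) N,
      ∀ m g, φ' m g = barDifferential k q (fun m g => φ m g) m g := by
  induction q with
  | zero => exact exists_multilinear_zero φ
  | succ q ih => exact exists_multilinear_step ih φ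

/-- The bar differential of a multilinear map is multilinear. -/
theorem exists_multilinear_barDifferential (q : ℕ)
    (φ : M →ₗ[k] MultilinearMap k (fun _ : Fin q => B) N) :
    ∃ φ' : M →ₗ[k] MultilinearMap k (fun _ : Fin (q + 1) => B) N,
      ∀ m g, φ' m g = barDifferential k q (fun m g => φ m g) m g := by
  cases q with
  | zero => exact exists_multilinear_zero φ
  | succ q => exact exists_multilinear_step (exists_multilinear_regular q) φ

variable {𝒜 : ℕ → Submodule k B} {ℳ : ℤ → Submodule k M} {𝒩 : ℤ → Submodule k N}

/-- The action of `B` on `M` is compatible with the gradings. -/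
def GradedAction (𝒜 : ℕ → Submodule k B) (ℳ : ℤ → Submodule k M) : Prop :=
  ∀ (n : ℕ) (i : ℤ) (b : B) (m : M), b ∈ 𝒜 n → m ∈ ℳ i → op b • m ∈ ℳ (i + n)

/-- The homogeneity condition in the definition of `cochains`. -/
def IsHomogeneousCochain (𝒜 : ℕ → Submodule k B) (ℳ : ℤ → Submodule k M) (𝒩 : ℤ → Submodule k N)
    (q : ℕ) (ℓ : ℤ) (f : M → (Fin q → B) → N) : Prop :=
  ∀ (i : ℤ) (m : M) (d : Fin q → ℕ) (g : Fin q → B), m ∈ ℳ i → (∀ t, g t ∈ 𝒜 (d t)) →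
      f m g ∈ 𝒩 (i + ∑ t, (d t : ℤ) + ℓ)

/-- Freezing an argument of degree `i` raises the degree of the cochain by `i`. The hypothesis `h0`
covers the negative degrees of `intGrading 𝒜`, where the new module argument can only be zero. -/
theorem IsHomogeneousCochain.slice {q : ℕ} {ℓ i : ℤ} {f : M → (Fin (q + 1) → B) → N}
    (hf : IsHomogeneousCochain 𝒜 ℳ 𝒩 (q + 1) ℓ f) (h0 : ∀ m g, f m (Fin.cons 0 g) = 0) {m : M}
    (hm : m ∈ ℳ i) :
    IsHomogeneousCochain 𝒜 (intGrading 𝒜) 𝒩 q (ℓ + i) (slice f m) := by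
  intro j b d g hb hg
  cases j with
  | ofNat j =>
    have := hf i m (Fin.cons j d) (Fin.cons b g) hm
      (fun t => by refine Fin.cases ?_ (fun t => ?_) t; exacts [hb, hg t])
    rw [Fin.sum_univ_succ] at this
    simp only [Fin.cons_zero, Fin.cons_succ] at this
    have h2 : Int.ofNat j + ∑ t, (d t : ℤ) + (ℓ + i) = i + (j + ∑ t, (d t : ℤ)) + ℓ := by
      simp only [Int.ofNat_eq_natCast]
      ring
    rw [h2]
    exact this
  | negSucc j =>
    have hb0 : b = 0 := hb
    rw [hb0]
    show f m (Fin.cons 0 g) ∈ _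
    rw [h0]
    exact Submodule.zero_mem _

theorem gradedAction_intGrading [SetLike.GradedMul 𝒜] : GradedAction 𝒜 (intGrading 𝒜) := by
  intro n i b m hb hm
  cases i with
  | ofNat j => exact (SetLike.GradedMul.mul_mem hm hb : m * b ∈ 𝒜 (j + n))
  | negSucc j =>
    have hm0 : m = 0 := hm
    rw [hm0, smul_zero]
    exact Submodule.zero_mem _

theorem isHomogeneousCochain_barDifferential_zero (hM : GradedAction 𝒜 ℳ) (hN : GradedAction 𝒜 𝒩)
    {ℓ : ℤ} {f : M → (Fin 0 → B) → N} (hf : IsHomogeneousCochain 𝒜 ℳ 𝒩 0 ℓ f) :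
    IsHomogeneousCochain 𝒜 ℳ 𝒩 1 ℓ (barDifferential k 0 f) := by
  intro i m d g hm hg
  rw [barDifferential_zero]
  have h1 := hf _ _ Fin.elim0 Fin.elim0 (hM _ _ _ _ (hg 0) hm) (fun t => t.elim0)
  have h2 := hN _ _ _ _ (hg 0) (hf _ _ Fin.elim0 Fin.elim0 hm (fun t => t.elim0))
  refine Submodule.sub_mem _ ?_ ?_
  · convert h1 using 2
    simp
  · convert h2 using 2
    simp
    ring

theorem isHomogeneousCochain_barDifferential_step (hM : GradedAction 𝒜 ℳ) {q : ℕ}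
    (ih : ∀ ⦃ℓ : ℤ⦄ (f : B → (Fin q → B) → N),
      (∃ φ : B →ₗ[k] MultilinearMap k (fun _ : Fin q => B) N, ∀ m g, f m g = φ m g) →
      IsHomogeneousCochain 𝒜 (intGrading 𝒜) 𝒩 q ℓ f →
      IsHomogeneousCochain 𝒜 (intGrading 𝒜) 𝒩 (q + 1) ℓ (barDifferential k q f))
    {ℓ : ℤ} {f : M → (Fin (q + 1) → B) → N}
    (hφ : ∃ φ : M →ₗ[k] MultilinearMap k (fun _ : Fin (q + 1) => B) N, ∀ m g, f m g = φ m g)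
    (hf : IsHomogeneousCochain 𝒜 ℳ 𝒩 (q + 1) ℓ f) :
    IsHomogeneousCochain 𝒜 ℳ 𝒩 (q + 2) ℓ (barDifferential k (q + 1) f) := by
  obtain ⟨φ, hφ⟩ := hφ
  intro i m d g hm hg
  obtain ⟨b, g, rfl⟩ : ∃ b g', g = Fin.cons b g' := ⟨g 0, Fin.tail g, (Fin.cons_self_tail g).symm⟩
  have hb : b ∈ 𝒜 (d 0) := hg 0
  have hg' : ∀ t, g t ∈ 𝒜 (d t.succ) := fun t => hg t.succ
  rw [barDifferential_cons, Fin.sum_univ_succ]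
  have h1 := hf _ _ _ _ (hM _ _ _ _ hb hm) hg'
  have h0 : ∀ m g, f m (Fin.cons 0 g) = 0 := fun m g => by
    rw [hφ]
    exact (φ m).map_coord_zero 0 rfl
  have h2 := ih (slice f m) ⟨(φ m).curryLeft, fun b g => hφ m _⟩ (hf.slice h0 hm) (d 0 : ℤ) b _ g
    hb hg'
  refine Submodule.sub_mem _ ?_ ?_
  · convert h1 using 2
    ring
  · convert h2 using 2
    ring

theorem isHomogeneousCochain_barDifferential [SetLike.GradedMul 𝒜] (hM : GradedAction 𝒜 ℳ)
    (hN : GradedAction 𝒜 𝒩) {q : ℕ} {ℓ : ℤ} {f : M → (Fin q → B) → N}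
    (hφ : ∃ φ : M →ₗ[k] MultilinearMap k (fun _ : Fin q => B) N, ∀ m g, f m g = φ m g)
    (hf : IsHomogeneousCochain 𝒜 ℳ 𝒩 q ℓ f) :
    IsHomogeneousCochain 𝒜 ℳ 𝒩 (q + 1) ℓ (barDifferential k q f) := by
  have key : ∀ (q : ℕ) ⦃ℓ : ℤ⦄ (f : B → (Fin q → B) → N),
      (∃ φ : B →ₗ[k] MultilinearMap k (fun _ : Fin q => B) N, ∀ m g, f m g = φ m g) →
      IsHomogeneousCochain 𝒜 (intGrading 𝒜) 𝒩 q ℓ f →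
      IsHomogeneousCochain 𝒜 (intGrading 𝒜) 𝒩 (q + 1) ℓ (barDifferential k q f) := by
    intro q
    induction q with
    | zero => exact fun ℓ f _ hf =>
        isHomogeneousCochain_barDifferential_zero gradedAction_intGrading hN hf
    | succ q ih => exact fun ℓ f hφ hf =>
        isHomogeneousCochain_barDifferential_step gradedAction_intGrading ih hφ hf
  cases q with
  | zero => exact isHomogeneousCochain_barDifferential_zero hM hN hf
  | succ q => exact isHomogeneousCochain_barDifferential_step hM (key q) hφ hf

theorem barDifferential_mem_cochains [SetLike.GradedMul 𝒜] (hM : GradedAction 𝒜 ℳ)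
    (hN : GradedAction 𝒜 𝒩) {q : ℕ} {ℓ : ℤ} {f : M → (Fin q → B) → N}
    (hf : f ∈ cochains 𝒜 ℳ 𝒩 q ℓ) : barDifferential k q f ∈ cochains 𝒜 ℳ 𝒩 (q + 1) ℓ := by
  refine ⟨?_, isHomogeneousCochain_barDifferential hM hN hf.1 hf.2⟩
  obtain ⟨φ, hφ⟩ := hf.1
  obtain ⟨φ', hφ'⟩ := exists_multilinear_barDifferential q φ
  refine ⟨φ', fun m g => ?_⟩
  rw [hφ', show f = fun m g => φ m g from funext fun m => funext fun g => hφ m g]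

end Bar

/-! ### Functoriality of graded `Ext` and the long exact sequence in the first variable. -/

section ExtGroups

variable {k B : Type*} [Field k] [Ring B] [Algebra k B]
variable {M N M' N' M'' N'' : Type*}
  [AddCommGroup M] [Module k M] [Module Bᵐᵒᵖ M] [IsScalarTower k Bᵐᵒᵖ M]
  [AddCommGroup N] [Module k N] [Module Bᵐᵒᵖ N] [IsScalarTower k Bᵐᵒᵖ N]
  [AddCommGroup M'] [Module k M'] [Module Bᵐᵒᵖ M'] [IsScalarTower k Bᵐᵒᵖ M']
  [AddCommGroup N'] [Module k N'] [Module Bᵐᵒᵖ N'] [IsScalarTower k Bᵐᵒᵖ N']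
  [AddCommGroup M''] [Module k M''] [Module Bᵐᵒᵖ M''] [IsScalarTower k Bᵐᵒᵖ M'']
  [AddCommGroup N''] [Module k N''] [Module Bᵐᵒᵖ N''] [IsScalarTower k Bᵐᵒᵖ N'']
variable {𝒜 : ℕ → Submodule k B} {ℳ : ℤ → Submodule k M} {𝒩 : ℤ → Submodule k N}
  {ℳ' : ℤ → Submodule k M'} {𝒩' : ℤ → Submodule k N'}
  {ℳ'' : ℤ → Submodule k M''} {𝒩'' : ℤ → Submodule k N''}

/-- The class of a cocycle. -/
def GExt.mk {q : ℕ} {ℓ : ℤ} (f : M → (Fin q → B) → N) (hf : f ∈ cocycles 𝒜 ℳ 𝒩 q ℓ) :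
    GExt 𝒜 ℳ 𝒩 q ℓ := Submodule.Quotient.mk ⟨f, hf⟩

theorem GExt.exists_mk {q : ℕ} {ℓ : ℤ} (x : GExt 𝒜 ℳ 𝒩 q ℓ) :
    ∃ (f : M → (Fin q → B) → N) (hf : f ∈ cocycles 𝒜 ℳ 𝒩 q ℓ), GExt.mk f hf = x := by
  obtain ⟨⟨f, hf⟩, rfl⟩ := Submodule.Quotient.mk_surjective _ x
  exact ⟨f, hf, rfl⟩

theorem GExt.mk_eq_mk_iff {q : ℕ} {ℓ : ℤ} {f f' : M → (Fin q → B) → N}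
    (hf : f ∈ cocycles 𝒜 ℳ 𝒩 q ℓ) (hf' : f' ∈ cocycles 𝒜 ℳ 𝒩 q ℓ) :
    GExt.mk f hf = GExt.mk f' hf' ↔ f - f' ∈ coboundaries 𝒜 ℳ 𝒩 q ℓ :=
  Submodule.Quotient.eq _

theorem GExt.mk_eq_zero_iff {q : ℕ} {ℓ : ℤ} {f : M → (Fin q → B) → N}
    (hf : f ∈ cocycles 𝒜 ℳ 𝒩 q ℓ) :
    GExt.mk f hf = 0 ↔ f ∈ coboundaries 𝒜 ℳ 𝒩 q ℓ :=
  Submodule.Quotient.mk_eq_zero _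

theorem GExt.subsingleton_iff {q : ℕ} {ℓ : ℤ} :
    Subsingleton (GExt 𝒜 ℳ 𝒩 q ℓ)
      ↔ ∀ f ∈ cocycles 𝒜 ℳ 𝒩 q ℓ, f ∈ coboundaries 𝒜 ℳ 𝒩 q ℓ := by
  constructor
  · intro h f hf
    exact (GExt.mk_eq_zero_iff hf).1 (Subsingleton.elim _ _)
  · intro h
    refine subsingleton_of_forall_eq 0 fun x => ?_
    obtain ⟨f, hf, rfl⟩ := x.exists_mk
    exact (GExt.mk_eq_zero_iff hf).2 (h f hf)

theorem GExt.map_mk {α : M' →ₗ[Bᵐᵒᵖ] M} {β : N →ₗ[Bᵐᵒᵖ] N'} {a c ℓ ℓ' : ℤ}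
    (hα : ∀ i, ∀ m ∈ ℳ' i, α m ∈ ℳ (i + a)) (hβ : ∀ i, ∀ x ∈ 𝒩 i, β x ∈ 𝒩' (i + c))
    (hℓ : ℓ + a + c = ℓ') {q : ℕ} {f : M → (Fin q → B) → N} (hf : f ∈ cocycles 𝒜 ℳ 𝒩 q ℓ) :
    GExt.map α β hα hβ hℓ q (GExt.mk f hf)
      = GExt.mk (cochainMap (k := k) α β q f) (cochainMap_mem_cocycles α β hα hβ hℓ q f hf) :=
  rfl

theorem GExt.map_map {α : M' →ₗ[Bᵐᵒᵖ] M} {β : N →ₗ[Bᵐᵒᵖ] N'} {a c ℓ ℓ' : ℤ}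
    (hα : ∀ i, ∀ m ∈ ℳ' i, α m ∈ ℳ (i + a)) (hβ : ∀ i, ∀ x ∈ 𝒩 i, β x ∈ 𝒩' (i + c))
    (hℓ : ℓ + a + c = ℓ')
    {α' : M'' →ₗ[Bᵐᵒᵖ] M'} {β' : N' →ₗ[Bᵐᵒᵖ] N''} {a' c' ℓ'' : ℤ}
    (hα' : ∀ i, ∀ m ∈ ℳ'' i, α' m ∈ ℳ' (i + a')) (hβ' : ∀ i, ∀ x ∈ 𝒩' i, β' x ∈ 𝒩'' (i + c'))
    (hℓ' : ℓ' + a' + c' = ℓ'')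
    {γ : M'' →ₗ[Bᵐᵒᵖ] M} {δ : N →ₗ[Bᵐᵒᵖ] N''} {u v : ℤ}
    (hγ : ∀ i, ∀ m ∈ ℳ'' i, γ m ∈ ℳ (i + u)) (hδ : ∀ i, ∀ x ∈ 𝒩 i, δ x ∈ 𝒩'' (i + v))
    (hℓ'' : ℓ + u + v = ℓ'') (h₁ : ∀ m, α (α' m) = γ m) (h₂ : ∀ x, β' (β x) = δ x) (q : ℕ)
    (x : GExt 𝒜 ℳ 𝒩 q ℓ) :
    GExt.map α' β' hα' hβ' hℓ' q (GExt.map α β hα hβ hℓ q x) = GExt.map γ δ hγ hδ hℓ'' q x := by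
  obtain ⟨f, hf, rfl⟩ := x.exists_mk
  simp only [GExt.map_mk]
  congr 1
  funext m g
  simp [cochainMap, h₁, h₂]

/-- `GExt.map` is linear in the homomorphism of the first variable. -/
theorem GExt.map_eq_sum {ι : Type*} (T : Finset ι) (c : ι → k) {α : M' →ₗ[Bᵐᵒᵖ] M}
    {α' : ι → M' →ₗ[Bᵐᵒᵖ] M}
    {β : N →ₗ[Bᵐᵒᵖ] N'} {a v ℓ ℓ' : ℤ} (hα : ∀ i, ∀ m ∈ ℳ' i, α m ∈ ℳ (i + a))
    (hα' : ∀ t i, ∀ m ∈ ℳ' i, α' t m ∈ ℳ (i + a))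
    (hβ : ∀ i, ∀ x ∈ 𝒩 i, β x ∈ 𝒩' (i + v)) (hℓ : ℓ + a + v = ℓ')
    (h : ∀ m, α m = ∑ t ∈ T, c t • α' t m) (q : ℕ) (x : GExt 𝒜 ℳ 𝒩 q ℓ) :
    GExt.map α β hα hβ hℓ q x = ∑ t ∈ T, c t • GExt.map (α' t) β (hα' t) hβ hℓ q x := by
  obtain ⟨f, hf, rfl⟩ := x.exists_mk
  obtain ⟨⟨φ, hφ⟩, -⟩ := id hf.1
  have : ∀ t, c t • GExt.map (α' t) β (hα' t) hβ hℓ q (GExt.mk f hf)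
      = Submodule.Quotient.mk (c t • ⟨_, cochainMap_mem_cocycles (α' t) β (hα' t) hβ hℓ q f hf⟩) :=
    fun _ => rfl
  simp only [this]
  have h2 := map_sum ((coboundaries 𝒜 ℳ' 𝒩' q ℓ').submoduleOf (cocycles 𝒜 ℳ' 𝒩' q ℓ')).mkQ
    (fun t => c t • (⟨_, cochainMap_mem_cocycles (α' t) β (hα' t) hβ hℓ q f hf⟩ :
      cocycles 𝒜 ℳ' 𝒩' q ℓ')) T
  simp only [Submodule.mkQ_apply] at h2
  rw [← h2, GExt.map_mk]
  refine congrArg Submodule.Quotient.mk (Subtype.ext ?_)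
  rw [Submodule.coe_sum]
  funext m g
  have hβk : ∀ (r : k) (x : N), β (r • x) = r • β x := fun r x => (β.restrictScalars k).map_smul r x
  simp [cochainMap, h, hφ, hβk]

theorem GExt.map_eq_zero {α : M' →ₗ[Bᵐᵒᵖ] M}
    {β : N →ₗ[Bᵐᵒᵖ] N'} {a v ℓ ℓ' : ℤ} (hα : ∀ i, ∀ m ∈ ℳ' i, α m ∈ ℳ (i + a))
    (hβ : ∀ i, ∀ x ∈ 𝒩 i, β x ∈ 𝒩' (i + v)) (hℓ : ℓ + a + v = ℓ')
    (h : ∀ m, α m = 0) (q : ℕ) (x : GExt 𝒜 ℳ 𝒩 q ℓ) :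
    GExt.map α β hα hβ hℓ q x = 0 := by
  rw [GExt.map_eq_sum (ι := Empty) ∅ (fun _ => 0) (α' := fun t => t.elim) hα (fun t => t.elim) hβ
    hℓ (by simpa using h)]
  simp

theorem GExt.map_eq_smul {α α' : M' →ₗ[Bᵐᵒᵖ] M} (c : k)
    {β : N →ₗ[Bᵐᵒᵖ] N'} {a v ℓ ℓ' : ℤ} (hα : ∀ i, ∀ m ∈ ℳ' i, α m ∈ ℳ (i + a))
    (hα' : ∀ i, ∀ m ∈ ℳ' i, α' m ∈ ℳ (i + a))
    (hβ : ∀ i, ∀ x ∈ 𝒩 i, β x ∈ 𝒩' (i + v)) (hℓ : ℓ + a + v = ℓ')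
    (h : ∀ m, α m = c • α' m) (q : ℕ) (x : GExt 𝒜 ℳ 𝒩 q ℓ) :
    GExt.map α β hα hβ hℓ q x = c • GExt.map α' β hα' hβ hℓ q x := by
  rw [GExt.map_eq_sum {()} (fun _ => c) (α' := fun _ : Unit => α') hα (fun _ => hα') hβ hℓ
    (by simpa using h)]
  simp

theorem GExt.map_eq_add {α α₁ α₂ : M' →ₗ[Bᵐᵒᵖ] M}
    {β : N →ₗ[Bᵐᵒᵖ] N'} {a v ℓ ℓ' : ℤ} (hα : ∀ i, ∀ m ∈ ℳ' i, α m ∈ ℳ (i + a))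
    (hα₁ : ∀ i, ∀ m ∈ ℳ' i, α₁ m ∈ ℳ (i + a)) (hα₂ : ∀ i, ∀ m ∈ ℳ' i, α₂ m ∈ ℳ (i + a))
    (hβ : ∀ i, ∀ x ∈ 𝒩 i, β x ∈ 𝒩' (i + v)) (hℓ : ℓ + a + v = ℓ')
    (h : ∀ m, α m = α₁ m + α₂ m) (q : ℕ) (x : GExt 𝒜 ℳ 𝒩 q ℓ) :
    GExt.map α β hα hβ hℓ q x = GExt.map α₁ β hα₁ hβ hℓ q x + GExt.map α₂ β hα₂ hβ hℓ q x := by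
  rw [GExt.map_eq_sum Finset.univ (fun _ => 1) (α' := fun b : Bool => if b then α₁ else α₂) hα
    (by rintro (_ | _); exacts [hα₂, hα₁]) hβ hℓ (by simpa using h)]
  simp

theorem GExt.map_id {α : M →ₗ[Bᵐᵒᵖ] M} {β : N →ₗ[Bᵐᵒᵖ] N} {a c ℓ : ℤ}
    (hα : ∀ i, ∀ m ∈ ℳ i, α m ∈ ℳ (i + a)) (hβ : ∀ i, ∀ x ∈ 𝒩 i, β x ∈ 𝒩 (i + c))
    (hℓ : ℓ + a + c = ℓ) (h₁ : ∀ m, α m = m) (h₂ : ∀ x, β x = x) (q : ℕ)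
    (x : GExt 𝒜 ℳ 𝒩 q ℓ) :
    GExt.map α β hα hβ hℓ q x = x := by
  obtain ⟨f, hf, rfl⟩ := x.exists_mk
  rw [GExt.map_mk]
  congr 1
  funext m g
  simp [cochainMap, h₁, h₂]

/-- `Ext` vanishes on retracts of modules with vanishing `Ext`, in the second variable. -/
theorem GExt.subsingleton_of_retract_right {β : N →ₗ[Bᵐᵒᵖ] N'} {β' : N' →ₗ[Bᵐᵒᵖ] N}
    (hβ : ∀ i, ∀ x ∈ 𝒩 i, β x ∈ 𝒩' i) (hβ' : ∀ i, ∀ x ∈ 𝒩' i, β' x ∈ 𝒩 i)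
    (h : ∀ x, β' (β x) = x) {q : ℕ} {ℓ : ℤ} [Subsingleton (GExt 𝒜 ℳ 𝒩' q ℓ)] :
    Subsingleton (GExt 𝒜 ℳ 𝒩 q ℓ) := by
  refine subsingleton_of_forall_eq 0 fun x => ?_
  have hid : ∀ i, ∀ m ∈ ℳ i, (LinearMap.id : M →ₗ[Bᵐᵒᵖ] M) m ∈ ℳ (i + 0) := id_mem ℳ
  have h0 : GExt.map LinearMap.id β hid (c := 0) (by simpa using hβ) (ℓ' := ℓ) (by ring) q x = 0 :=
    Subsingleton.elim _ _
  rw [← GExt.map_id hid (id_mem 𝒩) (by ring) (fun _ => rfl) (fun _ => rfl) q x,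
    ← GExt.map_map hid (c := 0) (by simpa using hβ) (ℓ' := ℓ) (by ring) hid
      (c' := 0) (β' := β') (by simpa using hβ') (by ring) hid (id_mem 𝒩) (by ring) (fun _ => rfl)
      h, h0, map_zero]

/-- Short exact sequences of graded right modules with `k`-linear graded splittings. -/
structure IsGradedSplit (ℳ' : ℤ → Submodule k M') (ℳ : ℤ → Submodule k M)
    (ℳ'' : ℤ → Submodule k M'')
    (ι : M' →ₗ[Bᵐᵒᵖ] M) (π : M →ₗ[Bᵐᵒᵖ] M'') (ρ : M →ₗ[k] M') (τ : M'' →ₗ[k] M) : Prop where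
  ι_mem : ∀ i, ∀ x ∈ ℳ' i, ι x ∈ ℳ (i + 0)
  π_mem : ∀ i, ∀ x ∈ ℳ i, π x ∈ ℳ'' (i + 0)
  ρ_mem : ∀ i, ∀ x ∈ ℳ i, ρ x ∈ ℳ' i
  τ_mem : ∀ i, ∀ x ∈ ℳ'' i, τ x ∈ ℳ i
  ρ_ι : ∀ x, ρ (ι x) = x
  π_τ : ∀ x, π (τ x) = x
  π_ι : ∀ x, π (ι x) = 0
  exact : ∀ x, π x = 0 → ∃ y, ι y = x

section Pullback

/-- Pulling back cochains along a `k`-linear map. -/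
def pullCochain {q : ℕ} (ρ : M →ₗ[k] M') (f : M' → (Fin q → B) → N) : M → (Fin q → B) → N :=
  fun m => f (ρ m)

theorem pullCochain_mem {q : ℕ} {ℓ : ℤ} {ρ : M →ₗ[k] M'} (hρ : ∀ i, ∀ x ∈ ℳ i, ρ x ∈ ℳ' i)
    {f : M' → (Fin q → B) → N} (hf : f ∈ cochains 𝒜 ℳ' 𝒩 q ℓ) :
    pullCochain ρ f ∈ cochains 𝒜 ℳ 𝒩 q ℓ := by
  obtain ⟨⟨φ, hφ⟩, h⟩ := hf
  exact ⟨⟨φ.comp ρ, fun m g => hφ _ _⟩, fun i m d g hm hg => h i _ d g (hρ i m hm) hg⟩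

end Pullback

variable {ι : M' →ₗ[Bᵐᵒᵖ] M} {π : M →ₗ[Bᵐᵒᵖ] M''} {ρ : M →ₗ[k] M'} {τ : M'' →ₗ[k] M}

/-- As `m - τ (π m)` comes from `M'`, a cochain that is linear in `m` and vanishes on `M'` depends
on `π m` only. Only a `k`-linear section is needed, since cochains are merely `k`-linear in `m`. -/
theorem IsGradedSplit.eq_cochainMap (S : IsGradedSplit ℳ' ℳ ℳ'' ι π ρ τ) {q : ℕ} {ℓ : ℤ}
    {f : M → (Fin q → B) → N} (hf : f ∈ cochains 𝒜 ℳ 𝒩 q ℓ)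
    (h : cochainMap (k := k) ι LinearMap.id q f = 0) :
    f = cochainMap (k := k) π LinearMap.id q (pullCochain τ f) := by
  obtain ⟨⟨φ, hφ⟩, -⟩ := hf
  funext m g
  obtain ⟨y, hy⟩ := S.exact (m - τ (π m)) (by rw [map_sub, S.π_τ, sub_self])
  have h1 : f (ι y) g = 0 := congrFun (congrFun h y) g
  rw [hy, hφ, map_sub, _root_.sub_apply, sub_eq_zero, ← hφ, ← hφ] at h1
  exact h1

theorem IsGradedSplit.cochainMap_injective (S : IsGradedSplit ℳ' ℳ ℳ'' ι π ρ τ) {q : ℕ}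
    {f : M'' → (Fin q → B) → N} (h : cochainMap (k := k) π LinearMap.id q f = 0) : f = 0 := by
  funext m g
  have := congrFun (congrFun h (τ m)) g
  simpa [cochainMap, S.π_τ] using this

variable [SetLike.GradedMul 𝒜]

/-- Exactness in the middle of the long exact sequence. -/
theorem IsGradedSplit.exact_ext (S : IsGradedSplit ℳ' ℳ ℳ'' ι π ρ τ) (hM : GradedAction 𝒜 ℳ)
    (hN : GradedAction 𝒜 𝒩) {q : ℕ} {ℓ : ℤ} (x : GExt 𝒜 ℳ 𝒩 q ℓ)
    (hx : GExt.map ι LinearMap.id S.ι_mem (id_mem 𝒩) (ℓ' := ℓ) (by ring) q x = 0) :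
    ∃ y : GExt 𝒜 ℳ'' 𝒩 q ℓ,
      GExt.map π LinearMap.id S.π_mem (id_mem 𝒩) (ℓ' := ℓ) (by ring) q y = x := by
  obtain ⟨f, hf, rfl⟩ := x.exists_mk
  rw [GExt.map_mk, GExt.mk_eq_zero_iff] at hx
  have key : ∀ f' ∈ cocycles 𝒜 ℳ 𝒩 q ℓ, cochainMap (k := k) ι LinearMap.id q f' = 0 →
      f - f' ∈ coboundaries 𝒜 ℳ 𝒩 q ℓ → ∃ y : GExt 𝒜 ℳ'' 𝒩 q ℓ,
      GExt.map π LinearMap.id S.π_mem (id_mem 𝒩) (ℓ' := ℓ) (by ring) q y = GExt.mk f hf := by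
    intro f' hf' h0 hff'
    have hp := S.eq_cochainMap hf'.1 h0
    have hd : pullCochain τ f' ∈ cocycles 𝒜 ℳ'' 𝒩 q ℓ := by
      refine ⟨pullCochain_mem S.τ_mem hf'.1, ?_⟩
      refine S.cochainMap_injective ?_
      rw [cochainMap_barDifferential, ← hp]
      exact hf'.2
    refine ⟨GExt.mk _ hd, ?_⟩
    rw [GExt.map_mk, GExt.mk_eq_mk_iff, ← hp, ← neg_sub]
    exact Submodule.neg_mem _ hff'
  cases q with
  | zero => exact key f hf hx (by rw [sub_self]; exact Submodule.zero_mem _)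
  | succ q =>
    obtain ⟨g, hg, hgf⟩ := hx
    have hg' : pullCochain ρ g ∈ cochains 𝒜 ℳ 𝒩 q ℓ := pullCochain_mem S.ρ_mem hg
    -- The primitive `g` of the restriction to `M'` is extended to `M` along the retraction `ρ`;
    -- subtracting its boundary gives a cohomologous cocycle that vanishes on `M'` exactly.
    refine key (f - barDifferential k q (pullCochain ρ g)) ⟨?_, ?_⟩ ?_ ?_
    · exact Submodule.sub_mem _ hf.1 (barDifferential_mem_cochains hM hN hg')
    · refine LinearMap.mem_ker.2 ?_
      rw [map_sub, barDifferential_comp_self, sub_zero]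
      exact hf.2
    · rw [map_sub, cochainMap_barDifferential, ← hgf, sub_eq_zero]
      congr 1
      funext m g'
      simp [cochainMap, pullCochain, S.ρ_ι]
    · rw [sub_sub_cancel]
      exact ⟨_, hg', rfl⟩

theorem IsGradedSplit.subsingleton (S : IsGradedSplit ℳ' ℳ ℳ'' ι π ρ τ) (hM : GradedAction 𝒜 ℳ)
    (hN : GradedAction 𝒜 𝒩) {q : ℕ} {ℓ : ℤ} (h' : Subsingleton (GExt 𝒜 ℳ' 𝒩 q ℓ))
    (h'' : Subsingleton (GExt 𝒜 ℳ'' 𝒩 q ℓ)) : Subsingleton (GExt 𝒜 ℳ 𝒩 q ℓ) := by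
  refine subsingleton_of_forall_eq 0 fun x => ?_
  obtain ⟨y, rfl⟩ := S.exact_ext hM hN x (Subsingleton.elim _ _)
  rw [Subsingleton.elim y 0, map_zero]

/-- The kernel is the image of the connecting map from `Ext^{q-1}(M', N)`. The predecessor is
quantified as `q' + 1 = q` so that nothing is required when `q = 0`. -/
theorem IsGradedSplit.injective (S : IsGradedSplit ℳ' ℳ ℳ'' ι π ρ τ) (hM : GradedAction 𝒜 ℳ)
    (hN : GradedAction 𝒜 𝒩) {q : ℕ} {ℓ : ℤ}
    (h' : ∀ q', q' + 1 = q → Subsingleton (GExt 𝒜 ℳ' 𝒩 q' ℓ)) :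
    Function.Injective
      (GExt.map (𝒜 := 𝒜) π LinearMap.id S.π_mem (id_mem 𝒩) (ℓ := ℓ) (ℓ' := ℓ) (by ring) q) := by
  rw [injective_iff_map_eq_zero]
  intro x hx
  obtain ⟨f, hf, rfl⟩ := x.exists_mk
  rw [GExt.map_mk, GExt.mk_eq_zero_iff] at hx
  rw [GExt.mk_eq_zero_iff]
  cases q with
  | zero =>
    have : f = 0 := S.cochainMap_injective hx
    rw [this]
    exact Submodule.zero_mem _
  | succ q =>
    obtain ⟨g, hg, hgf⟩ := hx
    have key : ∀ g' ∈ cochains 𝒜 ℳ 𝒩 q ℓ, cochainMap (k := k) ι LinearMap.id q g' = 0 →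
        barDifferential k q g' = barDifferential k q g → f ∈ coboundaries 𝒜 ℳ'' 𝒩 (q + 1) ℓ := by
      intro g' hg' h0 hgg'
      have hp := S.eq_cochainMap hg' h0
      refine ⟨_, pullCochain_mem S.τ_mem hg', ?_⟩
      rw [← sub_eq_zero]
      refine S.cochainMap_injective ?_
      rw [map_sub, cochainMap_barDifferential, ← hp, hgg', hgf, sub_self]
    have hι : cochainMap (k := k) ι LinearMap.id q g ∈ cocycles 𝒜 ℳ' 𝒩 q ℓ := by
      refine ⟨cochainMap_mem_cochains ι _ S.ι_mem (id_mem 𝒩) (by ring) q hg, ?_⟩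
      refine LinearMap.mem_ker.2 ?_
      rw [← cochainMap_barDifferential, hgf]
      funext m g'
      simp only [cochainMap, LinearMap.coe_mk, AddHom.coe_mk, S.π_ι, LinearMap.id_apply]
      obtain ⟨⟨φ, hφ⟩, -⟩ := hf.1
      simp [hφ]
    have hc := GExt.subsingleton_iff.1 (h' q rfl) _ hι
    -- In degree zero there are no coboundaries, so `hc` already says that `g` vanishes on `M'`; in
    -- higher degrees `g` must be corrected by an extended boundary.
    cases q with
    | zero => exact key g hg hc rfl
    | succ q =>
      obtain ⟨w, hw, hwg⟩ := hc
      have hw' : pullCochain ρ w ∈ cochains 𝒜 ℳ 𝒩 q ℓ := pullCochain_mem S.ρ_mem hw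
      refine key (g - barDifferential k q (pullCochain ρ w)) ?_ ?_ ?_
      · exact Submodule.sub_mem _ hg (barDifferential_mem_cochains hM hN hw')
      · rw [map_sub, cochainMap_barDifferential, ← hwg, sub_eq_zero]
        congr 1
        funext m g'
        simp [cochainMap, pullCochain, S.ρ_ι]
      · rw [map_sub, barDifferential_comp_self, sub_zero]

/-- Extending a cocycle along `ρ` fails to give a cocycle by `d (ρ^* f)`, which vanishes on `M'` and
so is a `(q+1)`-cocycle of `M''`. This obstruction bounds by hypothesis, and its primitive corrects
the extension without changing it on `M'`. -/
theorem IsGradedSplit.surjective (S : IsGradedSplit ℳ' ℳ ℳ'' ι π ρ τ) (hM : GradedAction 𝒜 ℳ)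
    (hN : GradedAction 𝒜 𝒩) {q : ℕ} {ℓ : ℤ} (h'' : Subsingleton (GExt 𝒜 ℳ'' 𝒩 (q + 1) ℓ)) :
    Function.Surjective
      (GExt.map (𝒜 := 𝒜) ι LinearMap.id S.ι_mem (id_mem 𝒩) (ℓ := ℓ) (ℓ' := ℓ) (by ring) q) := by
  intro x
  obtain ⟨f, hf, rfl⟩ := x.exists_mk
  have hf' : pullCochain ρ f ∈ cochains 𝒜 ℳ 𝒩 q ℓ := pullCochain_mem S.ρ_mem hf.1
  have hr : cochainMap (k := k) ι LinearMap.id q (pullCochain ρ f) = f := by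
    funext m g'
    simp [cochainMap, pullCochain, S.ρ_ι]
  have hd := barDifferential_mem_cochains hM hN hf'
  have hp := S.eq_cochainMap hd (by
    rw [cochainMap_barDifferential, hr]
    exact hf.2)
  have hc : pullCochain τ (barDifferential k q (pullCochain ρ f))
      ∈ cocycles 𝒜 ℳ'' 𝒩 (q + 1) ℓ := by
    refine ⟨pullCochain_mem S.τ_mem hd, ?_⟩
    refine S.cochainMap_injective ?_
    rw [cochainMap_barDifferential, ← hp, barDifferential_comp_self]
  obtain ⟨w, hw, hwg⟩ := GExt.subsingleton_iff.1 h'' _ hc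
  have hw' := cochainMap_mem_cochains π LinearMap.id S.π_mem (id_mem 𝒩) (ℓ := ℓ) (ℓ' := ℓ)
    (by ring) q hw
  have hz : pullCochain ρ f - cochainMap (k := k) π LinearMap.id q w ∈ cocycles 𝒜 ℳ 𝒩 q ℓ := by
    refine ⟨Submodule.sub_mem _ hf' hw', LinearMap.mem_ker.2 ?_⟩
    rw [map_sub, ← cochainMap_barDifferential, hwg, ← hp, sub_self]
  refine ⟨GExt.mk _ hz, ?_⟩
  rw [GExt.map_mk]
  congr 1
  rw [map_sub, hr, sub_eq_self]
  obtain ⟨⟨φ, hφ⟩, -⟩ := hw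
  funext m g
  simp [cochainMap, S.π_ι, hφ]

end ExtGroups

/-! ### Truncations and the filtration of `B` by the ideals `B_{≥ r}`. -/

section Quotients

variable {k R M X : Type*} [Field k] [Ring R] [Algebra k R] [AddCommGroup M] [Module k M]
  [Module R M] [IsScalarTower k R M] [AddCommGroup X] [Module k X]

/-- Descent of a `k`-linear map to the quotient by an `R`-submodule. -/
def liftScalars (P : Submodule R M) (f : M →ₗ[k] X) (h : ∀ x ∈ P, f x = 0) : (M ⧸ P) →ₗ[k] X :=
  ((P.restrictScalars k).liftQ f fun x hx => h x hx) ∘ₗ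
    (Submodule.Quotient.restrictScalarsEquiv k P).symm.toLinearMap

end Quotients

section Components

variable {k B : Type*} [Field k] [Ring B] [Algebra k B] (𝒜 : ℕ → Submodule k B) [GradedAlgebra 𝒜]

/-- The homogeneous component of degree `i`. -/
def component (i : ℕ) : B →ₗ[k] B :=
  (𝒜 i).subtype ∘ₗ DirectSum.component k ℕ (fun i => 𝒜 i) i ∘ₗ
    (DirectSum.decomposeLinearEquiv 𝒜).toLinearMap

theorem component_apply (i : ℕ) (x : B) : component 𝒜 i x = (DirectSum.decompose 𝒜 x i : B) := rfl

theorem component_mem (i : ℕ) (x : B) : component 𝒜 i x ∈ 𝒜 i := (DirectSum.decompose 𝒜 x i).2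

variable {𝒜} in
theorem component_of_mem {i : ℕ} {x : B} (hx : x ∈ 𝒜 i) : component 𝒜 i x = x :=
  DirectSum.decompose_of_mem_same 𝒜 hx

variable {𝒜} in
theorem component_of_mem_ne {i j : ℕ} {x : B} (hx : x ∈ 𝒜 i) (h : i ≠ j) : component 𝒜 j x = 0 :=
  DirectSum.decompose_of_mem_ne 𝒜 hx h

variable {𝒜} in
theorem component_mul_add {i j : ℕ} (x : B) {y : B} (hy : y ∈ 𝒜 j) :
    component 𝒜 (i + j) (x * y) = component 𝒜 i x * y :=
  DirectSum.coe_decompose_mul_add_of_right_mem 𝒜 hy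

variable {𝒜} in
theorem component_add_mul {i j : ℕ} {x : B} (y : B) (hx : x ∈ 𝒜 i) :
    component 𝒜 (i + j) (x * y) = x * component 𝒜 j y :=
  DirectSum.coe_decompose_mul_add_of_left_mem 𝒜 hx

variable {𝒜} in
theorem component_mul_of_lt {i n : ℕ} {x : B} (y : B) (hx : x ∈ 𝒜 i) (h : n < i) :
    component 𝒜 n (x * y) = 0 :=
  DirectSum.coe_decompose_mul_of_left_mem_of_not_le 𝒜 hx (not_le.2 h)

theorem mem_tailIdeal {r : ℕ} {x : B} : x ∈ tailIdeal 𝒜 r ↔ ∀ i < r, component 𝒜 i x = 0 :=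
  Iff.rfl

theorem mem_tailIdeal_of_mem {r i : ℕ} {x : B} (hx : x ∈ 𝒜 i) (h : r ≤ i) : x ∈ tailIdeal 𝒜 r :=
  fun _ hj => component_of_mem_ne hx (by omega)

theorem mul_mem_tailIdeal {r s : ℕ} {x y : B} (hx : x ∈ 𝒜 r) (hy : y ∈ tailIdeal 𝒜 s) :
    x * y ∈ tailIdeal 𝒜 (r + s) := by
  intro i hi
  rcases le_or_gt r i with h | h
  · obtain ⟨j, rfl⟩ := Nat.exists_eq_add_of_le h
    have := component_add_mul (j := j) y hx
    rw [component_apply] at this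
    rw [this, (mem_tailIdeal 𝒜).1 hy j (by omega), mul_zero]
  · exact component_mul_of_lt y hx h

/-- The sum of the homogeneous components of degree less than `r`. -/
def truncation (r : ℕ) : B →ₗ[k] B := ∑ i ∈ Finset.range r, component 𝒜 i

theorem truncation_apply (r : ℕ) (x : B) :
    truncation 𝒜 r x = ∑ i ∈ Finset.range r, component 𝒜 i x := by
  simp [truncation]

theorem truncation_succ (r : ℕ) (x : B) :
    truncation 𝒜 (r + 1) x = truncation 𝒜 r x + component 𝒜 r x := by
  rw [truncation_apply, Finset.sum_range_succ, ← truncation_apply]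

variable {𝒜} in
theorem truncation_of_mem {r i : ℕ} {x : B} (hx : x ∈ 𝒜 i) :
    truncation 𝒜 r x = if i < r then x else 0 := by
  rw [truncation_apply]
  split_ifs with h
  · rw [Finset.sum_eq_single i (fun j _ hj => component_of_mem_ne hx hj.symm)
      (fun h' => absurd (Finset.mem_range.2 h) h'), component_of_mem hx]
  · exact Finset.sum_eq_zero fun j hj => component_of_mem_ne hx (by
      have := Finset.mem_range.1 hj; omega)

theorem component_truncation {r i : ℕ} (x : B) :
    component 𝒜 i (truncation 𝒜 r x) = if i < r then component 𝒜 i x else 0 := by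
  rw [truncation_apply, map_sum]
  split_ifs with h
  · rw [Finset.sum_eq_single i
      (fun j _ hj => component_of_mem_ne (component_mem 𝒜 j x) hj)
      (fun h' => absurd (Finset.mem_range.2 h) h'), component_of_mem (component_mem 𝒜 i x)]
  · exact Finset.sum_eq_zero fun j hj => component_of_mem_ne (component_mem 𝒜 j x) (by
      have := Finset.mem_range.1 hj; omega)

theorem sub_truncation_mem (r : ℕ) (x : B) : x - truncation 𝒜 r x ∈ tailIdeal 𝒜 r := by
  rw [mem_tailIdeal]
  intro i hi
  rw [map_sub, component_truncation, if_pos hi, sub_self]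

variable {𝒜} in
theorem truncation_of_mem_tailIdeal {r : ℕ} {x : B} (hx : x ∈ tailIdeal 𝒜 r) :
    truncation 𝒜 r x = 0 := by
  rw [truncation_apply]
  exact Finset.sum_eq_zero fun i hi => hx i (Finset.mem_range.1 hi)

variable {𝒜} in
theorem mem_intGrading_cases {i : ℤ} {x : B} (hx : x ∈ intGrading 𝒜 i) :
    x = 0 ∨ ∃ n : ℕ, i = n ∧ x ∈ 𝒜 n := by
  cases i with
  | ofNat n => exact Or.inr ⟨n, rfl, hx⟩
  | negSucc n => exact Or.inl hx

theorem truncation_mem_intGrading (r : ℕ) (i : ℤ) (x : B) (hx : x ∈ intGrading 𝒜 i) :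
    truncation 𝒜 r x ∈ intGrading 𝒜 i := by
  rcases mem_intGrading_cases hx with rfl | ⟨n, rfl, h⟩
  · rw [map_zero]; exact Submodule.zero_mem _
  · rw [truncation_of_mem h]
    split_ifs
    exacts [h, Submodule.zero_mem _]

theorem component_mem_intGrading (r : ℕ) (i : ℤ) (x : B) (hx : x ∈ intGrading 𝒜 i) :
    component 𝒜 r x ∈ intGrading 𝒜 i := by
  rcases mem_intGrading_cases hx with rfl | ⟨n, rfl, h⟩
  · rw [map_zero]; exact Submodule.zero_mem _
  · by_cases hn : n = r
    · subst hn; rw [component_of_mem h]; exact h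
    · rw [component_of_mem_ne h hn]; exact Submodule.zero_mem _

theorem iSupIndep_intGrading : iSupIndep (intGrading 𝒜) := by
  intro i
  rw [Submodule.disjoint_def]
  intro x hx hx'
  rcases mem_intGrading_cases hx with rfl | ⟨n, rfl, h⟩
  · rfl
  · have hle : ⨆ j, ⨆ (_ : j ≠ (n : ℤ)), intGrading 𝒜 j ≤ LinearMap.ker (component 𝒜 n) := by
      refine iSup₂_le fun j hj y hy => ?_
      rcases mem_intGrading_cases hy with rfl | ⟨m, rfl, h'⟩
      · exact Submodule.zero_mem _
      · exact component_of_mem_ne h' (by exact_mod_cast hj)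
    have := hle hx'
    rwa [LinearMap.mem_ker, component_of_mem h] at this

theorem iSup_intGrading : ⨆ i, intGrading 𝒜 i = ⊤ := by
  rw [eq_top_iff, ← (DirectSum.Decomposition.isInternal 𝒜).submodule_iSup_eq_top]
  exact iSup_le fun n => le_iSup (intGrading 𝒜) (n : ℤ)

theorem isInternal_intGrading : DirectSum.IsInternal (intGrading 𝒜) :=
  (DirectSum.isInternal_submodule_iff_iSupIndep_and_iSup_eq_top _).2
    ⟨iSupIndep_intGrading 𝒜, iSup_intGrading 𝒜⟩

variable {𝒜}

theorem GradedAction.quot {M : Type*} [AddCommGroup M] [Module k M] [Module Bᵐᵒᵖ M]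
    [IsScalarTower k Bᵐᵒᵖ M] {ℳ : ℤ → Submodule k M} (h : GradedAction 𝒜 ℳ)
    (P : Submodule Bᵐᵒᵖ M) : GradedAction 𝒜 (quotGrading ℳ P) := by
  rintro n i b _ hb ⟨x, hx, rfl⟩
  exact ⟨op b • x, h n i b x hb hx, rfl⟩

theorem GradedAction.sub {M : Type*} [AddCommGroup M] [Module k M] [Module Bᵐᵒᵖ M]
    [IsScalarTower k Bᵐᵒᵖ M] {ℳ : ℤ → Submodule k M} (h : GradedAction 𝒜 ℳ)
    (P : Submodule Bᵐᵒᵖ M) : GradedAction 𝒜 (subGrading ℳ P) :=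
  fun n i b x hb hx => h n i b x hb hx

/-- The grading of `B / I`, for a two-sided ideal `I`. -/
abbrev quotIdealGrading (𝒜 : ℕ → Submodule k B) (I : Ideal B) [I.IsTwoSided] :
    ℤ → Submodule k (B ⧸ toRight I) := quotGrading (intGrading 𝒜) (toRight I)

theorem gradedAction_quotIdealGrading (I : Ideal B) [I.IsTwoSided] :
    GradedAction 𝒜 (quotIdealGrading 𝒜 I) := gradedAction_intGrading.quot _

variable (𝒜)

/-- The components of degree less than `r` span a graded `k`-complement of `B_{≥ r}`, so truncation
splits the sequence. -/
theorem isGradedSplit_tail (r : ℕ) :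
    IsGradedSplit (subGrading (intGrading 𝒜) (toRight (tailIdeal 𝒜 r))) (intGrading 𝒜)
      (quotIdealGrading 𝒜 (tailIdeal 𝒜 r)) (toRight (tailIdeal 𝒜 r)).subtype
      (toRight (tailIdeal 𝒜 r)).mkQ
      ((LinearMap.id - truncation 𝒜 r).codRestrict ((toRight (tailIdeal 𝒜 r)).restrictScalars k)
        (sub_truncation_mem 𝒜 r) : B →ₗ[k] ↥(toRight (tailIdeal 𝒜 r)))
      (liftScalars (toRight (tailIdeal 𝒜 r)) (truncation 𝒜 r)
        fun _ hx => truncation_of_mem_tailIdeal hx) where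
  ι_mem i x hx := by rw [add_zero]; exact hx
  π_mem i x hx := by rw [add_zero]; exact ⟨x, hx, rfl⟩
  ρ_mem i x hx := Submodule.sub_mem _ hx (truncation_mem_intGrading 𝒜 r i x hx)
  τ_mem := by
    rintro i _ ⟨x, hx, rfl⟩
    exact truncation_mem_intGrading 𝒜 r i x hx
  ρ_ι x := Subtype.ext (by
    show (x : B) - truncation 𝒜 r x = x
    rw [truncation_of_mem_tailIdeal x.2, sub_zero])
  π_τ x := by
    obtain ⟨x, rfl⟩ := Submodule.Quotient.mk_surjective _ x
    refine (Submodule.Quotient.eq _).2 ?_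
    rw [← neg_sub]
    exact Submodule.neg_mem _ (sub_truncation_mem 𝒜 r x)
  π_ι x := (Submodule.Quotient.mk_eq_zero _).2 x.2
  exact x hx := ⟨⟨x, (Submodule.Quotient.mk_eq_zero _).1 hx⟩, rfl⟩

/-- The projection `B / B_{≥ r + 1} → B / B_{≥ r}`. -/
abbrev tailFactor (r : ℕ) :
    (B ⧸ toRight (tailIdeal 𝒜 (r + 1))) →ₗ[Bᵐᵒᵖ] (B ⧸ toRight (tailIdeal 𝒜 r)) :=
  quotFactor (tailIdeal 𝒜 (r + 1)) (tailIdeal 𝒜 r) (tailIdeal_antitone 𝒜 r.le_succ)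

/-- The right module `B_{≥ r} / B_{≥ r + 1}`. -/
abbrev layer (r : ℕ) : Submodule Bᵐᵒᵖ (B ⧸ toRight (tailIdeal 𝒜 (r + 1))) :=
  LinearMap.ker (tailFactor 𝒜 r)

/-- The grading of `B_{≥ r} / B_{≥ r + 1}`. -/
abbrev layerGrading (r : ℕ) : ℤ → Submodule k (layer 𝒜 r) :=
  subGrading (quotIdealGrading 𝒜 (tailIdeal 𝒜 (r + 1))) (layer 𝒜 r)

theorem mk_mem_layer {r : ℕ} {x : B} (hx : x ∈ tailIdeal 𝒜 r) :
    (Submodule.Quotient.mk x : B ⧸ toRight (tailIdeal 𝒜 (r + 1))) ∈ layer 𝒜 r :=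
  LinearMap.mem_ker.2 ((Submodule.Quotient.mk_eq_zero _).2 hx)

/-- Modulo `B_{≥ r+1}`, the component of degree `r` retracts onto the layer and truncation below `r`
is the section. -/
theorem isGradedSplit_layer (r : ℕ) :
    IsGradedSplit (layerGrading 𝒜 r) (quotIdealGrading 𝒜 (tailIdeal 𝒜 (r + 1)))
      (quotIdealGrading 𝒜 (tailIdeal 𝒜 r)) (layer 𝒜 r).subtype (tailFactor 𝒜 r)
      (liftScalars (toRight (tailIdeal 𝒜 (r + 1)))
        ((((toRight (tailIdeal 𝒜 (r + 1))).mkQ.restrictScalars k) ∘ₗ component 𝒜 r).codRestrict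
          ((layer 𝒜 r).restrictScalars k)
          fun x => mk_mem_layer 𝒜 (mem_tailIdeal_of_mem 𝒜 (component_mem 𝒜 r x) le_rfl))
        (fun x hx => Subtype.ext (by
          show Submodule.Quotient.mk (component 𝒜 r x) = (0 : B ⧸ toRight (tailIdeal 𝒜 (r + 1)))
          rw [component_apply, hx r (by omega)]
          rfl)) : (B ⧸ toRight (tailIdeal 𝒜 (r + 1))) →ₗ[k] layer 𝒜 r)
      (liftScalars (toRight (tailIdeal 𝒜 r))
        ((toRight (tailIdeal 𝒜 (r + 1))).mkQ.restrictScalars k ∘ₗ truncation 𝒜 r)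
        fun _ hx => by
          rw [LinearMap.comp_apply, truncation_of_mem_tailIdeal hx, map_zero]) where
  ι_mem i x hx := by rw [add_zero]; exact hx
  π_mem := quotFactor_mem 𝒜 _ _ _
  ρ_mem := by
    rintro i _ ⟨x, hx, rfl⟩
    exact ⟨_, component_mem_intGrading 𝒜 r i x hx, rfl⟩
  τ_mem := by
    rintro i _ ⟨x, hx, rfl⟩
    exact ⟨_, truncation_mem_intGrading 𝒜 r i x hx, rfl⟩
  ρ_ι := by
    rintro ⟨x, hx⟩
    obtain ⟨x, rfl⟩ := Submodule.Quotient.mk_surjective _ x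
    have hx' : x ∈ tailIdeal 𝒜 r := (Submodule.Quotient.mk_eq_zero _).1 (LinearMap.mem_ker.1 hx)
    refine Subtype.ext ((Submodule.Quotient.eq _).2 ?_)
    have h := sub_truncation_mem 𝒜 (r + 1) x
    rw [truncation_succ, truncation_of_mem_tailIdeal hx', zero_add] at h
    rw [← neg_sub]
    exact Submodule.neg_mem _ h
  π_τ x := by
    obtain ⟨x, rfl⟩ := Submodule.Quotient.mk_surjective _ x
    refine (Submodule.Quotient.eq _).2 ?_
    rw [← neg_sub]
    exact Submodule.neg_mem _ (sub_truncation_mem 𝒜 r x)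
  π_ι x := x.2
  exact x hx := ⟨⟨x, hx⟩, rfl⟩

variable {𝒜}

theorem layer_exists {r : ℕ} (x : layer 𝒜 r) :
    ∃ (y : B) (hy : y ∈ 𝒜 r),
      x = ⟨Submodule.Quotient.mk y, mk_mem_layer 𝒜 (mem_tailIdeal_of_mem 𝒜 hy le_rfl)⟩ := by
  obtain ⟨x, hx⟩ := x
  obtain ⟨x, rfl⟩ := Submodule.Quotient.mk_surjective _ x
  have hx' : x ∈ tailIdeal 𝒜 r := (Submodule.Quotient.mk_eq_zero _).1 (LinearMap.mem_ker.1 hx)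
  refine ⟨component 𝒜 r x, component_mem 𝒜 r x, Subtype.ext ((Submodule.Quotient.eq _).2 ?_)⟩
  have h := sub_truncation_mem 𝒜 (r + 1) x
  rwa [truncation_succ, truncation_of_mem_tailIdeal hx', zero_add] at h

/-- With the next lemma: the layer sits in the single degree `r`. Homogeneity of the maps between
layers and simples is then automatic. -/
theorem mem_layerGrading {r : ℕ} (x : layer 𝒜 r) : x ∈ layerGrading 𝒜 r r := by
  obtain ⟨y, hy, rfl⟩ := layer_exists x
  exact ⟨y, hy, rfl⟩

theorem eq_zero_of_mem_layerGrading {r : ℕ} {i : ℤ} (hi : i ≠ r) {x : layer 𝒜 r}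
    (hx : x ∈ layerGrading 𝒜 r i) : x = 0 := by
  obtain ⟨x, hx'⟩ := x
  obtain ⟨z, hz, hzx⟩ := hx
  have hzx' : (Submodule.Quotient.mk z : B ⧸ toRight (tailIdeal 𝒜 (r + 1))) = x := hzx
  subst hzx'
  have hz' : z ∈ tailIdeal 𝒜 r := (Submodule.Quotient.mk_eq_zero _).1 (LinearMap.mem_ker.1 hx')
  refine Subtype.ext ((Submodule.Quotient.mk_eq_zero _).2 ?_)
  rcases mem_intGrading_cases hz with rfl | ⟨n, rfl, h⟩
  · exact Submodule.zero_mem _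
  · intro j hj
    by_cases hjn : n = j
    · subst hjn
      exact hz' n (by have : n ≠ r := by exact_mod_cast hi
                      omega)
    · exact component_of_mem_ne h hjn

end Components

/-! ### Graded simple modules, and layers as sums of shifted simples. -/

section Simples

variable {k B : Type*} [Field k] [Ring B] [Algebra k B]

/-- The degree zero part of the graded algebra is `k^n`, with primitive idempotents `e j` and
characters `χ j`. -/
structure IsBasic {n : ℕ} (𝒜 : ℕ → Submodule k B) (e : Fin n → B) (χ : Fin n → B → k) : Prop where
  mem : ∀ j, e j ∈ 𝒜 0
  ne_zero : ∀ j, e j ≠ 0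
  sum_eq : ∑ j, e j = 1
  mul_self : ∀ j, e j * e j = e j
  mul_ne : ∀ i j, i ≠ j → e i * e j = 0
  mul_left : ∀ j, ∀ b ∈ 𝒜 0, e j * b = χ j b • e j
  mul_right : ∀ j, ∀ b ∈ 𝒜 0, b * e j = χ j b • e j

variable {n : ℕ} {𝒜 : ℕ → Submodule k B} [GradedAlgebra 𝒜] {e : Fin n → B} {χ : Fin n → B → k}

/-- The generator of `S = eB / (eB)_{≥ 1}`. -/
def simpleGen (𝒜 : ℕ → Submodule k B) [GradedAlgebra 𝒜] (e : B) : RightSimple 𝒜 e :=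
  Submodule.Quotient.mk ⟨e, Submodule.mem_span_singleton_self e⟩

theorem simpleGen_mem (he : IsBasic 𝒜 e χ) (j : Fin n) :
    simpleGen 𝒜 (e j) ∈ rightSimpleGrading 𝒜 (e j) 0 :=
  ⟨⟨e j, Submodule.mem_span_singleton_self _⟩, he.mem j, rfl⟩

/-- `B_{≥ 1}` kills `S_j`, so `B` acts through the degree zero component and its character `χ j`. -/
theorem op_smul_simpleGen (he : IsBasic 𝒜 e χ) (j : Fin n) (b : B) :
    op b • simpleGen 𝒜 (e j) = χ j (component 𝒜 0 b) • simpleGen 𝒜 (e j) := by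
  refine (Submodule.Quotient.eq _).2 ?_
  show e j * b - χ j (component 𝒜 0 b) • e j ∈ tailIdeal 𝒜 1
  rw [← he.mul_left j _ (component_mem 𝒜 0 b), ← mul_sub]
  have h := sub_truncation_mem 𝒜 1 b
  rw [truncation_succ, truncation_apply, Finset.range_zero, Finset.sum_empty, zero_add] at h
  exact Ideal.mul_mem_left _ _ h

theorem simple_exists (he : IsBasic 𝒜 e χ) {j : Fin n} (x : RightSimple 𝒜 (e j)) :
    ∃ c : k, x = c • simpleGen 𝒜 (e j) := by
  obtain ⟨⟨x, hx⟩, rfl⟩ := Submodule.Quotient.mk_surjective _ x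
  obtain ⟨b, rfl⟩ := Submodule.mem_span_singleton.1 hx
  refine ⟨_, Eq.trans ?_ (op_smul_simpleGen he j b.unop)⟩
  rfl

theorem mem_rightSimpleGrading (he : IsBasic 𝒜 e χ) {j : Fin n} (x : RightSimple 𝒜 (e j)) :
    x ∈ rightSimpleGrading 𝒜 (e j) 0 := by
  obtain ⟨c, rfl⟩ := simple_exists he x
  exact Submodule.smul_mem _ _ (simpleGen_mem he j)

theorem eq_zero_of_mem_rightSimpleGrading {j : Fin n} {i : ℤ} (hi : i ≠ 0)
    {x : RightSimple 𝒜 (e j)} (hx : x ∈ rightSimpleGrading 𝒜 (e j) i) : x = 0 := by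
  obtain ⟨⟨z, hz'⟩, hz, rfl⟩ := hx
  refine (Submodule.Quotient.mk_eq_zero _).2 ?_
  show z ∈ tailIdeal 𝒜 1
  have hz2 : z ∈ intGrading 𝒜 i := hz
  rcases mem_intGrading_cases hz2 with rfl | ⟨n, rfl, h⟩
  · exact Submodule.zero_mem _
  · exact mem_tailIdeal_of_mem 𝒜 h (by
      have : n ≠ 0 := by exact_mod_cast hi
      omega)

/-- Left multiplication by `y ∈ B_r`, as a map from `eB / (eB)_{≥ 1}` to `B_{≥ r} / B_{≥ r + 1}`. -/
def simpleToLayer (e : B) {r : ℕ} (y : B) (hy : y ∈ 𝒜 r) : RightSimple 𝒜 e →ₗ[Bᵐᵒᵖ] layer 𝒜 r :=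
  Submodule.liftQ _
    (((toRight (tailIdeal 𝒜 (r + 1))).mkQ ∘ₗ leftMul y ∘ₗ
      (Submodule.span Bᵐᵒᵖ {e}).subtype).codRestrict (layer 𝒜 r)
      fun _ => mk_mem_layer 𝒜 (mul_mem_tailIdeal 𝒜 (s := 0) hy fun i hi => absurd hi (Nat.not_lt_zero i)))
    fun _ hx => Subtype.ext ((Submodule.Quotient.mk_eq_zero _).2 (mul_mem_tailIdeal 𝒜 hy hx))

theorem simpleToLayer_mem (_ : IsBasic 𝒜 e χ) (j : Fin n) {r : ℕ} (y : B) (hy : y ∈ 𝒜 r) (i : ℤ)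
    (x : RightSimple 𝒜 (e j)) (hx : x ∈ rightSimpleGrading 𝒜 (e j) i) :
    simpleToLayer (e j) y hy x ∈ layerGrading 𝒜 r (i + r) := by
  by_cases hi : i = 0
  · rw [hi, zero_add]; exact mem_layerGrading _
  · rw [eq_zero_of_mem_rightSimpleGrading hi hx, map_zero]; exact Submodule.zero_mem _

/-- The map `y ↦ ψ(y e_j) e_j` from `B_{≥ r} / B_{≥ r + 1}` to `e_jB / (e_jB)_{≥ 1}`. -/
def layerToSimple (he : IsBasic 𝒜 e χ) (j : Fin n) (r : ℕ) (ψ : B →ₗ[k] k) :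
    layer 𝒜 r →ₗ[Bᵐᵒᵖ] RightSimple 𝒜 (e j) :=
  let c : (B ⧸ toRight (tailIdeal 𝒜 (r + 1))) →ₗ[k] k :=
    liftScalars _ (ψ ∘ₗ LinearMap.mulRight k (e j) ∘ₗ component 𝒜 r) fun x hx => by
      rw [LinearMap.comp_apply, LinearMap.comp_apply, component_apply, hx r (by omega), map_zero,
        map_zero]
  { toFun := fun x => c x • simpleGen 𝒜 (e j)
    map_add' := fun x y => by rw [Submodule.coe_add, map_add, add_smul]
    map_smul' := fun b x => by
      obtain ⟨y, hy, rfl⟩ := layer_exists x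
      obtain ⟨b, rfl⟩ := op_surjective b
      show ψ (component 𝒜 r (y * b) * e j) • simpleGen 𝒜 (e j)
        = op b • ψ (component 𝒜 r y * e j) • simpleGen 𝒜 (e j)
      -- Right linearity: for `y` of degree `r` the degree `r` part of `y b` is `y b₀`, and `b₀ e_j
      -- = χ_j(b₀) e_j`, which is also how `b` acts on `S_j`.
      have h1 := component_add_mul (j := 0) b hy
      rw [add_zero] at h1
      refine Eq.trans ?_ (op_smul_smul_comm (k := k) (M := RightSimple 𝒜 (e j))
        (ψ (component 𝒜 r y * e j)) b (simpleGen 𝒜 (e j))).symm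
      rw [op_smul_simpleGen he, h1, mul_assoc, he.mul_right j _ (component_mem 𝒜 0 b), component_of_mem hy, mul_smul_comm, map_smul,
        smul_smul, smul_eq_mul, mul_comm] }

theorem layerToSimple_mk (he : IsBasic 𝒜 e χ) (j : Fin n) {r : ℕ} (ψ : B →ₗ[k] k) {y : B}
    (hy : y ∈ 𝒜 r) (h) : layerToSimple he j r ψ ⟨Submodule.Quotient.mk y, h⟩
      = ψ (y * e j) • simpleGen 𝒜 (e j) := by
  show ψ (component 𝒜 r y * e j) • simpleGen 𝒜 (e j) = _
  rw [component_of_mem hy]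

theorem layerToSimple_mem (he : IsBasic 𝒜 e χ) (j : Fin n) {r : ℕ} (ψ : B →ₗ[k] k) (i : ℤ)
    (x : layer 𝒜 r) (hx : x ∈ layerGrading 𝒜 r i) :
    layerToSimple he j r ψ x ∈ rightSimpleGrading 𝒜 (e j) (i + (-r : ℤ)) := by
  by_cases hi : i = r
  · rw [hi, add_neg_cancel]; exact mem_rightSimpleGrading he _
  · rw [eq_zero_of_mem_layerGrading hi hx, map_zero]; exact Submodule.zero_mem _

/-- The coordinate functionals of a basis of `B_r`, extended to `B`. -/
def coordFunctional {r : ℕ} {ι : Type*} (b : Module.Basis ι k (𝒜 r)) (t : ι) : B →ₗ[k] k :=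
  b.coord t ∘ₗ DirectSum.component k ℕ (fun i => 𝒜 i) r ∘ₗ
    (DirectSum.decomposeLinearEquiv 𝒜).toLinearMap

theorem coordFunctional_of_mem {r : ℕ} {ι : Type*} (b : Module.Basis ι k (𝒜 r)) (t : ι) {x : B}
    (hx : x ∈ 𝒜 r) : coordFunctional b t x = b.coord t ⟨x, hx⟩ :=
  congrArg (b.coord t) (Subtype.ext (component_of_mem hx))

/-- Write `y = ∑_j y e_j` and expand `y e_j` in a basis of `B_r`; multiplying by `e_j` once more is
harmless as `e_j` is idempotent. Each resulting term factors through some `S_j`, so the layer is a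
direct summand of a finite sum of shifted simples. -/
theorem layer_eq_sum (he : IsBasic 𝒜 e χ) {r : ℕ} {ι : Type*} [Fintype ι]
    (b : Module.Basis ι k (𝒜 r)) (x : layer 𝒜 r) :
    x = ∑ t : ι × Fin n, simpleToLayer (e t.2) (b t.1 : B) (b t.1).2
      (layerToSimple he t.2 r (coordFunctional b t.1) x) := by
  obtain ⟨y, hy, rfl⟩ := layer_exists x
  refine Subtype.ext ?_
  rw [Submodule.coe_sum]
  have hmem : ∀ j, y * e j ∈ 𝒜 r := fun j => by
    have := SetLike.GradedMul.mul_mem hy (he.mem j)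
    rwa [add_zero] at this
  have hterm : ∀ (t : ι × Fin n), ((simpleToLayer (e t.2) (b t.1 : B) (b t.1).2
      (layerToSimple he t.2 r (coordFunctional b t.1)
        ⟨Submodule.Quotient.mk y, mk_mem_layer 𝒜 (mem_tailIdeal_of_mem 𝒜 hy le_rfl)⟩) :
          layer 𝒜 r) : B ⧸ toRight (tailIdeal 𝒜 (r + 1)))
      = Submodule.Quotient.mk (b.coord t.1 ⟨y * e t.2, hmem t.2⟩ • (b t.1 : B) * e t.2) := by
    rintro ⟨t, j⟩
    rw [layerToSimple_mk he j _ hy]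
    have hs : ∀ (c : k) (x : RightSimple 𝒜 (e j)),
        simpleToLayer (e j) (b t : B) (b t).2 (c • x)
          = c • simpleToLayer (e j) (b t : B) (b t).2 x :=
      fun c x => ((simpleToLayer (e j) (b t : B) (b t).2).restrictScalars k).map_smul c x
    rw [hs]
    rw [coordFunctional_of_mem b t (hmem j), smul_mul_assoc]
    rfl
  rw [Finset.sum_congr rfl fun t _ => hterm t]
  have hsum : ∑ t : ι × Fin n, (b.coord t.1 ⟨y * e t.2, hmem t.2⟩ • (b t.1 : B) * e t.2) = y := by
    rw [Fintype.sum_prod_type_right]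
    have : ∀ j, ∑ t, b.coord t ⟨y * e j, hmem j⟩ • (b t : B) * e j = y * e j := by
      intro j
      rw [← Finset.sum_mul]
      have h2 := congrArg (fun z : 𝒜 r => (z : B)) (b.sum_repr ⟨y * e j, hmem j⟩)
      simp only [Submodule.coe_sum, Submodule.coe_smul] at h2
      simp only [Module.Basis.coord_apply]
      rw [h2, mul_assoc, he.mul_self]
    simp only [this]
    rw [← Finset.mul_sum, he.sum_eq, mul_one]
  refine Eq.trans (congrArg Submodule.Quotient.mk hsum.symm) ?_
  exact map_sum (toRight (tailIdeal 𝒜 (r + 1))).mkQ _ _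

/-- The inclusion of `eB / (eB)_{≥ 1}` in `B / B_{≥ 1}`. -/
def simpleToQuot (𝒜 : ℕ → Submodule k B) [GradedAlgebra 𝒜] (e : B) :
    RightSimple 𝒜 e →ₗ[Bᵐᵒᵖ] (B ⧸ toRight (tailIdeal 𝒜 1)) :=
  Submodule.mapQ _ _ (Submodule.span Bᵐᵒᵖ {e}).subtype fun _ hx => hx

/-- The projection of `B / B_{≥ 1}` onto `eB / (eB)_{≥ 1}`. -/
def quotToSimple (𝒜 : ℕ → Submodule k B) [GradedAlgebra 𝒜] (e : B) :
    (B ⧸ toRight (tailIdeal 𝒜 1)) →ₗ[Bᵐᵒᵖ] RightSimple 𝒜 e :=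
  Submodule.mapQ _ _ ((leftMul e).codRestrict (Submodule.span Bᵐᵒᵖ {e})
    fun x => Submodule.mem_span_singleton.2 ⟨op x, rfl⟩)
    fun _ hx => Ideal.mul_mem_left (tailIdeal 𝒜 1) e hx

theorem simpleToQuot_mem (e : B) (i : ℤ) (x : RightSimple 𝒜 e)
    (hx : x ∈ rightSimpleGrading 𝒜 e i) :
    simpleToQuot 𝒜 e x ∈ quotIdealGrading 𝒜 (tailIdeal 𝒜 1) (i + 0) := by
  rw [add_zero]
  obtain ⟨x, hx, rfl⟩ := hx
  exact ⟨x, hx, rfl⟩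

theorem quotToSimple_mem (he : IsBasic 𝒜 e χ) (j : Fin n) (i : ℤ) (x : B ⧸ toRight (tailIdeal 𝒜 1))
    (hx : x ∈ quotIdealGrading 𝒜 (tailIdeal 𝒜 1) i) :
    quotToSimple 𝒜 (e j) x ∈ rightSimpleGrading 𝒜 (e j) (i + 0) := by
  obtain ⟨x, hx, rfl⟩ := hx
  refine ⟨⟨e j * x, Submodule.mem_span_singleton.2 ⟨op x, rfl⟩⟩, ?_, rfl⟩
  exact mul_mem_intGrading 𝒜 0 (e j) (he.mem j) i x hx

theorem quotToSimple_simpleToQuot (he : IsBasic 𝒜 e χ) (j : Fin n) (x : RightSimple 𝒜 (e j)) :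
    quotToSimple 𝒜 (e j) (simpleToQuot 𝒜 (e j) x) = x := by
  obtain ⟨⟨x, hx⟩, rfl⟩ := Submodule.Quotient.mk_surjective _ x
  obtain ⟨b, rfl⟩ := Submodule.mem_span_singleton.1 hx
  refine congrArg Submodule.Quotient.mk (Subtype.ext ?_)
  show e j * (e j * b.unop) = e j * b.unop
  rw [← mul_assoc, he.mul_self]

end Simples

/-! ### Vanishing and detection of `Ext` classes by means of simples. -/

section ExtSimples

variable {k B : Type*} [Field k] [Ring B] [Algebra k B]
variable {n : ℕ} {𝒜 : ℕ → Submodule k B} [GradedAlgebra 𝒜] {e : Fin n → B} {χ : Fin n → B → k}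
variable {N : Type*} [AddCommGroup N] [Module k N] [Module Bᵐᵒᵖ N] [IsScalarTower k Bᵐᵒᵖ N]
  {𝒩 : ℤ → Submodule k N}

/-- If the identity of `M` is a sum of composites `M → S t → M`, then a class in `Ext(M, N)` whose
restrictions to all `S t` vanish is zero. -/
theorem GExt.eq_zero_of_frame {M : Type*} [AddCommGroup M] [Module k M] [Module Bᵐᵒᵖ M]
    [IsScalarTower k Bᵐᵒᵖ M] {ℳ : ℤ → Submodule k M} {ι : Type*} [Fintype ι] {S : ι → Type*}
    [∀ t, AddCommGroup (S t)] [∀ t, Module k (S t)] [∀ t, Module Bᵐᵒᵖ (S t)]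
    [∀ t, IsScalarTower k Bᵐᵒᵖ (S t)] {𝒮 : ∀ t, ℤ → Submodule k (S t)}
    (α : ∀ t, M →ₗ[Bᵐᵒᵖ] S t) (β : ∀ t, S t →ₗ[Bᵐᵒᵖ] M) {r ℓ ℓ' : ℤ}
    (hα : ∀ t, ∀ i, ∀ m ∈ ℳ i, α t m ∈ 𝒮 t (i + -r)) (hβ : ∀ t, ∀ i, ∀ m ∈ 𝒮 t i, β t m ∈ ℳ (i + r))
    (h : ∀ m, m = ∑ t, β t (α t m)) (hℓ : ℓ + r + 0 = ℓ') {q : ℕ} (z : GExt 𝒜 ℳ 𝒩 q ℓ)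
    (hz : ∀ t, GExt.map (β t) LinearMap.id (hβ t) (id_mem 𝒩) hℓ q z = 0) : z = 0 := by
  have hid : ∀ i, ∀ m ∈ ℳ i, (LinearMap.id : M →ₗ[Bᵐᵒᵖ] M) m ∈ ℳ (i + 0) := id_mem _
  have hβα : ∀ t i, ∀ m ∈ ℳ i, (β t ∘ₗ α t) m ∈ ℳ (i + 0) := by
    intro t i m hm
    have := hβ t _ _ (hα t i m hm)
    rw [neg_add_cancel_right] at this
    rw [add_zero]
    exact this
  rw [← GExt.map_id hid (id_mem 𝒩) (by ring) (fun _ => rfl) (fun _ => rfl) q z,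
    GExt.map_eq_sum Finset.univ (fun _ => (1 : k)) hid hβα (id_mem 𝒩) (by ring)
      (fun m => by
        simp only [one_smul]
        exact h m)]
  refine Finset.sum_eq_zero fun t _ => ?_
  rw [← GExt.map_map (hβ t) (id_mem 𝒩) hℓ (hα t) (id_mem 𝒩) (by rw [← hℓ]; ring) (hβα t)
    (id_mem 𝒩) (by ring) (fun _ => rfl) (fun _ => rfl), hz, map_zero, smul_zero]

/-- The decomposition `layer_eq_sum` is a frame for the layer, so its `Ext` classes are detected by
restriction along left multiplications `S_j → B_{≥ r} / B_{≥ r+1}`. -/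
theorem GExt.layer_eq_zero (he : IsBasic 𝒜 e χ) {r : ℕ} [FiniteDimensional k (𝒜 r)] {q : ℕ}
    {ℓ ℓ' : ℤ} (hℓ : ℓ + r + 0 = ℓ') (z : GExt 𝒜 (layerGrading 𝒜 r) 𝒩 q ℓ)
    (h : ∀ (j : Fin n) (y : B) (hy : y ∈ 𝒜 r),
      GExt.map (simpleToLayer (e j) y hy) LinearMap.id (simpleToLayer_mem he j y hy) (id_mem 𝒩)
        hℓ q z = 0) : z = 0 := by
  let ι := Fin (Module.finrank k (𝒜 r)) × Fin n
  let b := Module.finBasis k (𝒜 r)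
  have hα := fun t : ι => layerToSimple_mem he t.2 (r := r) (coordFunctional b t.1)
  have hβ := fun t : ι => simpleToLayer_mem he t.2 (b t.1 : B) (b t.1).2
  have key := @GExt.eq_zero_of_frame k B _ _ _ 𝒜 _ N _ _ _ _ 𝒩 (layer 𝒜 r) _ _ _ _
    (layerGrading 𝒜 r) ι _ (fun t => RightSimple 𝒜 (e t.2)) _ _ _ _
    (fun t => rightSimpleGrading 𝒜 (e t.2))
    (fun t => layerToSimple he t.2 r (coordFunctional b t.1))
    (fun t => simpleToLayer (e t.2) (b t.1 : B) (b t.1).2) r ℓ ℓ' hα hβ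
    (fun m => layer_eq_sum he b m) hℓ q z
  apply key
  intro t
  exact h t.2 (b t.1 : B) (b t.1).2

theorem GExt.subsingleton_layer (he : IsBasic 𝒜 e χ) {r : ℕ} [FiniteDimensional k (𝒜 r)] {q : ℕ}
    {ℓ : ℤ} (h : ∀ j, Subsingleton (GExt 𝒜 (rightSimpleGrading 𝒜 (e j)) 𝒩 q (ℓ + r))) :
    Subsingleton (GExt 𝒜 (layerGrading 𝒜 r) 𝒩 q ℓ) :=
  subsingleton_of_forall_eq 0 fun z => GExt.layer_eq_zero he (add_zero _) z
    fun _ _ _ => Subsingleton.elim _ _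

theorem GExt.subsingleton_of_subsingleton {M : Type*} [AddCommGroup M] [Module k M] [Module Bᵐᵒᵖ M]
    [IsScalarTower k Bᵐᵒᵖ M] [Subsingleton M] {ℳ : ℤ → Submodule k M} {q : ℕ} {ℓ : ℤ} :
    Subsingleton (GExt 𝒜 ℳ 𝒩 q ℓ) := by
  refine GExt.subsingleton_iff.2 fun f hf => ?_
  have : f = 0 := by
    obtain ⟨⟨φ, hφ⟩, -⟩ := hf.1
    funext m g
    rw [hφ, Subsingleton.elim m 0, map_zero]
    rfl
  rw [this]
  exact Submodule.zero_mem _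

theorem GExt.subsingleton_quot_zero {q : ℕ} {ℓ : ℤ} :
    Subsingleton (GExt 𝒜 (quotIdealGrading 𝒜 (tailIdeal 𝒜 0)) 𝒩 q ℓ) := by
  have : Subsingleton (B ⧸ toRight (tailIdeal 𝒜 0)) :=
    Submodule.Quotient.subsingleton_iff.2
      (eq_top_iff.2 fun x _ i hi => absurd hi (by omega))
  exact GExt.subsingleton_of_subsingleton

/-- Dévissage along the layers. The layer in degree `t` is built from simples shifted by `t`, which
is why degree `ℓ` on the quotient involves degrees `ℓ + t` on the simples. -/
theorem GExt.subsingleton_quot (he : IsBasic 𝒜 e χ) (hfin : ∀ i, FiniteDimensional k (𝒜 i))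
    (hN : GradedAction 𝒜 𝒩) {q : ℕ} {ℓ : ℤ} {r : ℕ}
    (h : ∀ t < r, ∀ j, Subsingleton (GExt 𝒜 (rightSimpleGrading 𝒜 (e j)) 𝒩 q (ℓ + t))) :
    Subsingleton (GExt 𝒜 (quotIdealGrading 𝒜 (tailIdeal 𝒜 r)) 𝒩 q ℓ) := by
  induction r with
  | zero => exact GExt.subsingleton_quot_zero
  | succ r ih =>
    have := hfin r
    exact (isGradedSplit_layer 𝒜 r).subsingleton (gradedAction_quotIdealGrading _) hN
      (GExt.subsingleton_layer he (h r (by omega))) (ih fun t ht => h t (by omega))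

/-- `S_j` is a direct summand of `B / B_{≥ 1}`, so pulling back along the projection has a left
inverse. -/
theorem GExt.map_simple_quot_injective (he : IsBasic 𝒜 e χ) (j : Fin n) (q : ℕ) (ℓ : ℤ) :
    Function.Injective (GExt.map (𝒜 := 𝒜) (quotToSimple 𝒜 (e j)) LinearMap.id
      (quotToSimple_mem he j) (id_mem 𝒩) (ℓ := ℓ) (ℓ' := ℓ) (by ring) q) := by
  rw [injective_iff_map_eq_zero]
  intro x hx
  have hid : ∀ i, ∀ m ∈ rightSimpleGrading 𝒜 (e j) i,
    (LinearMap.id : RightSimple 𝒜 (e j) →ₗ[Bᵐᵒᵖ] RightSimple 𝒜 (e j)) m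
      ∈ rightSimpleGrading 𝒜 (e j) (i + 0) := id_mem _
  rw [← GExt.map_id hid (id_mem 𝒩) (by ring) (fun _ => rfl) (fun _ => rfl) q x,
    ← GExt.map_map (quotToSimple_mem he j) (id_mem 𝒩) (ℓ' := ℓ) (by ring)
      (simpleToQuot_mem (e j)) (id_mem 𝒩) (by ring) hid (id_mem 𝒩) (by ring)
      (quotToSimple_simpleToQuot he j) (fun _ => rfl), hx, map_zero]

theorem GExt.subsingleton_simple (he : IsBasic 𝒜 e χ) (j : Fin n) {q : ℕ} {ℓ : ℤ}
    [Subsingleton (GExt 𝒜 (quotIdealGrading 𝒜 (tailIdeal 𝒜 1)) 𝒩 q ℓ)] :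
    Subsingleton (GExt 𝒜 (rightSimpleGrading 𝒜 (e j)) 𝒩 q ℓ) :=
  (GExt.map_simple_quot_injective he j q ℓ).subsingleton

end ExtSimples

/-! ### The direct limit `H^q(B)` and its right action. -/

section TailCohomology

variable {k B : Type*} [Field k] [Ring B] [Algebra k B] (𝒜 : ℕ → Submodule k B) [GradedAlgebra 𝒜]

/-- `\underline{Ext}^q(B / B_{≥ r}, B)_ℓ`. -/
abbrev QuotExt (r q : ℕ) (ℓ : ℤ) : Type _ :=
  GExt 𝒜 (quotIdealGrading 𝒜 (tailIdeal 𝒜 r)) (intGrading 𝒜) q ℓ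

/-- `\underline{Ext}^q(S, B)_ℓ` for `S = eB / (eB)_{≥ 1}`. -/
abbrev SimpleExt (e : B) (q : ℕ) (ℓ : ℤ) : Type _ :=
  GExt 𝒜 (rightSimpleGrading 𝒜 e) (intGrading 𝒜) q ℓ

/-- `\underline{Ext}^q(B_{≥ r} / B_{≥ r + 1}, B)_ℓ`. -/
abbrev LayerExt (r q : ℕ) (ℓ : ℤ) : Type _ :=
  GExt 𝒜 (layerGrading 𝒜 r) (intGrading 𝒜) q ℓ

/-- The canonical map from `\underline{Ext}^q(B / B_{≥ r}, B)` to local cohomology. -/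
def level (r q : ℕ) (ℓ : ℤ) : QuotExt 𝒜 r q ℓ →ₗ[k] TailCohomology 𝒜 q ℓ :=
  Module.DirectLimit.of k ℕ (fun r => QuotExt 𝒜 r q ℓ)
    (transition 𝒜 (tailIdeal 𝒜) (tailIdeal_antitone 𝒜) (intGrading 𝒜) q ℓ) r

variable {𝒜}

theorem exists_level {q : ℕ} {ℓ : ℤ} (x : TailCohomology 𝒜 q ℓ) :
    ∃ (r : ℕ) (ξ : QuotExt 𝒜 r q ℓ), level 𝒜 r q ℓ ξ = x :=
  Module.DirectLimit.exists_of x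

theorem level_transition {q : ℕ} {ℓ : ℤ} {r s : ℕ} (h : r ≤ s) (ξ : QuotExt 𝒜 r q ℓ) :
    level 𝒜 s q ℓ (transition 𝒜 _ (tailIdeal_antitone 𝒜) (intGrading 𝒜) q ℓ r s h ξ)
      = level 𝒜 r q ℓ ξ :=
  Module.DirectLimit.of_f

instance transition_directedSystem (q : ℕ) (ℓ : ℤ) :
    DirectedSystem (fun r => QuotExt 𝒜 r q ℓ)
      (transition 𝒜 _ (tailIdeal_antitone 𝒜) (intGrading 𝒜) q ℓ · · ·) where
  map_self r x := GExt.map_id _ _ _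
    (fun m => by
      obtain ⟨y, rfl⟩ := Submodule.Quotient.mk_surjective _ m
      rfl) (fun _ => rfl) q x
  map_map r s t hrs hst x := GExt.map_map _ _ _ _ _ _ _ _ _
    (fun m => by
      obtain ⟨y, rfl⟩ := Submodule.Quotient.mk_surjective _ m
      rfl) (fun _ => rfl) q x

theorem tailCohomology_subsingleton {q : ℕ} {ℓ : ℤ} (h : ∀ r, Subsingleton (QuotExt 𝒜 r q ℓ)) :
    Subsingleton (TailCohomology 𝒜 q ℓ) := by
  refine subsingleton_of_forall_eq 0 fun x => ?_
  obtain ⟨r, ξ, rfl⟩ := exists_level x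
  rw [Subsingleton.elim ξ 0, map_zero]

/-- The action of a homogeneous element on `\underline{Ext}^q(B / B_{≥ r}, B)`. -/
def quotAct (r q : ℕ) {ℓ ℓ' : ℤ} {a : ℕ} (h : ℓ + a = ℓ') (b : B) (hb : b ∈ 𝒜 a) :
    QuotExt 𝒜 r q ℓ →ₗ[k] QuotExt 𝒜 r q ℓ' :=
  GExt.map (leftMulQuot (tailIdeal 𝒜 r) b) LinearMap.id
    (leftMulQuot_mem 𝒜 (tailIdeal 𝒜 r) a b hb) (id_mem _) (by rw [add_zero, h]) q

theorem quotAct_comp_transition (q : ℕ) {ℓ ℓ' : ℤ} {a : ℕ} (h : ℓ + a = ℓ') (b : B) (hb : b ∈ 𝒜 a)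
    (r s : ℕ) (hrs : r ≤ s) :
    quotAct s q h b hb ∘ₗ transition 𝒜 (tailIdeal 𝒜) (tailIdeal_antitone 𝒜) (intGrading 𝒜) q ℓ r s hrs
      = transition 𝒜 (tailIdeal 𝒜) (tailIdeal_antitone 𝒜) (intGrading 𝒜) q ℓ' r s hrs ∘ₗ
        quotAct r q h b hb := by
  refine LinearMap.ext fun x => ?_
  obtain ⟨f, rfl⟩ := Submodule.Quotient.mk_surjective _ x
  refine congrArg (Submodule.Quotient.mk) (Subtype.ext ?_)
  funext m g
  obtain ⟨y, rfl⟩ := Submodule.Quotient.mk_surjective _ m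
  rfl

/-- The action of a homogeneous element on local cohomology, with flexible target degree. -/
def actTo (q : ℕ) {ℓ ℓ' : ℤ} {a : ℕ} (h : ℓ + a = ℓ') (b : B) (hb : b ∈ 𝒜 a) :
    TailCohomology 𝒜 q ℓ →ₗ[k] TailCohomology 𝒜 q ℓ' :=
  Module.DirectLimit.map (fun r => quotAct r q h b hb) (quotAct_comp_transition q h b hb)

theorem actTo_level (r q : ℕ) {ℓ ℓ' : ℤ} {a : ℕ} (h : ℓ + a = ℓ') (b : B) (hb : b ∈ 𝒜 a)
    (ξ : QuotExt 𝒜 r q ℓ) :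
    actTo q h b hb (level 𝒜 r q ℓ ξ) = level 𝒜 r q ℓ' (quotAct r q h b hb ξ) :=
  Module.DirectLimit.map_apply_of (fun r => quotAct r q h b hb) (quotAct_comp_transition q h b hb) ξ

theorem act_eq_actTo (q : ℕ) (ℓ : ℤ) (a : ℕ) (b : B) (hb : b ∈ 𝒜 a) (x : TailCohomology 𝒜 q ℓ) :
    LocalCohomology.act 𝒜 _ (tailIdeal_antitone 𝒜) _ q ℓ a b hb x = actTo q rfl b hb x := rfl

/-- The first variable is contravariant, so left multiplications on `B / B_{≥ r}` compose in reverse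
and give a right action. -/
theorem actTo_actTo (q : ℕ) {ℓ ℓ' ℓ'' : ℤ} {a a' : ℕ} (h : ℓ + a = ℓ') (h' : ℓ' + a' = ℓ'')
    (h'' : ℓ + (a + a' : ℕ) = ℓ'') (b b' : B) (hb : b ∈ 𝒜 a) (hb' : b' ∈ 𝒜 a')
    (x : TailCohomology 𝒜 q ℓ) : actTo q h' b' hb' (actTo q h b hb x)
      = actTo q h'' (b * b') (SetLike.GradedMul.mul_mem hb hb') x := by
  obtain ⟨r, ξ, rfl⟩ := exists_level x
  rw [actTo_level, actTo_level, actTo_level]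
  congr 1
  refine GExt.map_map _ _ _ _ _ _ _ _ _ (fun m => ?_) (fun _ => rfl) q ξ
  obtain ⟨y, rfl⟩ := Submodule.Quotient.mk_surjective _ m
  exact congrArg Submodule.Quotient.mk (mul_assoc b b' y).symm

theorem actTo_add (q : ℕ) {ℓ ℓ' : ℤ} {a : ℕ} (h : ℓ + a = ℓ') (b b' : B) (hb : b ∈ 𝒜 a)
    (hb' : b' ∈ 𝒜 a) (x : TailCohomology 𝒜 q ℓ) :
    actTo q h (b + b') (Submodule.add_mem _ hb hb') x = actTo q h b hb x + actTo q h b' hb' x := by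
  obtain ⟨r, ξ, rfl⟩ := exists_level x
  rw [actTo_level, actTo_level, actTo_level, ← map_add]
  congr 1
  refine GExt.map_eq_add _ _ _ _ _ (fun m => ?_) q ξ
  obtain ⟨y, rfl⟩ := Submodule.Quotient.mk_surjective _ m
  exact congrArg Submodule.Quotient.mk (add_mul b b' y)

theorem actTo_smul (q : ℕ) {ℓ ℓ' : ℤ} {a : ℕ} (h : ℓ + a = ℓ') (c : k) (b : B) (hb : b ∈ 𝒜 a)
    {b' : B} (hb' : b' ∈ 𝒜 a) (hc : b' = c • b) (x : TailCohomology 𝒜 q ℓ) :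
    actTo q h b' hb' x = c • actTo q h b hb x := by
  obtain ⟨r, ξ, rfl⟩ := exists_level x
  rw [actTo_level, actTo_level, ← map_smul]
  congr 1
  refine GExt.map_eq_smul c _ _ _ _ (fun m => ?_) q ξ
  obtain ⟨y, rfl⟩ := Submodule.Quotient.mk_surjective _ m
  rw [hc]
  exact congrArg Submodule.Quotient.mk (smul_mul_assoc c b y)

/-- The pairing of `B_a` with local cohomology. -/
def actBilinear (q : ℕ) {ℓ ℓ' : ℤ} {a : ℕ} (h : ℓ + a = ℓ') :
    𝒜 a →ₗ[k] TailCohomology 𝒜 q ℓ →ₗ[k] TailCohomology 𝒜 q ℓ' where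
  toFun b := actTo q h (b : B) b.2
  map_add' b b' := LinearMap.ext fun x => actTo_add q h (b : B) (b' : B) b.2 b'.2 x
  map_smul' c b := by
    refine LinearMap.ext fun x => ?_
    rw [LinearMap.smul_apply, RingHom.id_apply]
    exact actTo_smul q h c (b : B) b.2 (c • b).2 rfl x

variable {n : ℕ} {e : Fin n → B} {χ : Fin n → B → k}

/-- The map `\underline{Ext}^q(S_j, B) → H^q(B)`. -/
def simpleLevel (he : IsBasic 𝒜 e χ) (j : Fin n) (q : ℕ) (ℓ : ℤ) :
    SimpleExt 𝒜 (e j) q ℓ →ₗ[k] TailCohomology 𝒜 q ℓ :=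
  level 𝒜 1 q ℓ ∘ₗ GExt.map (quotToSimple 𝒜 (e j)) LinearMap.id (quotToSimple_mem he j) (id_mem _)
    (by ring) q

/-- Restriction of `Ext` classes from `B / B_{≥ r + 1}` to `B_{≥ r} / B_{≥ r + 1}`. -/
def layerRestrict (𝒜 : ℕ → Submodule k B) [GradedAlgebra 𝒜] (r q : ℕ) (ℓ : ℤ) : QuotExt 𝒜 (r + 1) q ℓ →ₗ[k] LayerExt 𝒜 r q ℓ :=
  GExt.map (layer 𝒜 r).subtype LinearMap.id (isGradedSplit_layer 𝒜 r).ι_mem (id_mem _) (by ring) q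

/-- Restriction of `Ext` classes along left multiplication by an element of `B_r`. -/
def simpleRestrict (he : IsBasic 𝒜 e χ) (j : Fin n) {r : ℕ} (q : ℕ) {ℓ ℓ' : ℤ} (h : ℓ + r = ℓ')
    (y : B) (hy : y ∈ 𝒜 r) : LayerExt 𝒜 r q ℓ →ₗ[k] SimpleExt 𝒜 (e j) q ℓ' :=
  GExt.map (simpleToLayer (e j) y hy) LinearMap.id (simpleToLayer_mem he j y hy) (id_mem _)
    (by rw [add_zero, h]) q

theorem IsBasic.mul_mem (he : IsBasic 𝒜 e χ) (j : Fin n) {r : ℕ} {y : B} (hy : y ∈ 𝒜 r) :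
    y * e j ∈ 𝒜 r := by
  have := SetLike.GradedMul.mul_mem hy (he.mem j)
  rwa [add_zero] at this

/-- The composite of the projection `B / B_{≥ r+1} → B / B_{≥ 1} → S_j` with `S_j → B_{≥ r} / B_{≥
r+1} ⊆ B / B_{≥ r+1}` is left multiplication by `y e_j`. Hence restricting a class to a simple of
the layer amounts, inside `H^q`, to acting by `y e_j`. This links the filtration with the module
structure. -/
theorem simpleLevel_restrict (he : IsBasic 𝒜 e χ) (j : Fin n) {r : ℕ} (q : ℕ) {ℓ ℓ' : ℤ}
    (h : ℓ + r = ℓ') (y : B) (hy : y ∈ 𝒜 r) (ξ : QuotExt 𝒜 (r + 1) q ℓ) :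
    simpleLevel he j q ℓ' (simpleRestrict he j q h y hy (layerRestrict 𝒜 r q ℓ ξ))
      = actTo q h (y * e j) (he.mul_mem j hy) (level 𝒜 (r + 1) q ℓ ξ) := by
  rw [actTo_level, simpleLevel, LinearMap.comp_apply]
  refine (level_transition (Nat.le_add_left 1 r) _).symm.trans ?_
  congr 1
  have h₁ : ∀ i, ∀ m ∈ rightSimpleGrading 𝒜 (e j) i,
      ((layer 𝒜 r).subtype ∘ₗ simpleToLayer (e j) y hy) m
        ∈ quotIdealGrading 𝒜 (tailIdeal 𝒜 (r + 1)) (i + r) := fun i m hm =>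
    simpleToLayer_mem he j y hy i m hm
  have h₂ : ∀ i, ∀ m ∈ quotIdealGrading 𝒜 (tailIdeal 𝒜 1) i,
      ((layer 𝒜 r).subtype ∘ₗ simpleToLayer (e j) y hy ∘ₗ quotToSimple 𝒜 (e j)) m
        ∈ quotIdealGrading 𝒜 (tailIdeal 𝒜 (r + 1)) (i + r) := fun i m hm => by
    have := h₁ _ _ (quotToSimple_mem he j i m hm)
    rw [add_zero] at this
    exact this
  have e₁ : simpleRestrict he j q h y hy (layerRestrict 𝒜 r q ℓ ξ) = GExt.map (𝒜 := 𝒜) _ LinearMap.id h₁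
      (id_mem (intGrading 𝒜)) (ℓ' := ℓ') (by rw [add_zero, h]) q ξ :=
    GExt.map_map _ _ _ _ _ _ _ _ _ (fun _ => rfl) (fun _ => rfl) q ξ
  have e₂ : GExt.map (quotToSimple 𝒜 (e j)) LinearMap.id (quotToSimple_mem he j)
      (id_mem (intGrading 𝒜)) (ℓ' := ℓ') (by ring) q (simpleRestrict he j q h y hy (layerRestrict 𝒜 r q ℓ ξ))
      = GExt.map (𝒜 := 𝒜) _ LinearMap.id h₂ (id_mem (intGrading 𝒜)) (ℓ' := ℓ') (by rw [add_zero, h]) q ξ := by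
    rw [e₁]
    exact GExt.map_map _ _ _ _ _ _ _ _ _ (fun _ => rfl) (fun _ => rfl) q ξ
  rw [e₂]
  refine GExt.map_map _ _ _ _ _ _ _ _ _ (fun m => ?_) (fun _ => rfl) q ξ
  obtain ⟨x, rfl⟩ := Submodule.Quotient.mk_surjective _ m
  exact congrArg Submodule.Quotient.mk (mul_assoc y (e j) x).symm

theorem quotAct_eq_zero {r q : ℕ} {ℓ ℓ' : ℤ} {a : ℕ} (h : ℓ + a = ℓ') {b : B} (hb : b ∈ 𝒜 a)
    (hra : r ≤ a) (ξ : QuotExt 𝒜 r q ℓ) : quotAct r q h b hb ξ = 0 := by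
  refine GExt.map_eq_zero _ _ _ (fun m => ?_) q ξ
  obtain ⟨x, rfl⟩ := Submodule.Quotient.mk_surjective _ m
  refine (Submodule.Quotient.mk_eq_zero _).2 ?_
  exact (tailIdeal 𝒜 r).mul_mem_right x (mem_tailIdeal_of_mem 𝒜 hb hra)

end TailCohomology

/-! ### The duality between local cohomology and the Matlis duals of the `B e_b`. -/

section Matlis

variable {k B : Type*} [Field k] [Ring B] [Algebra k B] {𝒜 : ℕ → Submodule k B} [GradedAlgebra 𝒜]
variable {n : ℕ} {e : Fin n → B} {χ : Fin n → B → k} {N : ℕ} {s : Fin n → ℤ}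

/-- The part of the generalized Gorenstein condition about dimensions: `\underline{Ext}^i(S_j, B)`
is one-dimensional, concentrated in degree `-s_j`, for `i = N`, and zero for `i ≠ N`. -/
structure IsExtConcentrated (𝒜 : ℕ → Submodule k B) [GradedAlgebra 𝒜] (e : Fin n → B) (N : ℕ)
    (s : Fin n → ℤ) : Prop where
  of_ne : ∀ j i ℓ, i ≠ N → Subsingleton (SimpleExt 𝒜 (e j) i ℓ)
  of_degree_ne : ∀ j ℓ, ℓ ≠ -s j → Subsingleton (SimpleExt 𝒜 (e j) N ℓ)
  exists_gen : ∀ j, ∃ g : SimpleExt 𝒜 (e j) N (-s j), g ≠ 0 ∧ ∀ x, ∃ c : k, x = c • g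

theorem IsExtConcentrated.subsingleton_quot (hG : IsExtConcentrated 𝒜 e N s) (he : IsBasic 𝒜 e χ)
    (hfin : ∀ i, FiniteDimensional k (𝒜 i)) (r : ℕ) {q : ℕ} (hq : q ≠ N) (ℓ : ℤ) :
    Subsingleton (QuotExt 𝒜 r q ℓ) :=
  GExt.subsingleton_quot he hfin gradedAction_intGrading fun _ _ j => hG.of_ne j q _ hq

theorem IsExtConcentrated.subsingleton_layer (hG : IsExtConcentrated 𝒜 e N s) (he : IsBasic 𝒜 e χ)
    (hfin : ∀ i, FiniteDimensional k (𝒜 i)) (r : ℕ) {q : ℕ} (hq : q ≠ N) (ℓ : ℤ) :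
    Subsingleton (LayerExt 𝒜 r q ℓ) :=
  have := hfin r
  GExt.subsingleton_layer he fun j => hG.of_ne j q _ hq

/-- One step at a time: the kernel of `Ext^N(B / B_{≥ t}, B) → Ext^N(B / B_{≥ t+1}, B)` comes from
`Ext^{N-1}` of the layer, which is zero. -/
theorem IsExtConcentrated.transition_injective (hG : IsExtConcentrated 𝒜 e N s)
    (he : IsBasic 𝒜 e χ) (hfin : ∀ i, FiniteDimensional k (𝒜 i)) {r t : ℕ} (h : r ≤ t) (ℓ : ℤ)
    (x : QuotExt 𝒜 r N ℓ)
    (hx : transition 𝒜 _ (tailIdeal_antitone 𝒜) (intGrading 𝒜) N ℓ r t h x = 0) : x = 0 := by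
  induction t, h using Nat.le_induction with
  | base =>
    rwa [DirectedSystem.map_self (f := fun r t h => transition 𝒜 _ (tailIdeal_antitone 𝒜)
      (intGrading 𝒜) N ℓ r t h)] at hx
  | succ t h ih =>
    have h2 := DirectedSystem.map_map (f := fun r t h => transition 𝒜 _ (tailIdeal_antitone 𝒜)
      (intGrading 𝒜) N ℓ r t h) h t.le_succ x
    rw [← h2] at hx
    refine ih ?_
    refine (injective_iff_map_eq_zero _).1 ((isGradedSplit_layer 𝒜 t).injective (q := N) (ℓ := ℓ)
      (gradedAction_quotIdealGrading _) gradedAction_intGrading fun q' hq' =>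
        hG.subsingleton_layer he hfin t (by omega) ℓ) _ hx

theorem IsExtConcentrated.simpleLevel_injective (hG : IsExtConcentrated 𝒜 e N s)
    (he : IsBasic 𝒜 e χ) (hfin : ∀ i, FiniteDimensional k (𝒜 i)) (j : Fin n) (ℓ : ℤ)
    (x : SimpleExt 𝒜 (e j) N ℓ) (hx : simpleLevel he j N ℓ x = 0) : x = 0 := by
  -- A class dying in the limit dies at a finite stage, where injectivity of the transition maps
  -- applies.
  obtain ⟨t, ht, h⟩ := Module.DirectLimit.of.zero_exact hx
  exact (injective_iff_map_eq_zero _).1 (GExt.map_simple_quot_injective he j N ℓ) _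
    (hG.transition_injective he hfin ht ℓ _ h)

theorem exists_dual_ne_zero {k E : Type*} [Field k] [AddCommMonoid E] [Module k E] {v : E}
    (hv : v ≠ 0) : ∃ f : E →ₗ[k] k, f v ≠ 0 := by
  let _ : AddCommGroup E := Module.addCommMonoidToAddCommGroup k
  by_contra! hcon
  exact hv ((Module.forall_dual_apply_eq_zero_iff k v).1 hcon)

theorem injective_of_map_eq_zero {k E F : Type*} [Field k] [AddCommMonoid E] [Module k E]
    [AddCommMonoid F] [Module k F] (f : E →ₗ[k] F) (h : ∀ x, f x = 0 → x = 0) :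
    Function.Injective f := by
  let _ : AddCommGroup E := Module.addCommMonoidToAddCommGroup k
  let _ : AddCommGroup F := Module.addCommMonoidToAddCommGroup k
  exact (injective_iff_map_eq_zero f).2 h

/-- The generator for `S_j` stays nonzero in `H^N`, so some linear form there can be normalized to
take the value 1 on it. These forms define the duality pairing. -/
theorem IsExtConcentrated.exists_functional (hG : IsExtConcentrated 𝒜 e N s)
    (he : IsBasic 𝒜 e χ) (hfin : ∀ i, FiniteDimensional k (𝒜 i)) (j : Fin n) :
    ∃ (g : SimpleExt 𝒜 (e j) N (-s j)) (f : TailCohomology 𝒜 N (-s j) →ₗ[k] k),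
      f (simpleLevel he j N (-s j) g) = 1 ∧ ∀ x, ∃ c : k, x = c • g := by
  obtain ⟨g, hg0, hg⟩ := hG.exists_gen j
  have h0 : simpleLevel he j N (-s j) g ≠ 0 := fun h =>
    hg0 (hG.simpleLevel_injective he hfin j _ g h)
  obtain ⟨f, hf⟩ := exists_dual_ne_zero (k := k) h0
  refine ⟨g, (f (simpleLevel he j N (-s j) g))⁻¹ • f, ?_, hg⟩
  rw [LinearMap.smul_apply, smul_eq_mul, inv_mul_cancel₀ hf]

/-- The homogeneous component of degree `d`, as a map to `𝒜 d`. -/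
def toPiece (𝒜 : ℕ → Submodule k B) [GradedAlgebra 𝒜] (d : ℕ) : B →ₗ[k] 𝒜 d :=
  (component 𝒜 d).codRestrict _ (component_mem 𝒜 d)

/-- The pairing `(y, x) ↦ f (x y)` of `B` with local cohomology defined by a linear form `f` of degree
`c`. -/
def pairing {c : ℤ} (f : TailCohomology 𝒜 N c →ₗ[k] k) (ℓ : ℤ) :
    B →ₗ[k] TailCohomology 𝒜 N ℓ →ₗ[k] k := by
  classical
  -- At most one `d` brings degree `ℓ` to the degree `c` of `f`; if `ℓ > c` there is none and the
  -- pairing is zero.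
  exact if h : ∃ d : ℕ, ℓ + d = c then
    LinearMap.compRight k f ∘ₗ actBilinear N h.choose_spec ∘ₗ toPiece 𝒜 h.choose else 0

theorem pairing_apply {c : ℤ} (f : TailCohomology 𝒜 N c →ₗ[k] k) {ℓ : ℤ} {d : ℕ} (h : ℓ + d = c)
    (y : B) (x : TailCohomology 𝒜 N ℓ) :
    pairing f ℓ y x = f (actTo N h (component 𝒜 d y) (component_mem 𝒜 d y) x) := by
  have hex : ∃ d : ℕ, ℓ + d = c := ⟨d, h⟩
  obtain rfl : d = hex.choose := by
    have := hex.choose_spec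
    omega
  rw [pairing, dif_pos hex]
  rfl

theorem pairing_apply_of_mem {c : ℤ} (f : TailCohomology 𝒜 N c →ₗ[k] k) {ℓ : ℤ} {d : ℕ}
    (h : ℓ + d = c) {y : B} (hy : y ∈ 𝒜 d) (x : TailCohomology 𝒜 N ℓ) :
    pairing f ℓ y x = f (actTo N h y hy x) := by
  rw [pairing_apply f h]
  congr 2
  congr 1
  exact component_of_mem hy

theorem pairing_of_not_exists {c : ℤ} (f : TailCohomology 𝒜 N c →ₗ[k] k) {ℓ : ℤ}
    (h : ¬ ∃ d : ℕ, ℓ + d = c) : pairing f ℓ = 0 := dif_neg h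

theorem pairing_of_mem_ne {c : ℤ} (f : TailCohomology 𝒜 N c →ₗ[k] k) {ℓ : ℤ} {d : ℕ}
    (h : ℓ + d ≠ c) {y : B} (hy : y ∈ 𝒜 d) (x : TailCohomology 𝒜 N ℓ) : pairing f ℓ y x = 0 := by
  by_cases hex : ∃ d : ℕ, ℓ + d = c
  · obtain ⟨d', h'⟩ := hex
    have : component 𝒜 d' y = 0 := component_of_mem_ne hy (by rintro rfl; exact h h')
    rw [pairing_apply f h']
    have h0 := actTo_smul N h' (0 : k) (component 𝒜 d' y) (component_mem 𝒜 d' y)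
      (component_mem 𝒜 d' y) (by rw [this, smul_zero]) x
    rw [zero_smul] at h0
    rw [h0, map_zero]
  · rw [pairing_of_not_exists f hex]
    rfl

/-- Associativity `f((x r) y) = f(x (r y))`, checked on homogeneous `y`; it is the right linearity
of the map to the Matlis dual. -/
theorem pairing_actTo {c : ℤ} (f : TailCohomology 𝒜 N c →ₗ[k] k) {ℓ : ℤ} {a : ℕ} {r : B}
    (hr : r ∈ 𝒜 a) (y : B) (x : TailCohomology 𝒜 N ℓ) :
    pairing f (ℓ + a) y (actTo N rfl r hr x) = pairing f ℓ (r * y) x := by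
  have key : ∀ d, ∀ y ∈ 𝒜 d, pairing f (ℓ + a) y (actTo N rfl r hr x) = pairing f ℓ (r * y) x := by
    intro d y hy
    by_cases h : ℓ + a + d = c
    · have h' : ℓ + (a + d : ℕ) = c := by push_cast; rw [← h]; ring
      rw [pairing_apply_of_mem f h hy, pairing_apply_of_mem f h' (SetLike.GradedMul.mul_mem hr hy),
        actTo_actTo N rfl h h']
    · rw [pairing_of_mem_ne f h hy, pairing_of_mem_ne f (d := a + d) (by
        push_cast
        rw [← add_assoc]
        exact h) (SetLike.GradedMul.mul_mem hr hy)]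
  classical
  rw [← DirectSum.sum_support_decompose 𝒜 y, Finset.mul_sum]
  simp only [map_sum, LinearMap.sum_apply]
  exact Finset.sum_congr rfl fun d _ => key d _ (SetLike.coe_mem _)

theorem span_eq_mul {e : B} {y : B} (hy : y ∈ Submodule.span B {e}) : ∃ z, y = z * e := by
  obtain ⟨z, rfl⟩ := Submodule.mem_span_singleton.1 hy
  exact ⟨z, rfl⟩

theorem component_mem_span (he : IsBasic 𝒜 e χ) (j : Fin n) (d : ℕ) {y : B}
    (hy : y ∈ Submodule.span B {e j}) : component 𝒜 d y ∈ Submodule.span B {e j} := by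
  obtain ⟨z, rfl⟩ := span_eq_mul hy
  have := component_mul_add (i := d) z (he.mem j)
  rw [add_zero] at this
  rw [this]
  exact Submodule.mem_span_singleton.2 ⟨_, rfl⟩

theorem matlisDual_eq_zero (he : IsBasic 𝒜 e χ) (j : Fin n) {m : ℤ}
    {ψ : Module.Dual k ↥(Submodule.span B {e j})} (hψ : ψ ∈ matlisDual 𝒜 (e j) m)
    (h : ∀ d : ℕ, m + d = 0 → ∀ y (hy : y ∈ Submodule.span B {e j}), y ∈ 𝒜 d → ψ ⟨y, hy⟩ = 0) :
    ψ = 0 := by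
  have key : ∀ (d : ℕ) y (hy : y ∈ Submodule.span B {e j}), y ∈ 𝒜 d → ψ ⟨y, hy⟩ = 0 := by
    intro d y hy hyd
    by_cases hd : m + d = 0
    · exact h d hd y hy hyd
    · exact hψ d (by omega) ⟨y, hy⟩ hyd
  refine LinearMap.ext fun y => ?_
  obtain ⟨y, hy⟩ := y
  classical
  have hsum : (⟨y, hy⟩ : Submodule.span B {e j})
      = ∑ d ∈ (DirectSum.decompose 𝒜 y).support,
        ⟨component 𝒜 d y, component_mem_span he j d hy⟩ := by
    refine Subtype.ext ?_
    rw [Submodule.coe_sum]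
    exact (DirectSum.sum_support_decompose 𝒜 y).symm
  rw [hsum, map_sum]
  exact Finset.sum_eq_zero fun d _ => key d _ _ (component_mem 𝒜 d y)

/-- The linear map from local cohomology to the Matlis dual defined by a linear form. -/
def toMatlis (e : B) {c : ℤ} (f : TailCohomology 𝒜 N c →ₗ[k] k) (m ℓ : ℤ) (hm : m = -c + ℓ) :
    TailCohomology 𝒜 N ℓ →ₗ[k] matlisDual 𝒜 e m :=
  ((LinearMap.lcomp k k ((Submodule.span B {e}).subtype.restrictScalars k)) ∘ₗ
    (pairing f ℓ).flip).codRestrict _ (by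
      intro x i hi y hy
      have hy' : (y : B) ∈ intGrading 𝒜 i := hy
      show pairing f ℓ (y : B) x = 0
      rcases mem_intGrading_cases hy' with h0 | ⟨d, rfl, h⟩
      · rw [h0, map_zero]
        rfl
      · exact pairing_of_mem_ne f (by omega) h x)

theorem toMatlis_apply (e : B) {c : ℤ} (f : TailCohomology 𝒜 N c →ₗ[k] k) (m ℓ : ℤ)
    (hm : m = -c + ℓ) (x : TailCohomology 𝒜 N ℓ) (y : Submodule.span B {e}) :
    (toMatlis e f m ℓ hm x : Module.Dual k _) y = pairing f ℓ (y : B) x := rfl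

/-- Pairing with elements of `B_r e_j` sees only the restriction of a class to the layer in degree
`r`. -/
theorem pairing_mul_idempotent (he : IsBasic 𝒜 e χ) (j : Fin n) {c : ℤ}
    (f : TailCohomology 𝒜 N c →ₗ[k] k) {ℓ : ℤ} {r : ℕ} (h : ℓ + r = c) {y : B} (hy : y ∈ 𝒜 r)
    (ξ : QuotExt 𝒜 (r + 1) N ℓ) : pairing f ℓ (y * e j) (level 𝒜 (r + 1) N ℓ ξ)
      = f (simpleLevel he j N c (simpleRestrict he j N h y hy (layerRestrict 𝒜 r N ℓ ξ))) := by
  rw [pairing_apply_of_mem f h (he.mul_mem j hy), simpleLevel_restrict]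

variable {g : ∀ j, SimpleExt 𝒜 (e j) N (-s j)} {f : ∀ j, TailCohomology 𝒜 N (-s j) →ₗ[k] k}

/-- Descent on `r`. Restricted to `S_j` along `y`, the class `ξ` is a multiple of `g j` whose
coefficient is the pairing with `y e_j`, hence zero. So `ξ` vanishes on the top layer, comes from `B
/ B_{≥ r}`, and has the same image in the limit. -/
theorem IsExtConcentrated.level_eq_zero (hG : IsExtConcentrated 𝒜 e N s) (he : IsBasic 𝒜 e χ)
    (hfin : ∀ i, FiniteDimensional k (𝒜 i))
    (hf : ∀ j, f j (simpleLevel he j N (-s j) (g j)) = 1)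
    (hg : ∀ j x, ∃ c : k, x = c • g j) {ℓ : ℤ} (r : ℕ) (ξ : QuotExt 𝒜 r N ℓ)
    (h : ∀ j y, pairing (f j) ℓ (y * e j) (level 𝒜 r N ℓ ξ) = 0) : level 𝒜 r N ℓ ξ = 0 := by
  induction r with
  | zero =>
    have : Subsingleton (QuotExt 𝒜 0 N ℓ) := GExt.subsingleton_quot_zero
    rw [Subsingleton.elim ξ 0, map_zero]
  | succ r ih =>
    have hz : layerRestrict 𝒜 r N ℓ ξ = 0 := by
      have := hfin r
      refine GExt.layer_eq_zero he (by rw [add_zero]) _ fun j y hy => ?_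
      by_cases hj : ℓ + r = -s j
      · obtain ⟨c, hc⟩ := hg j (simpleRestrict he j N hj y hy (layerRestrict 𝒜 r N ℓ ξ))
        have h1 := h j y
        rw [pairing_mul_idempotent he j (f j) hj hy, hc, map_smul, map_smul, hf, smul_eq_mul,
          mul_one] at h1
        rw [h1, zero_smul] at hc
        -- The degrees `ℓ + r` and `-s j` are equal only through `hj`; generalizing the target
        -- degree transports the vanishing.
        have h2 : ∀ (ℓ' : ℤ) (h : ℓ + r = ℓ'), ℓ' = -s j →
            simpleRestrict he j N h y hy (layerRestrict 𝒜 r N ℓ ξ) = 0 := by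
          rintro _ _ rfl
          exact hc
        exact h2 (ℓ + r) rfl hj
      · have := hG.of_degree_ne j _ hj
        exact Subsingleton.elim _ _
    obtain ⟨ξ', hξ'⟩ := (isGradedSplit_layer 𝒜 r).exact_ext (gradedAction_quotIdealGrading _)
      gradedAction_intGrading ξ hz
    have hl : level 𝒜 (r + 1) N ℓ ξ = level 𝒜 r N ℓ ξ' := by
      rw [← level_transition r.le_succ ξ', ← hξ']
      rfl
    rw [hl] at h ⊢
    exact ih ξ' h

/-- The class in `\underline{Ext}^N(B_{≥ r} / B_{≥ r + 1}, B)` induced by a class on `S_j` and a linear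
form `ψ`. -/
def layerClass (he : IsBasic 𝒜 e χ) (j : Fin n) (r : ℕ) (ψ : B →ₗ[k] k) {ℓ ℓ' : ℤ} (h : ℓ + r = ℓ')
    (x : SimpleExt 𝒜 (e j) N ℓ') : LayerExt 𝒜 r N ℓ :=
  GExt.map (layerToSimple he j r ψ) LinearMap.id (layerToSimple_mem he j ψ)
    (id_mem (intGrading 𝒜)) (by rw [← h]; ring) N x

theorem layerToSimple_simpleToLayer (he : IsBasic 𝒜 e χ) (i j : Fin n) {r : ℕ} (ψ : B →ₗ[k] k)
    {y : B} (hy : y ∈ 𝒜 r) : layerToSimple he j r ψ (simpleToLayer (e i) y hy (simpleGen 𝒜 (e i)))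
      = ψ (y * e i * e j) • simpleGen 𝒜 (e j) :=
  layerToSimple_mk he j ψ (he.mul_mem i hy) _

/-- The composite `S_j → B_{≥ r} / B_{≥ r+1} → S_j` is the scalar `ψ(y e_j)`. For different simples
it is zero because `y e_i e_j = 0`, which is the next lemma. -/
theorem simpleRestrict_layerClass_self (he : IsBasic 𝒜 e χ) (j : Fin n) {r : ℕ} (ψ : B →ₗ[k] k)
    {ℓ ℓ' : ℤ} (h : ℓ + r = ℓ') (x : SimpleExt 𝒜 (e j) N ℓ') {y : B} (hy : y ∈ 𝒜 r) :
    simpleRestrict he j N h y hy (layerClass he j r ψ h x) = ψ (y * e j) • x := by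
  have h1 : ∀ i, ∀ m ∈ rightSimpleGrading 𝒜 (e j) i,
      (layerToSimple he j r ψ ∘ₗ simpleToLayer (e j) y hy) m
        ∈ rightSimpleGrading 𝒜 (e j) (i + 0) := fun i m hm => by
    have := layerToSimple_mem he j ψ _ _ (simpleToLayer_mem he j y hy i m hm)
    rw [add_neg_cancel_right] at this
    rw [add_zero]
    exact this
  have h2 : simpleRestrict he j N h y hy (layerClass he j r ψ h x)
      = GExt.map (𝒜 := 𝒜) _ LinearMap.id h1 (id_mem (intGrading 𝒜)) (ℓ' := ℓ') (by ring) N x :=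
    GExt.map_map _ _ _ _ _ _ _ _ _ (fun _ => rfl) (fun _ => rfl) N x
  rw [h2, GExt.map_eq_smul (α' := LinearMap.id) (ψ (y * e j)) h1 (id_mem _) (id_mem _) (by ring)
    (fun m => ?_), GExt.map_id _ _ _ (fun _ => rfl) (fun _ => rfl)]
  obtain ⟨c, rfl⟩ := simple_exists he m
  have hs : ∀ z, (layerToSimple he j r ψ ∘ₗ simpleToLayer (e j) y hy) (c • z)
      = c • (layerToSimple he j r ψ ∘ₗ simpleToLayer (e j) y hy) z := fun z =>
    ((layerToSimple he j r ψ ∘ₗ simpleToLayer (e j) y hy).restrictScalars k).map_smul c z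
  rw [hs, LinearMap.comp_apply, layerToSimple_simpleToLayer, mul_assoc, he.mul_self]
  exact smul_comm c (ψ (y * e j)) (simpleGen 𝒜 (e j))

theorem simpleRestrict_layerClass_ne (he : IsBasic 𝒜 e χ) {i j : Fin n} (hij : i ≠ j) {r : ℕ}
    (ψ : B →ₗ[k] k) {ℓ ℓ' : ℤ} (h : ℓ + r = ℓ') (x : SimpleExt 𝒜 (e j) N ℓ')
    {y : B} (hy : y ∈ 𝒜 r) :
    simpleRestrict he i N h y hy (layerClass he j r ψ h x) = 0 := by
  have h1 : ∀ t, ∀ m ∈ rightSimpleGrading 𝒜 (e i) t,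
      (layerToSimple he j r ψ ∘ₗ simpleToLayer (e i) y hy) m
        ∈ rightSimpleGrading 𝒜 (e j) (t + 0) := fun t m hm => by
    have := layerToSimple_mem he j ψ _ _ (simpleToLayer_mem he i y hy t m hm)
    rw [add_neg_cancel_right] at this
    rw [add_zero]
    exact this
  have h2 : simpleRestrict he i N h y hy (layerClass he j r ψ h x)
      = GExt.map (𝒜 := 𝒜) _ LinearMap.id h1 (id_mem (intGrading 𝒜)) (ℓ' := ℓ') (by ring) N x :=
    GExt.map_map _ _ _ _ _ _ _ _ _ (fun _ => rfl) (fun _ => rfl) N x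
  rw [h2, GExt.map_eq_zero h1 (id_mem _) (by ring) (fun m => ?_)]
  obtain ⟨c, rfl⟩ := simple_exists he m
  have hs : ∀ z, (layerToSimple he j r ψ ∘ₗ simpleToLayer (e i) y hy) (c • z)
      = c • (layerToSimple he j r ψ ∘ₗ simpleToLayer (e i) y hy) z := fun z =>
    ((layerToSimple he j r ψ ∘ₗ simpleToLayer (e i) y hy).restrictScalars k).map_smul c z
  rw [hs, LinearMap.comp_apply, layerToSimple_simpleToLayer, mul_assoc, he.mul_ne i j hij, mul_zero,
    map_zero]
  have h0 : (0 : k) • simpleGen 𝒜 (e j) = 0 := zero_smul k (simpleGen 𝒜 (e j))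
  exact (congrArg (c • ·) h0).trans (smul_zero c)

-- Realizes prescribed pairings in the top degree `r`: the sum of the layer classes for those `j`
-- with `ℓ + r = -s j` has the right values, and it extends to `B / B_{≥ r+1}` because `Ext^{N+1}(B
-- / B_{≥ r}, B) = 0`.
open Classical in
theorem IsExtConcentrated.exists_layerRestrict (hG : IsExtConcentrated 𝒜 e N s)
    (he : IsBasic 𝒜 e χ) (hfin : ∀ i, FiniteDimensional k (𝒜 i))
    (hf : ∀ j, f j (simpleLevel he j N (-s j) (g j)) = 1) {ℓ : ℤ} (r : ℕ)
    (ψ : Fin n → B →ₗ[k] k) : ∃ ξ : QuotExt 𝒜 (r + 1) N ℓ, ∀ i, ℓ + r = -s i → ∀ y ∈ 𝒜 r,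
      pairing (f i) ℓ (y * e i) (level 𝒜 (r + 1) N ℓ ξ) = ψ i (y * e i) := by
  let ζ : LayerExt 𝒜 r N ℓ :=
    ∑ j, if h : ℓ + r = -s j then layerClass he j r (ψ j) h (g j) else 0
  obtain ⟨ξ, hξ⟩ := (isGradedSplit_layer 𝒜 r).surjective (gradedAction_quotIdealGrading _)
    gradedAction_intGrading (hG.subsingleton_quot he hfin r (by omega) ℓ) ζ
  have hξ' : layerRestrict 𝒜 r N ℓ ξ = ζ := hξ
  refine ⟨ξ, fun i hi y hy => ?_⟩
  rw [pairing_mul_idempotent he i (f i) hi hy, hξ', map_sum,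
    Finset.sum_eq_single i (fun j _ hj => ?_) (fun h => absurd (Finset.mem_univ i) h)]
  · rw [dif_pos hi, simpleRestrict_layerClass_self, map_smul, map_smul, hf, smul_eq_mul, mul_one]
  · split_ifs with h
    · have h2 : ∀ (ℓ' : ℤ) (h' : ℓ + r = ℓ') (x : SimpleExt 𝒜 (e j) N ℓ'),
          simpleRestrict he i N hi y hy (layerClass he j r (ψ j) h' x) = 0 := by
        intro ℓ' h' x
        have : ℓ' = -s i := h'.symm.trans hi
        subst this
        exact simpleRestrict_layerClass_ne he hj.symm (ψ j) h' x hy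
      exact h2 _ h (g j)
    · exact map_zero _

/-- Successive approximation from the top degree downwards: match the degree `r` values on the top
layer, then treat the difference at the previous stage. -/
theorem IsExtConcentrated.exists_level_pairing (hG : IsExtConcentrated 𝒜 e N s)
    (he : IsBasic 𝒜 e χ) (hfin : ∀ i, FiniteDimensional k (𝒜 i))
    (hf : ∀ j, f j (simpleLevel he j N (-s j) (g j)) = 1) {ℓ : ℤ} (r : ℕ)
    (ψ : Fin n → B →ₗ[k] k)
    (hψ : ∀ j (d : ℕ), ℓ + d = -s j → r ≤ d → ∀ y ∈ 𝒜 d, ψ j (y * e j) = 0) :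
    ∃ ξ : QuotExt 𝒜 r N ℓ, ∀ j (d : ℕ), ℓ + d = -s j → ∀ y ∈ 𝒜 d,
      pairing (f j) ℓ (y * e j) (level 𝒜 r N ℓ ξ) = ψ j (y * e j) := by
  induction r generalizing ψ with
  | zero =>
    refine ⟨0, fun j d hd y hy => ?_⟩
    rw [map_zero, map_zero, hψ j d hd (Nat.zero_le d) y hy]
  | succ r ih =>
    obtain ⟨ξ, hξ⟩ := hG.exists_layerRestrict he hfin hf (ℓ := ℓ) r ψ
    -- The remainder vanishes in degree `r` by the choice of `ξ`. In degrees above `r` the given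
    -- form vanishes by assumption, and the pairing with `ξ` does too, as `B_{≥ r+1}` acts by zero
    -- on `Ext(B / B_{≥ r+1}, B)`.
    obtain ⟨ξ', hξ'⟩ := ih (fun j => ψ j - (pairing (f j) ℓ).flip (level 𝒜 (r + 1) N ℓ ξ)) (by
      intro j d hd hrd y hy
      rw [LinearMap.sub_apply, LinearMap.flip_apply, sub_eq_zero]
      rcases hrd.eq_or_lt with rfl | hlt
      · exact (hξ j hd y hy).symm
      · rw [hψ j d hd hlt y hy, pairing_apply_of_mem (f j) hd (he.mul_mem j hy), actTo_level,
          quotAct_eq_zero hd (he.mul_mem j hy) hlt, map_zero, map_zero])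
    refine ⟨ξ + transition 𝒜 _ (tailIdeal_antitone 𝒜) (intGrading 𝒜) N ℓ r (r + 1) r.le_succ ξ',
      fun j d hd y hy => ?_⟩
    rw [map_add, level_transition, map_add, hξ' j d hd y hy, LinearMap.sub_apply,
      LinearMap.flip_apply]
    exact add_sub_cancel _ _

theorem IsExtConcentrated.exists_matlis_equiv (hG : IsExtConcentrated 𝒜 e N s)
    (he : IsBasic 𝒜 e χ) (hfin : ∀ i, FiniteDimensional k (𝒜 i)) :
    ∃ φ : (ℓ : ℤ) → TailCohomology 𝒜 N ℓ ≃ₗ[k] ((b : Fin n) → matlisDual 𝒜 (e b) (s b + ℓ)),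
      ∀ (ℓ : ℤ) (a : ℕ) (r : B) (hr : r ∈ 𝒜 a) (x : TailCohomology 𝒜 N ℓ) (b : Fin n)
        (y : ↥(Submodule.span B {e b})),
        (φ (ℓ + a) (GradedExt.LocalCohomology.act 𝒜 _ _ _ N ℓ a r hr x) b : Module.Dual k _) y
          = (φ ℓ x b : Module.Dual k _) (r • y) := by
  choose g f hf hg using hG.exists_functional he hfin
  let Φ : (ℓ : ℤ) → TailCohomology 𝒜 N ℓ →ₗ[k] ((b : Fin n) → matlisDual 𝒜 (e b) (s b + ℓ)) :=
    fun ℓ => LinearMap.pi fun b => toMatlis (e b) (f b) (s b + ℓ) ℓ (by ring)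
  have hΦ : ∀ ℓ x b (y : Submodule.span B {e b}), (Φ ℓ x b : Module.Dual k _) y = pairing (f b) ℓ (y : B) x :=
    fun ℓ x b y => toMatlis_apply (e b) (f b) (s b + ℓ) ℓ (by ring) x y
  have hinj : ∀ ℓ, Function.Injective (Φ ℓ) := by
    intro ℓ
    refine injective_of_map_eq_zero _ fun x hx => ?_
    obtain ⟨r, ξ, rfl⟩ := exists_level x
    refine hG.level_eq_zero he hfin hf hg r ξ fun j y => ?_
    have h1 := hΦ ℓ (level 𝒜 r N ℓ ξ) j ⟨y * e j, Submodule.mem_span_singleton.2 ⟨y, rfl⟩⟩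
    rw [hx] at h1
    exact h1.symm
  have hsurj : ∀ ℓ, Function.Surjective (Φ ℓ) := by
    intro ℓ ψ
    -- The forms live on `B e_b`, whereas the construction of classes takes forms on all of `B`; any
    -- linear extension will do.
    choose ψ' hψ' using fun b => LinearMap.exists_extend
      (p := (Submodule.span B {e b}).restrictScalars k) (ψ b : Module.Dual k (Submodule.span B {e b}))
    -- Beyond this `r` no degree `d ≥ r` satisfies `ℓ + d = -s j`, so the vanishing condition of
    -- `exists_level_pairing` is vacuous. The sum is a crude bound for a maximum.
    obtain ⟨r, hr⟩ : ∃ r : ℕ, ∀ j, -s j < ℓ + r := by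
      refine ⟨∑ j, (-s j - ℓ + 1).toNat, fun j => ?_⟩
      have := Finset.single_le_sum (f := fun j => (-s j - ℓ + 1).toNat) (fun _ _ => Nat.zero_le _)
        (Finset.mem_univ j)
      omega
    obtain ⟨ξ, hξ⟩ := hG.exists_level_pairing he hfin hf (ℓ := ℓ) r ψ' (by
      intro j d hd hrd
      have := hr j
      omega)
    refine ⟨level 𝒜 r N ℓ ξ, ?_⟩
    funext b
    rw [← sub_eq_zero]
    refine Subtype.ext (matlisDual_eq_zero he b (Subtype.mem _) ?_)
    intro d hd y hy hyd
    have hy' : y = y * e b := by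
      obtain ⟨z, rfl⟩ := span_eq_mul hy
      rw [mul_assoc, he.mul_self]
    have h1 := hξ b d (by omega) y hyd
    rw [← hy'] at h1
    have h2 : ψ' b y = (ψ b : Module.Dual k (Submodule.span B {e b})) ⟨y, hy⟩ := LinearMap.congr_fun (hψ' b) ⟨y, hy⟩
    have h3 := hΦ ℓ (level 𝒜 r N ℓ ξ) b ⟨y, hy⟩
    rw [Submodule.coe_sub, LinearMap.sub_apply, h3, h1, h2, sub_self]
  refine ⟨fun ℓ => LinearEquiv.ofBijective (Φ ℓ) ⟨hinj ℓ, hsurj ℓ⟩, ?_⟩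
  intro ℓ a r hr x b y
  exact pairing_actTo (f b) hr (y : B) x

end Matlis
end GradedExt

/-! ### First quadrant bicomplexes and the comparison of their edges. -/

/-- First quadrant bicomplexes of abelian groups with anticommuting differentials. -/
structure Bicomplex where
  X : ℕ → ℕ → Type w
  [grp : ∀ p q, AddCommGroup (X p q)]
  dh : ∀ p q, X p q →+ X (p + 1) q
  dv : ∀ p q, X p q →+ X p (q + 1)
  dh_dh : ∀ p q x, dh (p + 1) q (dh p q x) = 0
  dv_dv : ∀ p q x, dv p (q + 1) (dv p q x) = 0
  anticomm : ∀ p q x, dh p (q + 1) (dv p q x) + dv (p + 1) q (dh p q x) = 0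

attribute [instance] Bicomplex.grp

namespace Bicomplex

variable (C : Bicomplex.{w})

/-- The product of all terms of a bicomplex. -/
abbrev Tot := ∀ p q, C.X p q

/-- The horizontal part of the total differential. -/
def hpart : C.Tot →+ C.Tot where
  toFun x
    | 0, _ => 0
    | p + 1, q => C.dh p q (x p q)
  map_zero' := by
    funext p q
    cases p <;> simp
  map_add' x y := by
    funext p q
    cases p <;> simp

/-- The vertical part of the total differential. -/
def vpart : C.Tot →+ C.Tot where
  toFun x
    | _, 0 => 0
    | p, q + 1 => C.dv p q (x p q)
  map_zero' := by
    funext p q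
    cases q <;> simp
  map_add' x y := by
    funext p q
    cases q <;> simp

/-- The total differential. -/
def total : C.Tot →+ C.Tot := C.hpart + C.vpart

variable {C}

@[simp] theorem hpart_zero (x : C.Tot) (q : ℕ) : C.hpart x 0 q = 0 := rfl

@[simp] theorem hpart_succ (x : C.Tot) (p q : ℕ) : C.hpart x (p + 1) q = C.dh p q (x p q) := rfl

@[simp] theorem vpart_zero (x : C.Tot) (p : ℕ) : C.vpart x p 0 = 0 := rfl

@[simp] theorem vpart_succ (x : C.Tot) (p q : ℕ) : C.vpart x p (q + 1) = C.dv p q (x p q) := rfl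

theorem total_apply (x : C.Tot) (p q : ℕ) : C.total x p q = C.hpart x p q + C.vpart x p q := rfl

theorem total_total (x : C.Tot) : C.total (C.total x) = 0 := by
  funext p q
  rcases p with _ | p <;> rcases q with _ | q
  · simp [total_apply]
  · rcases q with _ | q <;> simp [total_apply, C.dv_dv]
  · rcases p with _ | p <;> simp [total_apply, C.dh_dh]
  · have h : C.dh p (q + 1) (C.hpart x p (q + 1)) = 0 := by
      rcases p with _ | p <;> simp [C.dh_dh]
    have h' : C.dv (p + 1) q (C.vpart x (p + 1) q) = 0 := by
      rcases q with _ | q <;> simp [C.dv_dv]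
    simp only [total_apply, hpart_succ, vpart_succ, map_add, h, h', zero_add, add_zero,
      Pi.zero_apply]
    exact C.anticomm p q _

/-- Families concentrated in total degree `n`. -/
def Supp (n : ℤ) (x : C.Tot) : Prop := ∀ p q : ℕ, (p : ℤ) + q ≠ n → x p q = 0

/-- Total degrees are integers so that `n - 1` makes sense for `n = 0`: support in degree `-1`
forces the family to be zero. -/
theorem Supp.total {n : ℤ} {x : C.Tot} (hx : Supp (n - 1) x) : Supp n (C.total x) := by
  intro p q h
  rw [total_apply]
  have h1 : C.hpart x p q = 0 := by
    rcases p with _ | p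
    · rfl
    · rw [hpart_succ, hx p q (by push_cast at h; omega), map_zero]
  have h2 : C.vpart x p q = 0 := by
    rcases q with _ | q
    · rfl
    · rw [vpart_succ, hx p q (by push_cast at h; omega), map_zero]
  rw [h1, h2, add_zero]

theorem Supp.add {n : ℤ} {x y : C.Tot} (hx : Supp n x) (hy : Supp n y) : Supp n (x + y) :=
  fun p q h => by rw [Pi.add_apply, Pi.add_apply, hx p q h, hy p q h, add_zero]

theorem Supp.sub {n : ℤ} {x y : C.Tot} (hx : Supp n x) (hy : Supp n y) : Supp n (x - y) :=
  fun p q h => by rw [Pi.sub_apply, Pi.sub_apply, hx p q h, hy p q h, sub_zero]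

/-- The family with a single entry. -/
def single (p q : ℕ) (z : C.X p q) : C.Tot := Pi.single p (Pi.single q z)

@[simp] theorem single_same (p q : ℕ) (z : C.X p q) : single p q z p q = z := by simp [single]

theorem single_of_ne {p q p' q' : ℕ} (z : C.X p q) (h : p' ≠ p ∨ q' ≠ q) :
    single p q z p' q' = 0 := by
  unfold single
  by_cases hp : p' = p
  · subst hp
    rw [Pi.single_eq_same, Pi.single_eq_of_ne (h.resolve_left (fun h => h rfl))]
  · rw [Pi.single_eq_of_ne hp]
    rfl

theorem supp_single {p q : ℕ} {n : ℤ} (h : (p : ℤ) + q = n) (z : C.X p q) :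
    Supp n (single p q z) := fun p' q' h' => single_of_ne z (by
  by_contra! hc
  rw [hc.1, hc.2] at h'
  exact h' h)

/-- If the columns are exact except at the bottom, a total cochain whose boundary lies in the bottom
row can be moved into the bottom row. -/
theorem exists_sub_total {n : ℤ}
    (hC : ∀ (p q : ℕ) (x : C.X p (q + 1)), (p : ℤ) + (q + 1 : ℕ) = n → C.dv p (q + 1) x = 0 →
      ∃ y, C.dv p q y = x)
    (y : C.Tot) (hy : Supp n y) (hdy : ∀ p q, C.total y p (q + 1) = 0) :
    ∃ w : C.Tot, Supp (n - 1) w ∧ ∀ p q, (y - C.total w) p (q + 1) = 0 := by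
  -- On the antidiagonal of degree `n` the columns `p < m` are cleared above the bottom row, from
  -- left to right. The entry in column `m` is then a vertical cycle, since its left neighbour is
  -- already zero. Subtracting the boundary of a primitive `t` kills it and otherwise affects only
  -- column `m + 1`.
  have key : ∀ m : ℕ, ∃ w : C.Tot, Supp (n - 1) w ∧
      ∀ p q : ℕ, (q : ℤ) + 1 + m > n → (y - C.total w) p (q + 1) = 0 := by
    intro m
    induction m with
    | zero =>
      refine ⟨0, fun _ _ _ => rfl, fun p q h => ?_⟩
      rw [map_zero, sub_zero]
      exact hy p _ (by push_cast at h ⊢; omega)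
    | succ m ih =>
      obtain ⟨w, hw, hwy⟩ := ih
      by_cases hm : ∃ q : ℕ, (q : ℤ) + 1 + m = n
      · obtain ⟨q, hq⟩ := hm
        have hcyc : C.dv m (q + 1) ((y - C.total w) m (q + 1)) = 0 := by
          have h1 : C.total (y - C.total w) m (q + 2) = 0 := by
            rw [map_sub, total_total, sub_zero]
            exact hdy m (q + 1)
          have h2 : C.hpart (y - C.total w) m (q + 2) = 0 := by
            rcases m with _ | m
            · rfl
            · rw [hpart_succ, hwy m (q + 1) (by push_cast at hq ⊢; omega), map_zero]
          rwa [total_apply, h2, zero_add, vpart_succ] at h1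
        obtain ⟨t, ht⟩ := hC m q _ (by push_cast; omega) hcyc
        refine ⟨w + single m q t, hw.add (supp_single (by omega) t), fun p q' h => ?_⟩
        rw [map_add, ← sub_sub, Pi.sub_apply, Pi.sub_apply, total_apply (single m q t)]
        have hh : C.hpart (single m q t) p (q' + 1) = 0 := by
          rcases p with _ | p
          · rfl
          · rw [hpart_succ, single_of_ne t (by push_cast at h; omega), map_zero]
        rw [hh, zero_add, vpart_succ]
        by_cases hq' : q' = q
        · subst hq'
          by_cases hp : p = m
          · subst hp
            rw [single_same, ht, sub_self]
          · rw [single_of_ne t (Or.inl hp), map_zero, sub_zero]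
            exact (hy.sub hw.total) p _ (by push_cast; omega)
        · rw [single_of_ne t (Or.inr hq'), map_zero, sub_zero]
          exact hwy p q' (by push_cast at h; omega)
      · refine ⟨w, hw, fun p q h => hwy p q ?_⟩
        push_cast at h
        have : (q : ℤ) + 1 + m ≠ n := fun h' => hm ⟨q, h'⟩
        omega
  -- With `m` at least `n`, the condition `q + 1 + m > n` holds for every `q`.
  obtain ⟨w, hw, h⟩ := key (n.toNat)
  exact ⟨w, hw, fun p q => h p q (by omega)⟩

/-- A bicomplex with exact columns has exact total complex. -/
theorem exists_total_eq {n : ℤ}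
    (hC : ∀ (p q : ℕ) (x : C.X p (q + 1)), (p : ℤ) + (q + 1 : ℕ) = n → C.dv p (q + 1) x = 0 →
      ∃ y, C.dv p q y = x)
    (hC0 : ∀ (p : ℕ) (x : C.X p 0), (p : ℤ) = n → C.dv p 0 x = 0 → x = 0)
    (y : C.Tot) (hy : Supp n y) (hdy : C.total y = 0) :
    ∃ w : C.Tot, Supp (n - 1) w ∧ C.total w = y := by
  obtain ⟨w, hw, h⟩ := exists_sub_total hC y hy fun p q => by rw [hdy]; rfl
  refine ⟨w, hw, ?_⟩
  rw [← sub_eq_zero, ← neg_sub, neg_eq_zero]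
  funext p q
  rcases q with _ | q
  · by_cases hp : (p : ℤ) = n
    · refine hC0 p _ hp ?_
      have h1 : C.total (y - C.total w) p 1 = 0 := by
        rw [map_sub, total_total, sub_zero, hdy]
        rfl
      have h2 : C.hpart (y - C.total w) p 1 = 0 := by
        rcases p with _ | p
        · rfl
        · rw [hpart_succ, h p 0, map_zero]
      rwa [total_apply, h2, zero_add, vpart_succ] at h1
    · exact (hy.sub hw.total) p 0 (by push_cast; omega)
  · exact h p q

/-- The transposed bicomplex. -/
def swap (C : Bicomplex.{w}) : Bicomplex.{w} where
  X p q := C.X q p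
  dh p q := C.dv q p
  dv p q := C.dh q p
  dh_dh p q := C.dv_dv q p
  dv_dv p q := C.dh_dh q p
  anticomm p q x := (add_comm _ _).trans (C.anticomm q p x)

/-- Transposition of families. -/
def swapTot (x : C.Tot) : C.swap.Tot := fun p q => x q p

theorem total_swapTot (x : C.Tot) : C.swap.total (swapTot x) = swapTot (C.total x) := by
  funext p q
  rw [total_apply, swapTot, total_apply, add_comm]
  rcases p with _ | p <;> rcases q with _ | q <;> rfl

theorem Supp.swapTot {n : ℤ} {x : C.Tot} (hx : Supp n x) : Supp n (swapTot x) :=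
  fun p q h => hx q p (by rwa [add_comm])

theorem exists_sub_total_row {n : ℤ}
    (hC : ∀ (p q : ℕ) (x : C.X (p + 1) q), ((p + 1 : ℕ) : ℤ) + q = n → C.dh (p + 1) q x = 0 →
      ∃ y, C.dh p q y = x)
    (y : C.Tot) (hy : Supp n y) (hdy : ∀ p q, C.total y (p + 1) q = 0) :
    ∃ w : C.Tot, Supp (n - 1) w ∧ ∀ p q, (y - C.total w) (p + 1) q = 0 := by
  obtain ⟨w, hw, h⟩ := exists_sub_total (C := C.swap)
    (fun p q x h => hC q p x (by rw [add_comm]; exact h)) (C.swapTot y) hy.swapTot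
    (fun p q => by rw [total_swapTot]; exact hdy q p)
  have e : C.swap.total w = C.swapTot (C.total (C.swap.swapTot w)) :=
    total_swapTot (C := C) (C.swap.swapTot w)
  rw [e] at h
  exact ⟨C.swap.swapTot w, hw.swapTot, fun p q => h q p⟩

theorem exists_total_eq_row {n : ℤ}
    (hC : ∀ (p q : ℕ) (x : C.X (p + 1) q), ((p + 1 : ℕ) : ℤ) + q = n → C.dh (p + 1) q x = 0 →
      ∃ y, C.dh p q y = x)
    (hC0 : ∀ (q : ℕ) (x : C.X 0 q), (q : ℤ) = n → C.dh 0 q x = 0 → x = 0)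
    (y : C.Tot) (hy : Supp n y) (hdy : C.total y = 0) :
    ∃ w : C.Tot, Supp (n - 1) w ∧ C.total w = y := by
  obtain ⟨w, hw, h⟩ := exists_total_eq (C := C.swap)
    (fun p q x h => hC q p x (by rw [add_comm]; exact h)) hC0 (C.swapTot y) hy.swapTot
    (by rw [total_swapTot, hdy]; rfl)
  have e : C.swap.total w = C.swapTot (C.total (C.swap.swapTot w)) :=
    total_swapTot (C := C) (C.swap.swapTot w)
  rw [e] at h
  exact ⟨C.swap.swapTot w, hw.swapTot, funext fun p => funext fun q => congrFun (congrFun h q) p⟩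

/-- Morphisms of bicomplexes. -/
structure Hom (C : Bicomplex.{w₁}) (C' : Bicomplex.{w₂}) where
  app : ∀ p q, C.X p q →+ C'.X p q
  app_dh : ∀ p q x, app (p + 1) q (C.dh p q x) = C'.dh p q (app p q x)
  app_dv : ∀ p q x, app p (q + 1) (C.dv p q x) = C'.dv p q (app p q x)

namespace Hom

variable {C₁ : Bicomplex.{w₁}} {C₂ : Bicomplex.{w₂}} {C₃ : Bicomplex.{w₃}}

/-- The map on families. -/
def tot (f : Hom C₁ C₂) : C₁.Tot →+ C₂.Tot where
  toFun x p q := f.app p q (x p q)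
  map_zero' := by funext p q; simp
  map_add' x y := by funext p q; simp

theorem tot_apply (f : Hom C₁ C₂) (x : C₁.Tot) (p q : ℕ) : f.tot x p q = f.app p q (x p q) := rfl

theorem tot_total (f : Hom C₁ C₂) (x : C₁.Tot) : f.tot (C₁.total x) = C₂.total (f.tot x) := by
  funext p q
  rw [tot_apply, total_apply, total_apply, map_add]
  congr 1
  · rcases p with _ | p
    · exact map_zero _
    · exact f.app_dh p q _
  · rcases q with _ | q
    · exact map_zero _
    · exact f.app_dv p q _

theorem supp_tot (f : Hom C₁ C₂) {n : ℤ} {x : C₁.Tot} (hx : Supp n x) : Supp n (f.tot x) :=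
  fun p q h => by rw [tot_apply, hx p q h, map_zero]

theorem tot_injective {f : Hom C₁ C₂} (hf : ∀ p q x, f.app p q x = 0 → x = 0) {x : C₁.Tot}
    (hx : f.tot x = 0) : x = 0 := by
  funext p q
  exact hf p q _ (congrFun (congrFun hx p) q)

theorem supp_of_tot {f : Hom C₁ C₂} (hf : ∀ p q x, f.app p q x = 0 → x = 0) {n : ℤ} {x : C₁.Tot}
    (hx : Supp n (f.tot x)) : Supp n x := fun p q h => hf p q _ (hx p q h)

open Classical in
theorem exists_tot_eq {f : Hom C₁ C₂} (hf : ∀ p q y, ∃ x, f.app p q x = y) {n : ℤ} {y : C₂.Tot}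
    (hy : Supp n y) : ∃ x, Supp n x ∧ f.tot x = y := by
  choose g hg using hf
  -- Arbitrary preimages need not respect the support; zero is chosen wherever `y` is zero.
  refine ⟨fun p q => if y p q = 0 then 0 else g p q (y p q), fun p q h => if_pos (hy p q h), ?_⟩
  funext p q
  rw [tot_apply]
  split_ifs with h
  · rw [h, map_zero]
  · exact hg p q _

theorem exists_tot_eq_of_exact {f : Hom C₁ C₂} {g : Hom C₂ C₃}
    (hfg : ∀ p q y, g.app p q y = 0 → ∃ x, f.app p q x = y) {y : C₂.Tot} (hy : g.tot y = 0) :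
    ∃ x, f.tot x = y := by
  choose x hx using fun p q => hfg p q (y p q) (congrFun (congrFun hy p) q)
  exact ⟨x, funext fun p => funext fun q => hx p q⟩

end Hom

/-- Given short exact sequences `0 → W → X → X'` and `0 → W → Y → Y'` of bicomplexes such that `X'` and
`Y'` have exact rows and columns respectively, `X` has columns and `Y` has rows exact except at the
edges, and cocycles on the edge of `Y` are boundaries, so are the cocycles on the edge of `X`. -/
theorem exists_boundary {X : Bicomplex.{w₁}} {X' : Bicomplex.{w₂}} {Y : Bicomplex.{w₃}}
    {Y' : Bicomplex.{w₄}} {W : Bicomplex.{w₅}} (i : Hom W X) (r : Hom X X') (j : Hom W Y)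
    (t : Hom Y Y') (hi : ∀ p q x, i.app p q x = 0 → x = 0) (hj : ∀ p q x, j.app p q x = 0 → x = 0)
    (hr : ∀ p q y, ∃ x, r.app p q x = y) (ht : ∀ p q y, ∃ x, t.app p q x = y)
    (htj : ∀ p q x, t.app p q (j.app p q x) = 0)
    (hir : ∀ p q y, r.app p q y = 0 → ∃ x, i.app p q x = y)
    (hjt : ∀ p q y, t.app p q y = 0 → ∃ x, j.app p q x = y) {n : ℕ}
    (hX' : ∀ (p q : ℕ) (x : X'.X (p + 1) q), p + 1 ≤ n → X'.dh (p + 1) q x = 0 →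
      ∃ y, X'.dh p q y = x)
    (hX'0 : ∀ (q : ℕ) (x : X'.X 0 q), X'.dh 0 q x = 0 → x = 0)
    (hY' : ∀ (p q : ℕ) (x : Y'.X p (q + 1)), Y'.dv p (q + 1) x = 0 → ∃ y, Y'.dv p q y = x)
    (hY'0 : ∀ (p : ℕ) (x : Y'.X p 0), Y'.dv p 0 x = 0 → x = 0)
    (hX : ∀ (p q : ℕ) (x : X.X p (q + 1)), X.dv p (q + 1) x = 0 → ∃ y, X.dv p q y = x)
    (hY : ∀ (p q : ℕ) (x : Y.X (p + 1) q), Y.dh (p + 1) q x = 0 → ∃ y, Y.dh p q y = x)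
    (hYn : ∀ z : Y.X 0 n, Y.dh 0 n z = 0 → Y.dv 0 n z = 0 →
      ∃ y : Y.Tot, Supp ((n : ℤ) - 1) y ∧ Y.total y = single 0 n z)
    (z : X.X n 0) (hz : X.dh n 0 z = 0) (hz' : X.dv n 0 z = 0) :
    ∃ y : X.Tot, Supp ((n : ℤ) - 1) y ∧ (∀ p q, y p (q + 1) = 0) ∧ X.total y = single n 0 z := by
  have hZ : X.total (single n 0 z) = 0 := by
    funext p q
    rw [total_apply]
    have h1 : X.hpart (single n 0 z) p q = 0 := by
      rcases p with _ | p
      · rfl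
      · rw [hpart_succ]
        by_cases h : p = n ∧ q = 0
        · obtain ⟨rfl, rfl⟩ := h
          rw [single_same, hz]
        · rw [single_of_ne z (by omega), map_zero]
    have h2 : X.vpart (single n 0 z) p q = 0 := by
      rcases q with _ | q
      · rfl
      · rw [vpart_succ]
        by_cases h : p = n ∧ q = 0
        · obtain ⟨rfl, rfl⟩ := h
          rw [single_same, hz']
        · rw [single_of_ne z (by omega), map_zero]
    rw [h1, h2, add_zero]
    rfl
  have hZs : Supp (n : ℤ) (single n 0 z : X.Tot) := supp_single (by simp) z
  -- The image of the edge cocycle in the acyclic `X'` bounds. Lifting its primitive to `X` and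
  -- subtracting the boundary replaces the cocycle by one coming from a cocycle `v` of `W`.
  obtain ⟨w, hw, hwZ⟩ := exists_total_eq_row (C := X') (n := n)
    (fun p q x h => hX' p q x (by omega)) (fun q x _ => hX'0 q x) (r.tot (single n 0 z))
    (r.supp_tot hZs) (by rw [← r.tot_total, hZ, map_zero])
  obtain ⟨w', hw', rfl⟩ := Hom.exists_tot_eq hr hw
  obtain ⟨v, hv⟩ := Hom.exists_tot_eq_of_exact (y := single n 0 z - X.total w') hir
    (by rw [map_sub, r.tot_total, hwZ, sub_self])
  have hvs : Supp (n : ℤ) v := Hom.supp_of_tot hi (by rw [hv]; exact hZs.sub hw'.total)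
  have hvt : W.total v = 0 := Hom.tot_injective hi (by
    rw [i.tot_total, hv, map_sub, hZ, total_total, sub_zero])
  -- In `Y` the rows are exact, so the image of `v` can be pushed into column `0`, where cocycles
  -- bound by hypothesis.
  obtain ⟨y, hy, hyv⟩ : ∃ y : Y.Tot, Supp ((n : ℤ) - 1) y ∧ Y.total y = j.tot v := by
    have hjv : Y.total (j.tot v) = 0 := by rw [← j.tot_total, hvt, map_zero]
    obtain ⟨w₁, hw₁, h⟩ := exists_sub_total_row (C := Y) (n := n) (fun p q x _ => hY p q x)
      (j.tot v) (j.supp_tot hvs) (fun p q => by rw [hjv]; rfl)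
    have hT : Y.total (j.tot v - Y.total w₁) = 0 := by rw [map_sub, hjv, total_total, sub_zero]
    have hsing : j.tot v - Y.total w₁ = single 0 n ((j.tot v - Y.total w₁) 0 n) := by
      funext p q
      rcases p with _ | p
      · by_cases hq : q = n
        · subst hq
          rw [single_same]
        · rw [single_of_ne _ (Or.inr hq)]
          exact ((j.supp_tot hvs).sub hw₁.total) 0 q (by push_cast; omega)
      · rw [single_of_ne _ (Or.inl (by omega))]
        exact h p q
    obtain ⟨y, hy, hyt⟩ := hYn ((j.tot v - Y.total w₁) 0 n)
      (by
        have h1 := congrFun (congrFun hT 1) n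
        have h2 : Y.vpart (j.tot v - Y.total w₁) 1 n = 0 := by
          rcases n with _ | n
          · rfl
          · rw [vpart_succ, h 0 n, map_zero]
        rwa [total_apply, h2, add_zero, hpart_succ] at h1)
      (by
        have h1 := congrFun (congrFun hT 0) (n + 1)
        rwa [total_apply, hpart_zero, zero_add, vpart_succ] at h1)
    refine ⟨w₁ + y, hw₁.add hy, ?_⟩
    rw [map_add, hyt, ← hsing, add_sub_cancel]
  -- The primitive `y` need not come from `W`, but its image in `Y'` is a cocycle because `t ∘ j =
  -- 0`. As `Y'` is acyclic, correcting `y` by a boundary brings it into `W`, so `v` itself bounds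
  -- in `W`.
  obtain ⟨x, hx, hxy⟩ := exists_total_eq (C := Y') (n := (n : ℤ) - 1) (fun p q x _ => hY' p q x)
    (fun p x _ => hY'0 p x) (t.tot y) (t.supp_tot hy) (by
      rw [← t.tot_total, hyv]
      funext p q
      exact htj p q _)
  obtain ⟨x', hx', rfl⟩ := Hom.exists_tot_eq ht hx
  obtain ⟨v', hv'⟩ := Hom.exists_tot_eq_of_exact (y := y - Y.total x') hjt
    (by rw [map_sub, t.tot_total, hxy, sub_self])
  have hvs' : Supp ((n : ℤ) - 1) v' := Hom.supp_of_tot hj (by rw [hv']; exact hy.sub hx'.total)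
  have hvv' : W.total v' = v := by
    rw [← sub_eq_zero]
    refine Hom.tot_injective hj ?_
    rw [map_sub, j.tot_total, hv', map_sub, total_total, sub_zero, hyv, sub_self]
  have hu : X.total (i.tot v' + w') = single n 0 z := by
    rw [map_add, ← i.tot_total, hvv', hv, sub_add_cancel]
  have hus : Supp ((n : ℤ) - 1) (i.tot v' + w') := (i.supp_tot hvs').add hw'
  -- The primitive found in `X` is moved into the bottom row, which is possible because its boundary
  -- lies there and the columns of `X` are exact above it.
  obtain ⟨w₂, hw₂, h⟩ := exists_sub_total (C := X) (n := (n : ℤ) - 1) (fun p q x _ => hX p q x)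
    (i.tot v' + w') hus (fun p q => by rw [hu]; exact single_of_ne z (Or.inr (by omega)))
  refine ⟨i.tot v' + w' - X.total w₂, hus.sub hw₂.total, h, ?_⟩
  rw [map_sub, total_total, sub_zero, hu]

end Bicomplex

namespace GradedExt

/-! ### Multilinear functions and their homogeneous parts. -/

section Multilinear

variable {k B : Type*} [Field k] [Ring B] [Algebra k B]
variable {M N N' : Type*} [AddCommGroup M] [Module k M] [AddCommGroup N] [Module k N]
  [AddCommGroup N'] [Module k N']

/-- The multilinear functions `M × B^q → N`. -/
def multilinearFunctions (k B M N : Type*) [Field k] [Ring B] [Algebra k B] [AddCommGroup M]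
    [Module k M] [AddCommGroup N] [Module k N] (q : ℕ) : Submodule k (M → (Fin q → B) → N) where
  carrier := {f | ∃ φ : M →ₗ[k] MultilinearMap k (fun _ : Fin q => B) N, ∀ m g, f m g = φ m g}
  zero_mem' := ⟨0, fun _ _ => rfl⟩
  add_mem' := by
    rintro f f' ⟨φ, hφ⟩ ⟨φ', hφ'⟩
    exact ⟨φ + φ', fun m g => by simp [hφ, hφ']⟩
  smul_mem' := by
    rintro c f ⟨φ, hφ⟩
    exact ⟨c • φ, fun m g => by simp [hφ]⟩

variable {q : ℕ}

theorem comp_mem_multilinearFunctions {f : M → (Fin q → B) → N}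
    (hf : f ∈ multilinearFunctions k B M N q) (L : N →ₗ[k] N') :
    (fun m g => L (f m g)) ∈ multilinearFunctions k B M N' q := by
  obtain ⟨φ, hφ⟩ := hf
  exact ⟨{ toFun := fun m => L.compMultilinearMap (φ m)
           map_add' := fun x y => by ext g; simp
           map_smul' := fun c x => by ext g; simp }, fun m g => by simp [hφ]⟩

theorem comp_left_mem_multilinearFunctions {M' : Type*} [AddCommGroup M'] [Module k M']
    {f : M → (Fin q → B) → N} (hf : f ∈ multilinearFunctions k B M N q) (α : M' →ₗ[k] M) :
    (fun m g => f (α m) g) ∈ multilinearFunctions k B M' N q := by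
  obtain ⟨φ, hφ⟩ := hf
  exact ⟨φ.comp α, fun m g => hφ _ _⟩

theorem pi_mem_multilinearFunctions {I : Type*} {f : M → (Fin q → B) → I → N}
    (hf : ∀ i, (fun m g => f m g i) ∈ multilinearFunctions k B M N q) :
    f ∈ multilinearFunctions k B M (I → N) q := by
  choose φ hφ using hf
  refine ⟨{ toFun := fun m => MultilinearMap.pi fun i => φ i m
            map_add' := fun x y => ?_
            map_smul' := fun c x => ?_ }, fun m g => ?_⟩
  · ext g i
    simp
  · ext g i
    simp
  · funext i
    exact hφ i m g

theorem map_zero_of_mem_multilinearFunctions {f : M → (Fin q → B) → N}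
    (hf : f ∈ multilinearFunctions k B M N q) (g : Fin q → B) : f 0 g = 0 := by
  obtain ⟨φ, hφ⟩ := hf
  rw [hφ, map_zero]
  rfl

theorem map_sub_of_mem_multilinearFunctions {f : M → (Fin q → B) → N}
    (hf : f ∈ multilinearFunctions k B M N q) (x y : M) (g : Fin q → B) :
    f (x - y) g = f x g - f y g := by
  obtain ⟨φ, hφ⟩ := hf
  rw [hφ, hφ, hφ, map_sub]
  rfl

/-- A multilinear function that vanishes on homogeneous arguments is zero. -/
theorem eq_zero_of_homogeneous {𝒜 : ℕ → Submodule k B} {ℳ : ℤ → Submodule k M}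
    (h𝒜 : ⨆ i, 𝒜 i = ⊤) (hℳ : ⨆ i, ℳ i = ⊤) {f : M → (Fin q → B) → N}
    (hf : f ∈ multilinearFunctions k B M N q)
    (h : ∀ i, ∀ m ∈ ℳ i, ∀ (d : Fin q → ℕ) (g : Fin q → B), (∀ t, g t ∈ 𝒜 (d t)) → f m g = 0) :
    f = 0 := by
  classical
  obtain ⟨φ, hφ⟩ := hf
  -- Induction on the set `s` of arguments not assumed homogeneous, freeing one coordinate at a time
  -- by linearity.
  have key : ∀ i, ∀ m ∈ ℳ i, ∀ (s : Finset (Fin q)) (g : Fin q → B),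
      (∀ t ∉ s, ∃ d, g t ∈ 𝒜 d) → φ m g = 0 := by
    intro i m hm s
    induction s using Finset.induction_on with
    | empty =>
      intro g hg
      choose d hd using fun t => hg t (Finset.notMem_empty t)
      rw [← hφ]
      exact h i m hm d g hd
    | insert t s ht ih =>
      intro g hg
      have hz : ∀ x ∈ ⨆ i, 𝒜 i, (φ m).toLinearMap g t x = 0 := by
        intro x hx
        induction hx using Submodule.iSup_induction' with
        | mem j x hx =>
          refine ih _ fun t' ht' => ?_
          by_cases h' : t' = t
          · subst h'
            exact ⟨j, by simpa using hx⟩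
          · rw [Function.update_of_ne h']
            exact hg t' (by simp [h', ht'])
        | zero => exact map_zero _
        | add x y _ _ hx hy => rw [map_add, hx, hy, add_zero]
      have := hz (g t) (by rw [h𝒜]; trivial)
      simpa using this
  funext m g
  rw [hφ]
  have hm : m ∈ ⨆ i, ℳ i := by rw [hℳ]; trivial
  induction hm using Submodule.iSup_induction' with
  | mem i m hm => exact key i m hm Finset.univ g (by simp)
  | zero => rw [map_zero]; rfl
  | add x y _ _ hx hy =>
    rw [map_add, _root_.add_apply, hx, hy]
    exact add_zero _

/-- Cochains of different degrees are linearly independent. -/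
theorem iSupIndep_cochains [Module Bᵐᵒᵖ N] [Module Bᵐᵒᵖ M]
    [IsScalarTower k Bᵐᵒᵖ N] {𝒜 : ℕ → Submodule k B}
    {ℳ : ℤ → Submodule k M} {𝒩 : ℤ → Submodule k N} (h𝒜 : ⨆ i, 𝒜 i = ⊤) (hℳ : ⨆ i, ℳ i = ⊤)
    (h𝒩 : iSupIndep 𝒩) (q : ℕ) : iSupIndep fun ℓ => cochains 𝒜 ℳ 𝒩 q ℓ := by
  rw [iSupIndep_def]
  intro ℓ
  rw [Submodule.disjoint_def]
  intro f hf hf'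
  refine eq_zero_of_homogeneous h𝒜 hℳ hf.1 fun i m hm d g hg => ?_
  let ev : (M → (Fin q → B) → N) →ₗ[k] N := LinearMap.proj g ∘ₗ LinearMap.proj m
  have h1 : ev f ∈ 𝒩 (i + ∑ t, (d t : ℤ) + ℓ) := hf.2 i m d g hm hg
  have h2 : ev f ∈ ⨆ j, ⨆ (_ : j ≠ i + ∑ t, (d t : ℤ) + ℓ), 𝒩 j := by
    have h3 : ⨆ ℓ', ⨆ (_ : ℓ' ≠ ℓ), cochains 𝒜 ℳ 𝒩 q ℓ' ≤
        (⨆ j, ⨆ (_ : j ≠ i + ∑ t, (d t : ℤ) + ℓ), 𝒩 j).comap ev := by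
      refine iSup₂_le fun ℓ' hℓ' f' hf' => ?_
      refine Submodule.mem_iSup_of_mem (i + ∑ t, (d t : ℤ) + ℓ')
        (Submodule.mem_iSup_of_mem (by simpa using hℓ') (hf'.2 i m d g hm hg))
    exact h3 hf'
  exact Submodule.disjoint_def.1 (iSupIndep_def.1 h𝒩 _) _ h1 h2

/-- Linear maps defined on the members of an independent family extend to the whole space. -/
theorem exists_linearMap_extend {ι : Type*} {p : ι → Submodule k N} (hp : iSupIndep p)
    (g : ∀ i, p i →ₗ[k] N') : ∃ K : N →ₗ[k] N', ∀ i (x : p i), K x = g i x := by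
  classical
  obtain ⟨L, hL⟩ := LinearMap.exists_leftInverse_of_injective
    (DFinsupp.lsum ℕ fun i => (p i).subtype) (LinearMap.ker_eq_bot.2 hp.dfinsupp_lsum_injective)
  refine ⟨(DFinsupp.lsum ℕ g : _ →ₗ[k] N') ∘ₗ L, fun i x => ?_⟩
  have := LinearMap.congr_fun hL (DFinsupp.single i x)
  simp only [LinearMap.comp_apply, DFinsupp.lsum_single, Submodule.subtype_apply,
    LinearMap.id_apply] at this
  rw [LinearMap.comp_apply, this, DFinsupp.lsum_single]

end Multilinear

/-! ### Cochains in two variables and their two commuting differentials. -/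

section Bicochains

variable {k A B : Type*} [Field k] [Ring A] [Algebra k A] [Ring B] [Algebra k B]
variable {U V N : Type*}
  [AddCommGroup U] [Module k U] [Module Aᵐᵒᵖ U] [IsScalarTower k Aᵐᵒᵖ U]
  [AddCommGroup V] [Module k V] [Module Bᵐᵒᵖ V] [IsScalarTower k Bᵐᵒᵖ V]
  [AddCommGroup N] [Module k N] [Module Aᵐᵒᵖ N] [IsScalarTower k Aᵐᵒᵖ N]
  [Module Bᵐᵒᵖ N] [IsScalarTower k Bᵐᵒᵖ N]
  {p q : ℕ} {ℓ : ℤ}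

/-- Multilinear maps `U × A^p × V × B^q → N` that are homogeneous of degree `ℓ`. -/
def bicochains (𝒜 : ℕ → Submodule k A) (𝒰 : ℤ → Submodule k U) (ℬ : ℕ → Submodule k B)
    (𝒱 : ℤ → Submodule k V) (𝒩 : ℤ → Submodule k N) (p q : ℕ) (ℓ : ℤ) :
    Submodule k (U → (Fin p → A) → V → (Fin q → B) → N) where
  carrier := {f |
    (∀ v b, (fun u a => f u a v b) ∈ multilinearFunctions k A U N p) ∧
    (∀ u a, f u a ∈ multilinearFunctions k B V N q) ∧
    ∀ (i j : ℤ) (u : U) (v : V) (d : Fin p → ℕ) (d' : Fin q → ℕ) (a : Fin p → A) (b : Fin q → B),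
      u ∈ 𝒰 i → v ∈ 𝒱 j → (∀ t, a t ∈ 𝒜 (d t)) → (∀ t, b t ∈ ℬ (d' t)) →
      f u a v b ∈ 𝒩 (i + ∑ t, (d t : ℤ) + (j + ∑ t, (d' t : ℤ)) + ℓ)}
  zero_mem' := ⟨fun _ _ => Submodule.zero_mem _, fun _ _ => Submodule.zero_mem _,
    fun _ _ _ _ _ _ _ _ _ _ _ _ => Submodule.zero_mem _⟩
  add_mem' := fun hf hg => ⟨fun v b => Submodule.add_mem _ (hf.1 v b) (hg.1 v b),
    fun u a => Submodule.add_mem _ (hf.2.1 u a) (hg.2.1 u a),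
    fun i j u v d d' a b h1 h2 h3 h4 =>
      Submodule.add_mem _ (hf.2.2 i j u v d d' a b h1 h2 h3 h4) (hg.2.2 i j u v d d' a b h1 h2 h3 h4)⟩
  smul_mem' := fun c _ hf => ⟨fun v b => Submodule.smul_mem _ c (hf.1 v b),
    fun u a => Submodule.smul_mem _ c (hf.2.1 u a),
    fun i j u v d d' a b h1 h2 h3 h4 =>
      Submodule.smul_mem _ c (hf.2.2 i j u v d d' a b h1 h2 h3 h4)⟩

/-- Exchanging the two groups of arguments. -/
def flipCochain (f : U → (Fin p → A) → V → (Fin q → B) → N) : V → (Fin q → B) → U → (Fin p → A) → N :=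
  fun v b u a => f u a v b

variable (k) in
/-- The bar differential in the second group of arguments. -/
def vertDifferential (f : U → (Fin p → A) → V → (Fin q → B) → N) :
    U → (Fin p → A) → V → (Fin (q + 1) → B) → N :=
  fun u a => barDifferential k q (f u a)

variable (k) in
/-- The bar differential in the first group of arguments. -/
def horDifferential (f : U → (Fin p → A) → V → (Fin q → B) → N) :
    U → (Fin (p + 1) → A) → V → (Fin q → B) → N :=
  flipCochain (vertDifferential k (flipCochain f))

variable {𝒜 : ℕ → Submodule k A} {𝒰 : ℤ → Submodule k U} {ℬ : ℕ → Submodule k B}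
  {𝒱 : ℤ → Submodule k V} {𝒩 : ℤ → Submodule k N}

theorem flipCochain_mem {f : U → (Fin p → A) → V → (Fin q → B) → N}
    (hf : f ∈ bicochains 𝒜 𝒰 ℬ 𝒱 𝒩 p q ℓ) : flipCochain f ∈ bicochains ℬ 𝒱 𝒜 𝒰 𝒩 q p ℓ := by
  refine ⟨hf.2.1, hf.1, fun i j u v d d' a b h1 h2 h3 h4 => ?_⟩
  have := hf.2.2 j i v u d' d b a h2 h1 h4 h3
  rwa [add_comm (j + _)] at this

/-- Freezing homogeneous arguments in the first group leaves a one-variable cochain whose degree is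
shifted by theirs. `mem_bicochains_of` is the converse; together they reduce exactness in one
direction to graded `Ext`. -/
theorem bicochains_apply_mem {f : U → (Fin p → A) → V → (Fin q → B) → N}
    (hf : f ∈ bicochains 𝒜 𝒰 ℬ 𝒱 𝒩 p q ℓ) {i : ℤ} {u : U} (hu : u ∈ 𝒰 i) {d : Fin p → ℕ}
    {a : Fin p → A} (ha : ∀ t, a t ∈ 𝒜 (d t)) :
    f u a ∈ cochains ℬ 𝒱 𝒩 q (i + ∑ t, (d t : ℤ) + ℓ) := by
  refine ⟨hf.2.1 u a, fun j v d' b hv hb => ?_⟩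
  have := hf.2.2 i j u v d d' a b hu hv ha hb
  convert this using 2
  ring

theorem mem_bicochains_of {f : U → (Fin p → A) → V → (Fin q → B) → N}
    (h1 : ∀ v b, (fun u a => f u a v b) ∈ multilinearFunctions k A U N p)
    (h2 : ∀ u a, f u a ∈ multilinearFunctions k B V N q)
    (h3 : ∀ i, ∀ u ∈ 𝒰 i, ∀ (d : Fin p → ℕ) (a : Fin p → A), (∀ t, a t ∈ 𝒜 (d t)) →
      f u a ∈ cochains ℬ 𝒱 𝒩 q (i + ∑ t, (d t : ℤ) + ℓ)) :
    f ∈ bicochains 𝒜 𝒰 ℬ 𝒱 𝒩 p q ℓ := by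
  refine ⟨h1, h2, fun i j u v d d' a b hu hv ha hb => ?_⟩
  have := (h3 i u hu d a ha).2 j v d' b hv hb
  convert this using 2
  ring

theorem opSMul_mem_multilinearFunctions {f : U → (Fin p → A) → N}
    (hf : f ∈ multilinearFunctions k A U N p) (b : B) :
    (fun u a => op b • f u a) ∈ multilinearFunctions k A U N p :=
  comp_mem_multilinearFunctions hf
    { toFun := fun x => op b • x
      map_add' := smul_add _
      map_smul' := fun c x => op_smul_smul_comm c b x }

theorem vertDifferential_mem [SetLike.GradedMul ℬ] (hV : GradedAction ℬ 𝒱) (hN : GradedAction ℬ 𝒩)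
    {f : U → (Fin p → A) → V → (Fin q → B) → N} (hf : f ∈ bicochains 𝒜 𝒰 ℬ 𝒱 𝒩 p q ℓ) :
    vertDifferential k f ∈ bicochains 𝒜 𝒰 ℬ 𝒱 𝒩 p (q + 1) ℓ := by
  refine mem_bicochains_of (fun v b => ?_) (fun u a => ?_) fun i u hu d a ha =>
    barDifferential_mem_cochains hV hN (bicochains_apply_mem hf hu ha)
  · have : (fun u a => vertDifferential k f u a v b)
      = (fun u a => f u a (op (b 0) • v) (Fin.tail b))
      + ∑ j : Fin q, (-1 : ℤ) ^ ((j : ℕ) + 1) •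
          (fun u a => f u a v (Fin.contractNth j.castSucc (· * ·) b))
      + (-1 : ℤ) ^ (q + 1) • (fun u a => op (b (Fin.last q)) • f u a v (Fin.init b)) := by
      funext u a
      simp [vertDifferential, barDifferential]
    rw [this]
    exact Submodule.add_mem _ (Submodule.add_mem _ (hf.1 _ _)
      (Submodule.sum_mem _ fun j _ => zsmul_mem (hf.1 _ _) _))
      (zsmul_mem (opSMul_mem_multilinearFunctions (hf.1 _ _) _) _)
  · obtain ⟨φ, hφ⟩ := hf.2.1 u a
    obtain ⟨φ', hφ'⟩ := exists_multilinear_barDifferential q φ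
    refine ⟨φ', fun v b => ?_⟩
    rw [hφ', vertDifferential,
      show f u a = fun m g => φ m g from funext fun m => funext fun g => hφ m g]

theorem horDifferential_mem [SetLike.GradedMul 𝒜] (hU : GradedAction 𝒜 𝒰) (hN : GradedAction 𝒜 𝒩)
    {f : U → (Fin p → A) → V → (Fin q → B) → N} (hf : f ∈ bicochains 𝒜 𝒰 ℬ 𝒱 𝒩 p q ℓ) :
    horDifferential k f ∈ bicochains 𝒜 𝒰 ℬ 𝒱 𝒩 (p + 1) q ℓ :=
  flipCochain_mem (vertDifferential_mem hU hN (flipCochain_mem hf))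

theorem vertDifferential_comp_self (f : U → (Fin p → A) → V → (Fin q → B) → N) :
    vertDifferential k (vertDifferential k f) = 0 := by
  funext u a
  exact barDifferential_comp_self k q _

theorem horDifferential_comp_self (f : U → (Fin p → A) → V → (Fin q → B) → N) :
    horDifferential k (horDifferential k f) = 0 := by
  unfold horDifferential
  rw [show flipCochain (flipCochain (vertDifferential k (flipCochain f)))
    = vertDifferential k (flipCochain f) from rfl, vertDifferential_comp_self]
  rfl

/-- The bar differential commutes with the action of another algebra on the coefficients. -/
def barDifferentialLinear (k A V N : Type*) {B : Type*} [Field k] [Ring A] [Algebra k A] [Ring B]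
    [Algebra k B] [AddCommGroup V] [Module Bᵐᵒᵖ V] [AddCommGroup N] [Module k N]
    [Module Aᵐᵒᵖ N] [Module Bᵐᵒᵖ N] [IsScalarTower k Bᵐᵒᵖ N] [SMulCommClass Aᵐᵒᵖ Bᵐᵒᵖ N] (q : ℕ) :
    (V → (Fin q → B) → N) →ₗ[Aᵐᵒᵖ] (V → (Fin (q + 1) → B) → N) where
  toFun := barDifferential k q
  map_add' := map_add _
  map_smul' c f := by
    funext v b
    simp only [barDifferential, LinearMap.coe_mk, AddHom.coe_mk, Pi.smul_apply, smul_add,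
      Finset.smul_sum, RingHom.id_apply, smul_comm c (op (b (Fin.last q))),
      smul_comm c ((-1 : ℤ) ^ _)]

/-- As the two actions on `N` commute, the vertical differential is `A`-linear in the values. It is
therefore a change of coefficients for the horizontal bar complex, and naturality of the bar
differential applies. -/
theorem horDifferential_vertDifferential [SMulCommClass Aᵐᵒᵖ Bᵐᵒᵖ N]
    (f : U → (Fin p → A) → V → (Fin q → B) → N) :
    horDifferential k (vertDifferential k f) = vertDifferential k (horDifferential k f) := by
  have key : ∀ {q : ℕ} (f : U → (Fin p → A) → V → (Fin q → B) → N),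
      barDifferential k p f = horDifferential k f := by
    intro q f
    funext u a v b
    simp [horDifferential, flipCochain, vertDifferential, barDifferential]
  have := cochainMap_barDifferential (k := k) (M' := U) LinearMap.id
    (barDifferentialLinear k A V N q) p f
  rw [key] at this
  rw [← key]
  exact this.symm

end Bicochains

/-! ### Exactness of rows and columns of bicochains. -/

section Exactness

variable {k A B : Type*} [Field k] [Ring A] [Algebra k A] [Ring B] [Algebra k B]
variable {U V N : Type*}
  [AddCommGroup U] [Module k U] [Module Aᵐᵒᵖ U] [IsScalarTower k Aᵐᵒᵖ U]
  [AddCommGroup V] [Module k V] [Module Bᵐᵒᵖ V] [IsScalarTower k Bᵐᵒᵖ V]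
  [AddCommGroup N] [Module k N] [Module Aᵐᵒᵖ N] [IsScalarTower k Aᵐᵒᵖ N]
  [Module Bᵐᵒᵖ N] [IsScalarTower k Bᵐᵒᵖ N]
  {p q : ℕ} {ℓ : ℤ}
variable {𝒜 : ℕ → Submodule k A} {𝒰 : ℤ → Submodule k U} {ℬ : ℕ → Submodule k B}
  {𝒱 : ℤ → Submodule k V} {𝒩 : ℤ → Submodule k N}

theorem multilinear_of_mem_bicochains {f : U → (Fin p → A) → V → (Fin q → B) → N}
    (hf : f ∈ bicochains 𝒜 𝒰 ℬ 𝒱 𝒩 p q ℓ) :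
    f ∈ multilinearFunctions k A U (V → (Fin q → B) → N) p :=
  pi_mem_multilinearFunctions fun v => pi_mem_multilinearFunctions fun b => hf.1 v b

/-- `U` lives in degrees at least `r` and `A` in nonnegative degrees, so freezing the first group of
arguments produces cocycles of degree at least `r + ℓ`, where `Ext^0` vanishes. -/
theorem eq_zero_of_vertDifferential_eq_zero (h𝒜 : ⨆ i, 𝒜 i = ⊤) (h𝒰 : ⨆ i, 𝒰 i = ⊤) {r : ℤ}
    (hr : ∀ i < r, 𝒰 i = ⊥) (h : ∀ m, r + ℓ ≤ m → Subsingleton (GExt ℬ 𝒱 𝒩 0 m))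
    {f : U → (Fin p → A) → V → (Fin 0 → B) → N} (hf : f ∈ bicochains 𝒜 𝒰 ℬ 𝒱 𝒩 p 0 ℓ)
    (hd : vertDifferential k f = 0) : f = 0 := by
  refine eq_zero_of_homogeneous h𝒜 h𝒰 (multilinear_of_mem_bicochains hf) fun i u hu d a ha => ?_
  by_cases hi : i < r
  · rw [hr i hi, Submodule.mem_bot] at hu
    rw [hu, map_zero_of_mem_multilinearFunctions (multilinear_of_mem_bicochains hf)]
  · have hs : (0 : ℤ) ≤ ∑ t, (d t : ℤ) := Finset.sum_nonneg fun _ _ => Int.natCast_nonneg _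
    exact GExt.subsingleton_iff.1 (h (i + ∑ t, (d t : ℤ) + ℓ) (by omega)) (f u a)
      ⟨bicochains_apply_mem hf hu ha, congrFun (congrFun hd u) a⟩

/-- Over a field primitives can be chosen linearly in the cocycle. Linearity is what keeps a
bicochain multilinear when primitives are taken for all frozen arguments at once. -/
theorem exists_homotopy (m : ℤ) (h : Subsingleton (GExt ℬ 𝒱 𝒩 (q + 1) m)) :
    ∃ K : cocycles ℬ 𝒱 𝒩 (q + 1) m →ₗ[k] multilinearFunctions k B V N q,
      ∀ x, (K x : V → (Fin q → B) → N) ∈ cochains ℬ 𝒱 𝒩 q m ∧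
        barDifferential k q (K x) = x.1 := by
  let D : (cochains ℬ 𝒱 𝒩 q m) →ₗ[k] (V → (Fin (q + 1) → B) → N) :=
    (barDifferential k q) ∘ₗ (cochains ℬ 𝒱 𝒩 q m).subtype
  obtain ⟨L, hL⟩ := LinearMap.exists_rightInverse_of_surjective D.rangeRestrict D.range_rangeRestrict
  have hx : ∀ x : cocycles ℬ 𝒱 𝒩 (q + 1) m, x.1 ∈ LinearMap.range D := by
    intro x
    obtain ⟨y, hy, hyx⟩ := GExt.subsingleton_iff.1 h x.1 x.2
    exact ⟨⟨y, hy⟩, hyx⟩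
  let J : cocycles ℬ 𝒱 𝒩 (q + 1) m →ₗ[k] LinearMap.range D :=
    (cocycles ℬ 𝒱 𝒩 (q + 1) m).subtype.codRestrict _ hx
  refine ⟨Submodule.inclusion (show cochains ℬ 𝒱 𝒩 q m ≤ multilinearFunctions k B V N q from
    fun _ hx => And.left hx) ∘ₗ L ∘ₗ J, fun x => ⟨(L (J x)).2, ?_⟩⟩
  exact congrArg Subtype.val (LinearMap.congr_fun hL (J x))

/-- The homotopies of all degrees are spliced into one linear map `K`, and the primitive is `K (f u
a)`. It matters only what `K` does to homogeneous cocycles of degree at least `r + ℓ`, since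
multilinear identities can be tested on homogeneous arguments. -/
theorem exists_vertDifferential_eq (h𝒜 : ⨆ i, 𝒜 i = ⊤) (h𝒰 : ⨆ i, 𝒰 i = ⊤)
    (hℬ : ⨆ i, ℬ i = ⊤) (h𝒱 : ⨆ i, 𝒱 i = ⊤) (h𝒩 : iSupIndep 𝒩) {r : ℤ}
    (hr : ∀ i < r, 𝒰 i = ⊥) (h : ∀ m, r + ℓ ≤ m → Subsingleton (GExt ℬ 𝒱 𝒩 (q + 1) m))
    {f : U → (Fin p → A) → V → (Fin (q + 1) → B) → N}
    (hf : f ∈ bicochains 𝒜 𝒰 ℬ 𝒱 𝒩 p (q + 1) ℓ) (hd : vertDifferential k f = 0) :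
    ∃ g ∈ bicochains 𝒜 𝒰 ℬ 𝒱 𝒩 p q ℓ, vertDifferential k g = f := by
  classical
  have hK : ∀ m : ℤ, ∃ K : cocycles ℬ 𝒱 𝒩 (q + 1) m →ₗ[k] multilinearFunctions k B V N q,
      r + ℓ ≤ m → ∀ x, (K x : V → (Fin q → B) → N) ∈ cochains ℬ 𝒱 𝒩 q m ∧
        barDifferential k q (K x) = x.1 := by
    intro m
    by_cases hm : r + ℓ ≤ m
    · obtain ⟨K, hK⟩ := exists_homotopy m (h m hm)
      exact ⟨K, fun _ => hK⟩
    · exact ⟨0, fun h => absurd h hm⟩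
  choose K₀ hK₀ using hK
  -- Cocycles of different degrees are independent, so the homotopies extend to a single linear map
  -- on all functions; those below degree `r + ℓ` may be zero.
  obtain ⟨K, hK⟩ := exists_linearMap_extend
    ((iSupIndep_cochains hℬ h𝒱 h𝒩 (q + 1)).mono fun m => (inf_le_left :
      cocycles ℬ 𝒱 𝒩 (q + 1) m ≤ _)) K₀
  have hm := multilinear_of_mem_bicochains hf
  have hKm := comp_mem_multilinearFunctions hm
    ((multilinearFunctions k B V N q).subtype ∘ₗ K)
  have hKf : ∀ i, r ≤ i → ∀ u ∈ 𝒰 i, ∀ (d : Fin p → ℕ) (a : Fin p → A), (∀ t, a t ∈ 𝒜 (d t)) →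
      (K (f u a) : V → (Fin q → B) → N) ∈ cochains ℬ 𝒱 𝒩 q (i + ∑ t, (d t : ℤ) + ℓ) ∧
        barDifferential k q (K (f u a)) = f u a := by
    intro i hi u hu d a ha
    have hs : (0 : ℤ) ≤ ∑ t, (d t : ℤ) := Finset.sum_nonneg fun _ _ => Int.natCast_nonneg _
    have hc : f u a ∈ cocycles ℬ 𝒱 𝒩 (q + 1) (i + ∑ t, (d t : ℤ) + ℓ) :=
      ⟨bicochains_apply_mem hf hu ha, congrFun (congrFun hd u) a⟩
    have hKe : K (f u a) = K₀ _ ⟨f u a, hc⟩ := hK _ ⟨_, hc⟩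
    rw [hKe]
    exact hK₀ _ (by omega) ⟨_, hc⟩
  have h0 : ∀ a, f 0 a = 0 := map_zero_of_mem_multilinearFunctions hm
  refine ⟨fun u a => K (f u a), mem_bicochains_of (fun v b => ?_) (fun u a => (K (f u a)).2) ?_, ?_⟩
  · exact comp_mem_multilinearFunctions hKm
      (LinearMap.proj b ∘ₗ (LinearMap.proj v : (V → (Fin q → B) → N) →ₗ[k] _))
  · intro i u hu d a ha
    by_cases hi : r ≤ i
    · exact (hKf i hi u hu d a ha).1
    · rw [hr i (by omega), Submodule.mem_bot] at hu
      rw [hu, h0, map_zero]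
      exact Submodule.zero_mem _
  · rw [← sub_eq_zero]
    refine eq_zero_of_homogeneous h𝒜 h𝒰 (Submodule.sub_mem _
      (comp_mem_multilinearFunctions hKm (barDifferential k q)) hm) fun i u hu d a ha => ?_
    rw [Pi.sub_apply, Pi.sub_apply, sub_eq_zero]
    by_cases hi : r ≤ i
    · exact (hKf i hi u hu d a ha).2
    · rw [hr i (by omega), Submodule.mem_bot] at hu
      rw [hu]
      show barDifferential k q (K (f 0 a) : V → (Fin q → B) → N) = f 0 a
      rw [h0, map_zero]
      exact map_zero _

theorem eq_zero_of_horDifferential_eq_zero (hℬ : ⨆ i, ℬ i = ⊤) (h𝒱 : ⨆ i, 𝒱 i = ⊤) {r : ℤ}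
    (hr : ∀ i < r, 𝒱 i = ⊥) (h : ∀ m, r + ℓ ≤ m → Subsingleton (GExt 𝒜 𝒰 𝒩 0 m))
    {f : U → (Fin 0 → A) → V → (Fin q → B) → N} (hf : f ∈ bicochains 𝒜 𝒰 ℬ 𝒱 𝒩 0 q ℓ)
    (hd : horDifferential k f = 0) : f = 0 :=
  congrArg flipCochain (eq_zero_of_vertDifferential_eq_zero hℬ h𝒱 hr h (flipCochain_mem hf)
    (congrArg flipCochain hd))

theorem exists_horDifferential_eq (h𝒜 : ⨆ i, 𝒜 i = ⊤) (h𝒰 : ⨆ i, 𝒰 i = ⊤)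
    (hℬ : ⨆ i, ℬ i = ⊤) (h𝒱 : ⨆ i, 𝒱 i = ⊤) (h𝒩 : iSupIndep 𝒩) {r : ℤ}
    (hr : ∀ i < r, 𝒱 i = ⊥) (h : ∀ m, r + ℓ ≤ m → Subsingleton (GExt 𝒜 𝒰 𝒩 (p + 1) m))
    {f : U → (Fin (p + 1) → A) → V → (Fin q → B) → N}
    (hf : f ∈ bicochains 𝒜 𝒰 ℬ 𝒱 𝒩 (p + 1) q ℓ) (hd : horDifferential k f = 0) :
    ∃ g ∈ bicochains 𝒜 𝒰 ℬ 𝒱 𝒩 p q ℓ, horDifferential k g = f := by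
  obtain ⟨g, hg, h⟩ := exists_vertDifferential_eq hℬ h𝒱 h𝒜 h𝒰 h𝒩 hr h (flipCochain_mem hf)
    (congrArg flipCochain hd)
  exact ⟨flipCochain g, flipCochain_mem hg, congrArg flipCochain h⟩

/-- The bar complex of the regular module is contracted by inserting `1` as the module argument, and
`1` has degree zero, so the degree is preserved. -/
theorem exists_vertDifferential_eq_regular [SetLike.GradedOne ℬ]
    {f : U → (Fin p → A) → B → (Fin (q + 1) → B) → N}
    (hf : f ∈ bicochains 𝒜 𝒰 ℬ (intGrading ℬ) 𝒩 p (q + 1) ℓ) (hd : vertDifferential k f = 0) :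
    ∃ g ∈ bicochains 𝒜 𝒰 ℬ (intGrading ℬ) 𝒩 p q ℓ, vertDifferential k g = f := by
  have hsl : ∀ u a, slice (f u a) 1 ∈ multilinearFunctions k B B N q := by
    intro u a
    obtain ⟨φ, hφ⟩ := hf.2.1 u a
    exact ⟨(φ 1).curryLeft, fun b g => hφ _ _⟩
  refine ⟨fun u a => slice (f u a) 1, mem_bicochains_of (fun v b => hf.1 1 (Fin.cons v b)) hsl ?_, ?_⟩
  · intro i u hu d a ha
    refine ⟨hsl u a, ?_⟩
    have h1 : (1 : B) ∈ intGrading ℬ 0 := (SetLike.GradedOne.one_mem : (1 : B) ∈ ℬ 0)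
    have hc := bicochains_apply_mem hf hu ha
    have := IsHomogeneousCochain.slice hc.2 (fun m g => by
      obtain ⟨φ, hφ⟩ := hc.1
      rw [hφ]
      exact (φ m).map_coord_zero 0 rfl) h1
    rwa [add_zero] at this
  · funext u a
    rw [vertDifferential, barDifferential_slice_one,
      show barDifferential k (q + 1) (f u a) = 0 from congrFun (congrFun hd u) a]
    exact sub_zero _

theorem exists_horDifferential_eq_regular [SetLike.GradedOne 𝒜]
    {f : A → (Fin (p + 1) → A) → V → (Fin q → B) → N}
    (hf : f ∈ bicochains 𝒜 (intGrading 𝒜) ℬ 𝒱 𝒩 (p + 1) q ℓ) (hd : horDifferential k f = 0) :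
    ∃ g ∈ bicochains 𝒜 (intGrading 𝒜) ℬ 𝒱 𝒩 p q ℓ, horDifferential k g = f := by
  obtain ⟨g, hg, h⟩ := exists_vertDifferential_eq_regular (flipCochain_mem hf)
    (congrArg flipCochain hd)
  exact ⟨flipCochain g, flipCochain_mem hg, congrArg flipCochain h⟩

/-- The extension of a cochain to the regular module in the first variable. -/
def edgeCochain (A : Type*) {B V N : Type*} [Ring A] [AddCommGroup N] [Module Aᵐᵒᵖ N] {q : ℕ}
    (g : V → (Fin q → B) → N) : A → (Fin 0 → A) → V → (Fin q → B) → N :=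
  fun u _ v b => op u • g v b

theorem edgeCochain_mem (hN : GradedAction 𝒜 𝒩) {g : V → (Fin q → B) → N}
    (hg : g ∈ cochains ℬ 𝒱 𝒩 q ℓ) :
    edgeCochain A g ∈ bicochains 𝒜 (intGrading 𝒜) ℬ 𝒱 𝒩 0 q ℓ := by
  refine ⟨fun v b => ?_, fun u _ => opSMul_mem_multilinearFunctions hg.1 u, ?_⟩
  · exact ⟨(MultilinearMap.constLinearEquivOfIsEmpty k k (fun _ : Fin 0 => A) N).toLinearMap ∘ₗ
      (orbitMap k (g v b) : A →ₗ[k] N), fun _ _ => rfl⟩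
  · intro i j u v d d' a b hu hv _ hb
    cases i with
    | ofNat i =>
      have : edgeCochain A g u a v b ∈ _ := hN i _ u _ hu (hg.2 j v d' b hv hb)
      convert this using 2
      simp
      ring
    | negSucc i =>
      have hu0 : u = 0 := hu
      rw [hu0, edgeCochain, op_zero, zero_smul]
      exact Submodule.zero_mem _

theorem vertDifferential_edgeCochain [SMulCommClass Aᵐᵒᵖ Bᵐᵒᵖ N] (g : V → (Fin q → B) → N) :
    vertDifferential k (edgeCochain A g) = edgeCochain A (barDifferential k q g) := by
  funext u _
  exact (barDifferentialLinear k A V N q).map_smul (op u) g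

theorem horDifferential_edgeCochain (g : V → (Fin q → B) → N) :
    horDifferential k (edgeCochain A g) = 0 := by
  funext u a v b
  simp only [horDifferential, flipCochain, vertDifferential, barDifferential_zero, edgeCochain]
  rw [smul_smul]
  exact sub_self _

/-- A horizontal cocycle in column `0` over the regular module is `A`-linear in its first argument,
hence determined by its value at `1`. -/
theorem eq_edgeCochain {f : A → (Fin 0 → A) → V → (Fin q → B) → N}
    (hf : horDifferential k f = 0) : f = edgeCochain A (f 1 Fin.elim0) := by
  funext u a v b
  have := congrFun (congrFun (congrFun (congrFun hf 1) (fun _ => u)) v) b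
  simp only [horDifferential, flipCochain, vertDifferential, barDifferential_zero, Pi.zero_apply,
    sub_eq_zero] at this
  rw [Subsingleton.elim a Fin.elim0, edgeCochain, ← this]
  congr 1
  exact (one_mul u).symm

theorem edge_mem_cochains [SetLike.GradedOne 𝒜] {f : A → (Fin p → A) → V → (Fin q → B) → N}
    (hf : f ∈ bicochains 𝒜 (intGrading 𝒜) ℬ 𝒱 𝒩 p q ℓ) {d : Fin p → ℕ} {a : Fin p → A}
    (ha : ∀ t, a t ∈ 𝒜 (d t)) : f 1 a ∈ cochains ℬ 𝒱 𝒩 q (∑ t, (d t : ℤ) + ℓ) := by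
  have h1 : (1 : A) ∈ intGrading 𝒜 0 := (SetLike.GradedOne.one_mem : (1 : A) ∈ 𝒜 0)
  have := bicochains_apply_mem hf h1 ha
  rwa [zero_add] at this

end Exactness

/-! ### The bicomplex of bicochains and the comparison of `Ext` over two algebras. -/

section Comparison

variable {k A B : Type*} [Field k] [Ring A] [Algebra k A] [Ring B] [Algebra k B]
variable {U V N U' V' U'' V'' : Type*}
  [AddCommGroup U] [Module k U] [Module Aᵐᵒᵖ U] [IsScalarTower k Aᵐᵒᵖ U]
  [AddCommGroup V] [Module k V] [Module Bᵐᵒᵖ V] [IsScalarTower k Bᵐᵒᵖ V]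
  [AddCommGroup U'] [Module k U'] [Module Aᵐᵒᵖ U'] [IsScalarTower k Aᵐᵒᵖ U']
  [AddCommGroup V'] [Module k V'] [Module Bᵐᵒᵖ V'] [IsScalarTower k Bᵐᵒᵖ V']
  [AddCommGroup U''] [Module k U''] [Module Aᵐᵒᵖ U''] [IsScalarTower k Aᵐᵒᵖ U'']
  [AddCommGroup V''] [Module k V''] [Module Bᵐᵒᵖ V''] [IsScalarTower k Bᵐᵒᵖ V'']
  [AddCommGroup N] [Module k N] [Module Aᵐᵒᵖ N] [IsScalarTower k Aᵐᵒᵖ N]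
  [Module Bᵐᵒᵖ N] [IsScalarTower k Bᵐᵒᵖ N] [SMulCommClass Aᵐᵒᵖ Bᵐᵒᵖ N]
  {p q : ℕ} {ℓ : ℤ}
variable {𝒜 : ℕ → Submodule k A} {𝒰 : ℤ → Submodule k U} {ℬ : ℕ → Submodule k B}
  {𝒱 : ℤ → Submodule k V} {𝒩 : ℤ → Submodule k N} {𝒰' : ℤ → Submodule k U'}
  {𝒱' : ℤ → Submodule k V'} {𝒰'' : ℤ → Submodule k U''} {𝒱'' : ℤ → Submodule k V''}
  [SetLike.GradedMul 𝒜] [SetLike.GradedMul ℬ]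

/-- The bicomplex of bicochains. -/
def bicomplex (hU : GradedAction 𝒜 𝒰) (hV : GradedAction ℬ 𝒱) (hA : GradedAction 𝒜 𝒩)
    (hB : GradedAction ℬ 𝒩) (ℓ : ℤ) : Bicomplex where
  X p q := bicochains 𝒜 𝒰 ℬ 𝒱 𝒩 p q ℓ
  dh p q :=
    { toFun := fun f => ⟨horDifferential k f.1, horDifferential_mem hU hA f.2⟩
      map_zero' := by
        refine Subtype.ext ?_
        funext u a v b
        exact congrFun (congrFun (map_zero (barDifferential k p (M := U) (N := N))) u) a
      map_add' := fun f g => by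
        refine Subtype.ext ?_
        funext u a v b
        exact congrFun (congrFun (map_add (barDifferential k p) (fun u a => f.1 u a v b)
          (fun u a => g.1 u a v b)) u) a }
  dv p q :=
    -- The sign turns the commuting squares into anticommuting ones.
    { toFun := fun f => (-1 : ℤ) ^ p • ⟨vertDifferential k f.1, vertDifferential_mem hV hB f.2⟩
      map_zero' := by
        convert smul_zero ((-1 : ℤ) ^ p) using 2
        refine Subtype.ext ?_
        funext u a
        exact map_zero (barDifferential k q)
      map_add' := fun f g => by
        rw [← smul_add]
        congr 1
        refine Subtype.ext ?_
        funext u a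
        exact map_add (barDifferential k q) _ _ }
  dh_dh p q f := Subtype.ext (horDifferential_comp_self f.1)
  dv_dv p q f := by
    refine Subtype.ext ?_
    funext u a
    have h : ∀ z : ℤ, barDifferential k (q + 1) (z • barDifferential k q (f.1 u a)) = 0 := fun z => by
      rw [map_zsmul, barDifferential_comp_self, smul_zero]
    exact (congrArg ((-1 : ℤ) ^ p • ·) (h ((-1) ^ p))).trans (smul_zero _)
  anticomm p q f := by
    refine Subtype.ext ?_
    have h := horDifferential_vertDifferential (k := k) f.1
    have h1 : ∀ z : ℤ, horDifferential k (z • vertDifferential k f.1)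
        = z • horDifferential k (vertDifferential k f.1) := fun z => by
      funext u a v b
      exact congrFun (congrFun (map_zsmul (barDifferential k p) z
        (fun u a => vertDifferential k f.1 u a v b)) u) a
    refine (congrArg (· + (-1 : ℤ) ^ (p + 1) • vertDifferential k (horDifferential k f.1))
      (h1 ((-1) ^ p))).trans ?_
    rw [h, pow_succ, mul_neg_one, neg_smul]
    exact add_neg_cancel _

theorem pullLeft_mem {f : U → (Fin p → A) → V → (Fin q → B) → N}
    (hf : f ∈ bicochains 𝒜 𝒰 ℬ 𝒱 𝒩 p q ℓ) (α : U' →ₗ[k] U) (hα : ∀ i, ∀ x ∈ 𝒰' i, α x ∈ 𝒰 i) :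
    (fun u => f (α u)) ∈ bicochains 𝒜 𝒰' ℬ 𝒱 𝒩 p q ℓ :=
  ⟨fun v b => comp_left_mem_multilinearFunctions (hf.1 v b) α, fun u a => hf.2.1 (α u) a,
    fun i j u v d d' a b hu => hf.2.2 i j (α u) v d d' a b (hα i u hu)⟩

theorem pullRight_mem {f : U → (Fin p → A) → V → (Fin q → B) → N}
    (hf : f ∈ bicochains 𝒜 𝒰 ℬ 𝒱 𝒩 p q ℓ) (β : V' →ₗ[k] V) (hβ : ∀ i, ∀ x ∈ 𝒱' i, β x ∈ 𝒱 i) :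
    (fun u a v => f u a (β v)) ∈ bicochains 𝒜 𝒰 ℬ 𝒱' 𝒩 p q ℓ :=
  ⟨fun v b => hf.1 (β v) b, fun u a => comp_left_mem_multilinearFunctions (hf.2.1 u a) β,
    fun i j u v d d' a b hu hv => hf.2.2 i j u (β v) d d' a b hu (hβ j v hv)⟩

/-- The morphism of bicomplexes induced by a homomorphism in the first variable. -/
def pullLeft (hU : GradedAction 𝒜 𝒰) (hU' : GradedAction 𝒜 𝒰') (hV : GradedAction ℬ 𝒱)
    (hA : GradedAction 𝒜 𝒩) (hB : GradedAction ℬ 𝒩) (ℓ : ℤ) (α : U' →ₗ[Aᵐᵒᵖ] U)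
    (hα : ∀ i, ∀ x ∈ 𝒰' i, α x ∈ 𝒰 (i + 0)) :
    Bicomplex.Hom (bicomplex hU hV hA hB ℓ) (bicomplex hU' hV hA hB ℓ) where
  app p q :=
    { toFun := fun f => ⟨fun u => f.1 (α u), pullLeft_mem f.2 (α.restrictScalars k)
        fun i x hx => by simpa using hα i x hx⟩
      map_zero' := rfl
      map_add' := fun f g => rfl }
  app_dh p q f := by
    refine Subtype.ext ?_
    funext u a v b
    exact congrFun (congrFun (cochainMap_barDifferential (k := k) α (LinearMap.id : N →ₗ[Aᵐᵒᵖ] N) p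
      (fun u a => f.1 u a v b)) u) a
  app_dv p q f := rfl

/-- The morphism of bicomplexes induced by a homomorphism in the second variable. -/
def pullRight (hU : GradedAction 𝒜 𝒰) (hV : GradedAction ℬ 𝒱) (hV' : GradedAction ℬ 𝒱')
    (hA : GradedAction 𝒜 𝒩) (hB : GradedAction ℬ 𝒩) (ℓ : ℤ) (β : V' →ₗ[Bᵐᵒᵖ] V)
    (hβ : ∀ i, ∀ x ∈ 𝒱' i, β x ∈ 𝒱 (i + 0)) :
    Bicomplex.Hom (bicomplex hU hV hA hB ℓ) (bicomplex hU hV' hA hB ℓ) where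
  app p q :=
    { toFun := fun f => ⟨fun u a v => f.1 u a (β v), pullRight_mem f.2 (β.restrictScalars k)
        fun i x hx => by simpa using hβ i x hx⟩
      map_zero' := rfl
      map_add' := fun f g => rfl }
  app_dh p q f := rfl
  app_dv p q f := by
    refine Subtype.ext ?_
    funext u a
    exact congrArg ((-1 : ℤ) ^ p • ·) (cochainMap_barDifferential (k := k) β
      (LinearMap.id : N →ₗ[Bᵐᵒᵖ] N) q (f.1 u a))

theorem bicomplex_dv_eq_zero {hU : GradedAction 𝒜 𝒰} {hV : GradedAction ℬ 𝒱}
    {hA : GradedAction 𝒜 𝒩} {hB : GradedAction ℬ 𝒩} {f : bicochains 𝒜 𝒰 ℬ 𝒱 𝒩 p q ℓ} :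
    (bicomplex hU hV hA hB ℓ).dv p q f = 0 ↔ vertDifferential k f.1 = 0 := by
  have hu : IsUnit ((-1 : ℤ) ^ p) := (isUnit_one.neg).pow p
  rw [show (bicomplex hU hV hA hB ℓ).dv p q f = (-1 : ℤ) ^ p •
    (⟨vertDifferential k f.1, vertDifferential_mem hV hB f.2⟩ :
      bicochains 𝒜 𝒰 ℬ 𝒱 𝒩 p (q + 1) ℓ) from rfl]
  refine (hu.smul_eq_zero).trans ?_
  exact Subtype.ext_iff

theorem bicomplex_dv_exact {hU : GradedAction 𝒜 𝒰} {hV : GradedAction ℬ 𝒱}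
    {hA : GradedAction 𝒜 𝒩} {hB : GradedAction ℬ 𝒩} {f : bicochains 𝒜 𝒰 ℬ 𝒱 𝒩 p (q + 1) ℓ}
    (h : ∃ g ∈ bicochains 𝒜 𝒰 ℬ 𝒱 𝒩 p q ℓ, vertDifferential k g = f.1) :
    ∃ g, (bicomplex hU hV hA hB ℓ).dv p q g = f := by
  obtain ⟨g, hg, h⟩ := h
  refine ⟨((-1 : ℤ) ^ p • ⟨g, hg⟩ : bicochains 𝒜 𝒰 ℬ 𝒱 𝒩 p q ℓ), Subtype.ext ?_⟩
  funext u a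
  show (-1 : ℤ) ^ p • barDifferential k q ((-1 : ℤ) ^ p • g u a) = f.1 u a
  rw [map_zsmul, smul_smul, ← mul_pow, ← h]
  simp [vertDifferential]

theorem bicomplex_dh_eq_zero {hU : GradedAction 𝒜 𝒰} {hV : GradedAction ℬ 𝒱}
    {hA : GradedAction 𝒜 𝒩} {hB : GradedAction ℬ 𝒩} {f : bicochains 𝒜 𝒰 ℬ 𝒱 𝒩 p q ℓ} :
    (bicomplex hU hV hA hB ℓ).dh p q f = 0 ↔ horDifferential k f.1 = 0 :=
  Subtype.ext_iff

theorem bicomplex_dh_exact {hU : GradedAction 𝒜 𝒰} {hV : GradedAction ℬ 𝒱}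
    {hA : GradedAction 𝒜 𝒩} {hB : GradedAction ℬ 𝒩} {f : bicochains 𝒜 𝒰 ℬ 𝒱 𝒩 (p + 1) q ℓ}
    (h : ∃ g ∈ bicochains 𝒜 𝒰 ℬ 𝒱 𝒩 p q ℓ, horDifferential k g = f.1) :
    ∃ g, (bicomplex hU hV hA hB ℓ).dh p q g = f := by
  obtain ⟨g, hg, h⟩ := h
  exact ⟨⟨g, hg⟩, Subtype.ext h⟩

/-- If `Ext` over `B` of `V''` vanishes on the edge, edge cocycles are boundaries. -/
theorem exists_total_eq_single {hV : GradedAction ℬ 𝒱} {hA : GradedAction 𝒜 𝒩}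
    {hB : GradedAction ℬ 𝒩} {n : ℕ} [SetLike.GradedOne 𝒜] (h : Subsingleton (GExt ℬ 𝒱 𝒩 n ℓ))
    (z : (bicomplex (gradedAction_intGrading (𝒜 := 𝒜)) hV hA hB ℓ).X 0 n)
    (hz : (bicomplex (gradedAction_intGrading (𝒜 := 𝒜)) hV hA hB ℓ).dh 0 n z = 0)
    (hz' : (bicomplex (gradedAction_intGrading (𝒜 := 𝒜)) hV hA hB ℓ).dv 0 n z = 0) :
    ∃ y : (bicomplex (gradedAction_intGrading (𝒜 := 𝒜)) hV hA hB ℓ).Tot,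
      Bicomplex.Supp ((n : ℤ) - 1) y ∧ Bicomplex.total _ y = Bicomplex.single 0 n z := by
  have he := eq_edgeCochain (bicomplex_dh_eq_zero.1 hz)
  have hd := bicomplex_dv_eq_zero.1 hz'
  have hc : z.1 1 Fin.elim0 ∈ cocycles ℬ 𝒱 𝒩 n ℓ := by
    refine ⟨?_, congrFun (congrFun hd 1) Fin.elim0⟩
    have := edge_mem_cochains z.2 (d := Fin.elim0) (a := Fin.elim0) (fun t => t.elim0)
    simpa using this
  have hb := GExt.subsingleton_iff.1 h _ hc
  cases n with
  | zero =>
    refine ⟨0, fun _ _ _ => rfl, ?_⟩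
    have h0 : z.1 1 Fin.elim0 = 0 := hb
    have hz0 : z = 0 := by
      refine Subtype.ext (he.trans ?_)
      rw [h0]
      funext u _ v b
      exact smul_zero _
    rw [hz0, map_zero]
    simp [Bicomplex.single]
  | succ n =>
    obtain ⟨g, hg, hgz⟩ := hb
    let y : (bicomplex (gradedAction_intGrading (𝒜 := 𝒜)) hV hA hB ℓ).X 0 n :=
      ⟨edgeCochain A g, edgeCochain_mem hA hg⟩
    have hy : (bicomplex (gradedAction_intGrading (𝒜 := 𝒜)) hV hA hB ℓ).dh 0 n y = 0 :=
      bicomplex_dh_eq_zero.2 (horDifferential_edgeCochain g)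
    have hy' : (bicomplex (gradedAction_intGrading (𝒜 := 𝒜)) hV hA hB ℓ).dv 0 n y = z := by
      refine Subtype.ext ?_
      show (-1 : ℤ) ^ 0 • vertDifferential k (edgeCochain A g) = z.1
      rw [pow_zero, one_smul, vertDifferential_edgeCochain, hgz, ← he]
    refine ⟨Bicomplex.single 0 n y, Bicomplex.supp_single (by push_cast; ring) y, ?_⟩
    funext p q
    rw [Bicomplex.total_apply]
    have h1 : Bicomplex.hpart _ (Bicomplex.single 0 n y) p q = 0 := by
      rcases p with _ | p
      · rfl
      · rw [Bicomplex.hpart_succ]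
        by_cases hp : p = 0 ∧ q = n
        · obtain ⟨rfl, rfl⟩ := hp
          rw [Bicomplex.single_same, hy]
        · rw [Bicomplex.single_of_ne y (by omega), map_zero]
    rw [h1, zero_add]
    rcases q with _ | q
    · rw [Bicomplex.single_of_ne z (Or.inr (by omega))]
      rfl
    · rw [Bicomplex.vpart_succ]
      by_cases hp : p = 0 ∧ q = n
      · obtain ⟨rfl, rfl⟩ := hp
        rw [Bicomplex.single_same, Bicomplex.single_same, hy']
      · rw [Bicomplex.single_of_ne y (by omega), Bicomplex.single_of_ne z (by omega), map_zero]

/-- Comparison of one-sided `Ext` groups over two algebras acting on `N`. -/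
theorem GExt.subsingleton_of_comparison [SetLike.GradedOne 𝒜] [SetLike.GradedOne ℬ]
    {ι : U' →ₗ[Aᵐᵒᵖ] A} {π : A →ₗ[Aᵐᵒᵖ] U''} {ρ : A →ₗ[k] U'} {τ : U'' →ₗ[k] A}
    (S : IsGradedSplit 𝒰' (intGrading 𝒜) 𝒰'' ι π ρ τ)
    {ι' : V' →ₗ[Bᵐᵒᵖ] B} {π' : B →ₗ[Bᵐᵒᵖ] V''} {ρ' : B →ₗ[k] V'} {τ' : V'' →ₗ[k] B}
    (S' : IsGradedSplit 𝒱' (intGrading ℬ) 𝒱'' ι' π' ρ' τ')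
    (hU' : GradedAction 𝒜 𝒰') (hU'' : GradedAction 𝒜 𝒰'') (hV' : GradedAction ℬ 𝒱')
    (hV'' : GradedAction ℬ 𝒱'') (hA : GradedAction 𝒜 𝒩) (hB : GradedAction ℬ 𝒩)
    (h𝒜 : ⨆ i, 𝒜 i = ⊤) (hℬ : ⨆ i, ℬ i = ⊤) (h𝒰' : ⨆ i, 𝒰' i = ⊤) (h𝒱' : ⨆ i, 𝒱' i = ⊤)
    (h𝒰'' : ⨆ i, 𝒰'' i = ⊤) (h𝒱'' : ⨆ i, 𝒱'' i = ⊤) (h𝒩 : iSupIndep 𝒩) {n : ℕ} {r s : ℤ}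
    (hr : ∀ i < r, 𝒰' i = ⊥) (hs : ∀ i < s, 𝒱' i = ⊥)
    (h₁ : ∀ p ≤ n, ∀ m, s + ℓ ≤ m → Subsingleton (GExt 𝒜 𝒰'' 𝒩 p m))
    (h₂ : ∀ q m, r + ℓ ≤ m → Subsingleton (GExt ℬ 𝒱'' 𝒩 q m))
    (h₃ : Subsingleton (GExt ℬ 𝒱'' 𝒩 n ℓ)) :
    Subsingleton (GExt 𝒜 𝒰'' 𝒩 n ℓ) := by
  have hAA : GradedAction 𝒜 (intGrading 𝒜) := gradedAction_intGrading
  have hBB : GradedAction ℬ (intGrading ℬ) := gradedAction_intGrading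
  rw [GExt.subsingleton_iff]
  intro f hf
  -- The cocycle `f` becomes the edge element `(u, a, v) ↦ f(u, a) v` in the bottom row of the
  -- bicomplex of `(U'', B)`.
  let z : bicochains 𝒜 𝒰'' ℬ (intGrading ℬ) 𝒩 n 0 ℓ :=
    ⟨flipCochain (edgeCochain B f), flipCochain_mem (edgeCochain_mem hB hf.1)⟩
  have : SMulCommClass Bᵐᵒᵖ Aᵐᵒᵖ N := SMulCommClass.symm _ _ _
  have hz : horDifferential k z.1 = 0 := by
    show flipCochain (vertDifferential k (edgeCochain B f)) = 0
    rw [vertDifferential_edgeCochain, show barDifferential k n f = 0 from hf.2]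
    funext u a v b
    exact smul_zero _
  have hz' : vertDifferential k z.1 = 0 := by
    have := horDifferential_edgeCochain (k := k) (A := B) f
    exact congrArg flipCochain this
  -- Here `W`, `X`, `X'`, `Y`, `Y'` belong to the pairs `(U'', V'')`, `(U'', B)`, `(U'', V')`, `(A,
  -- V'')`, `(U', V'')`. Rows of `X'` are exact by `h₁` and columns of `Y'` by `h₂`, thanks to the
  -- lower degree bounds on `V'` and `U'`; `X` and `Y` are controlled by the regular modules.
  obtain ⟨y, hy, hy0, hyz⟩ := Bicomplex.exists_boundary
    (W := bicomplex hU'' hV'' hA hB ℓ) (n := n)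
    (pullRight hU'' hV'' hBB hA hB ℓ π' S'.π_mem) (pullRight hU'' hBB hV' hA hB ℓ ι' S'.ι_mem)
    (pullLeft hU'' hAA hV'' hA hB ℓ π S.π_mem) (pullLeft hAA hU' hV'' hA hB ℓ ι S.ι_mem)
    (by
      intro p q x hx
      refine Subtype.ext ?_
      funext u a v
      have := congrFun (congrFun (congrFun (congrArg Subtype.val hx) u) a) (τ' v)
      have h2 : x.1 u a (π' (τ' v)) = 0 := this
      rwa [S'.π_τ] at h2)
    (by
      intro p q x hx
      refine Subtype.ext ?_
      funext u
      have h2 : x.1 (π (τ u)) = 0 := congrFun (congrArg Subtype.val hx) (τ u)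
      rwa [S.π_τ] at h2)
    (by
      intro p q y
      refine ⟨⟨_, pullRight_mem y.2 ρ' S'.ρ_mem⟩, Subtype.ext ?_⟩
      funext u a v
      exact congrArg (y.1 u a) (S'.ρ_ι v))
    (by
      intro p q y
      refine ⟨⟨_, pullLeft_mem y.2 ρ S.ρ_mem⟩, Subtype.ext ?_⟩
      funext u
      exact congrArg y.1 (S.ρ_ι u))
    (by
      intro p q x
      refine Subtype.ext ?_
      funext u a
      refine (congrArg (fun t => x.1 t a) (S.π_ι u)).trans ?_
      exact map_zero_of_mem_multilinearFunctions (multilinear_of_mem_bicochains x.2) a)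
    (by
      intro p q y hy
      refine ⟨⟨_, pullRight_mem y.2 τ' S'.τ_mem⟩, Subtype.ext ?_⟩
      funext u a v b
      obtain ⟨w, hw⟩ := S'.exact (τ' (π' v) - v) (by rw [map_sub, S'.π_τ, sub_self])
      have h2 : y.1 u a (ι' w) b = 0 :=
        congrFun (congrFun (congrFun (congrFun (congrArg Subtype.val hy) u) a) w) b
      rw [hw, map_sub_of_mem_multilinearFunctions (y.2.2.1 u a), sub_eq_zero] at h2
      exact h2)
    (by
      intro p q y hy
      refine ⟨⟨_, pullLeft_mem y.2 τ S.τ_mem⟩, Subtype.ext ?_⟩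
      funext u a
      obtain ⟨w, hw⟩ := S.exact (τ (π u) - u) (by rw [map_sub, S.π_τ, sub_self])
      have h2 : y.1 (ι w) a = 0 := congrFun (congrFun (congrArg Subtype.val hy) w) a
      rw [hw, map_sub_of_mem_multilinearFunctions (multilinear_of_mem_bicochains y.2),
        sub_eq_zero] at h2
      exact h2)
    (fun p q x hp hx => bicomplex_dh_exact (exists_horDifferential_eq h𝒜 h𝒰'' hℬ h𝒱' h𝒩 hs
      (h₁ (p + 1) hp) x.2 (bicomplex_dh_eq_zero.1 hx)))
    (fun q x hx => Subtype.ext (eq_zero_of_horDifferential_eq_zero hℬ h𝒱' hs (h₁ 0 (Nat.zero_le _))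
      x.2 (bicomplex_dh_eq_zero.1 hx)))
    (fun p q x hx => bicomplex_dv_exact (exists_vertDifferential_eq h𝒜 h𝒰' hℬ h𝒱'' h𝒩 hr
      (h₂ (q + 1)) x.2 (bicomplex_dv_eq_zero.1 hx)))
    (fun p x hx => Subtype.ext (eq_zero_of_vertDifferential_eq_zero h𝒜 h𝒰' hr (h₂ 0)
      x.2 (bicomplex_dv_eq_zero.1 hx)))
    (fun p q x hx => bicomplex_dv_exact (exists_vertDifferential_eq_regular x.2
      (bicomplex_dv_eq_zero.1 hx)))
    (fun p q x hx => bicomplex_dh_exact (exists_horDifferential_eq_regular x.2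
      (bicomplex_dh_eq_zero.1 hx)))
    (exists_total_eq_single h₃) z (bicomplex_dh_eq_zero.2 hz) (bicomplex_dv_eq_zero.2 hz')
  have hzf : ∀ u a, z.1 u a 1 Fin.elim0 = f u a := fun u a => one_smul Bᵐᵒᵖ _
  have hyn := (congrFun (congrFun hyz n) 0).trans
    (Bicomplex.single_same (C := bicomplex hU'' hBB hA hB ℓ) n 0 z)
  rw [Bicomplex.total_apply, Bicomplex.vpart_zero, add_zero] at hyn
  cases n with
  | zero =>
    have hz0 : z.1 = 0 := congrArg Subtype.val hyn.symm
    show f = 0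
    funext u a
    rw [← hzf, hz0]
    rfl
  | succ n =>
    rw [Bicomplex.hpart_succ] at hyn
    have hz0 : horDifferential k (y n 0).1 = z.1 := congrArg Subtype.val hyn
    -- Setting `v = 1` turns the bottom row primitive of `z` into a primitive of `f`.
    refine ⟨(flipCochain (y n 0).1) 1 Fin.elim0, ?_, ?_⟩
    · have := edge_mem_cochains (flipCochain_mem (y n 0).2) (d := Fin.elim0) (a := Fin.elim0)
        (fun t => t.elim0)
      simpa using this
    · funext u a
      rw [← hzf, ← hz0]
      rfl

end Comparison

/-! ### Consequences of the hypotheses on `B_0`, of the Gorenstein condition and of the χ-condition.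
-/

section Basic

variable {k B : Type*} [Field k] [Ring B] [Algebra k B] {𝒜 : ℕ → Submodule k B} [GradedAlgebra 𝒜]
variable {n : ℕ} {e : Fin n → B} {χ : Fin n → B → k}

theorem exists_isBasic (ε : (Fin n → k) ≃ₐ[k] 𝒜 0) (he : ∀ b, e b = (ε (Pi.single b 1) : B)) :
    ∃ χ : Fin n → B → k, IsBasic 𝒜 e χ := by
  classical
  have hmul : ∀ f g, (ε (f * g) : B) = ε f * ε g := fun f g => by
    rw [map_mul]; rfl
  have hsmul : ∀ (c : k) f, (ε (c • f) : B) = c • (ε f : B) := fun c f => by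
    rw [map_smul]; rfl
  have hb : ∀ b (hb : b ∈ 𝒜 0), b = (ε (ε.symm ⟨b, hb⟩) : B) := fun b hb => by
    rw [AlgEquiv.apply_symm_apply]
  have hχ : ∀ b (hb : b ∈ 𝒜 0) (j : Fin n),
      ε.symm ⟨component 𝒜 0 b, component_mem 𝒜 0 b⟩ j = ε.symm ⟨b, hb⟩ j := fun b hb j => by
    have : (⟨component 𝒜 0 b, component_mem 𝒜 0 b⟩ : 𝒜 0) = ⟨b, hb⟩ :=
      Subtype.ext (component_of_mem hb)
    rw [this]
  have hne : ∀ i j : Fin n, i ≠ j →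
      (Pi.single i 1 * Pi.single j 1 : Fin n → k) = 0 := by
    intro i j hij
    funext t
    by_cases h : t = i
    · subst h
      simp [Pi.single_eq_of_ne hij]
    · simp [Pi.single_eq_of_ne h]
  have hsingle : ∀ (j : Fin n) (f : Fin n → k), Pi.single j 1 * f = f j • Pi.single j 1 := by
    intro j f
    funext t
    by_cases h : t = j
    · subst h
      simp
    · simp [Pi.single_eq_of_ne h]
  refine ⟨fun j b => ε.symm ⟨component 𝒜 0 b, component_mem 𝒜 0 b⟩ j, ?_, ?_, ?_, ?_, ?_, ?_, ?_⟩
  · intro j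
    rw [he]
    exact (ε _).2
  · intro j h
    rw [he] at h
    have h1 : ε (Pi.single j 1) = 0 := Subtype.ext h
    rw [map_eq_zero_iff ε ε.injective] at h1
    have := congrFun h1 j
    simp at this
  · simp only [he]
    rw [← Submodule.coe_sum, ← map_sum, Finset.univ_sum_single (fun _ => (1 : k))]
    exact congrArg Subtype.val (map_one ε)
  · intro j
    rw [he, ← hmul, ← Pi.single_mul, one_mul]
  · intro i j hij
    rw [he, he, ← hmul, hne i j hij, map_zero]
    rfl
  · intro j b hb'
    show _ = ε.symm ⟨component 𝒜 0 b, component_mem 𝒜 0 b⟩ j • e j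
    have h := hmul (Pi.single j 1) (ε.symm ⟨b, hb'⟩)
    rw [← hb b hb', hsingle, hsmul] at h
    rw [hχ b hb', he, h]
  · intro j b hb'
    show _ = ε.symm ⟨component 𝒜 0 b, component_mem 𝒜 0 b⟩ j • e j
    have h := hmul (ε.symm ⟨b, hb'⟩) (Pi.single j 1)
    rw [← hb b hb', mul_comm, hsingle, hsmul] at h
    rw [hχ b hb', he, h]

theorem IsBasic.op (he : IsBasic 𝒜 e χ) :
    IsBasic (opGrading 𝒜) (fun j => MulOpposite.op (e j)) (fun j b => χ j b.unop) where
  mem j := ⟨e j, he.mem j, rfl⟩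
  ne_zero j := (op_ne_zero_iff _).2 (he.ne_zero j)
  sum_eq := by
    rw [← op_one, ← he.sum_eq, Finset.op_sum]
  mul_self j := by rw [← op_mul, he.mul_self]
  mul_ne i j hij := by rw [← op_mul, he.mul_ne j i hij.symm, op_zero]
  mul_left := by
    rintro j _ ⟨b, hb, rfl⟩
    exact congrArg MulOpposite.op (he.mul_right j b hb)
  mul_right := by
    rintro j _ ⟨b, hb, rfl⟩
    exact congrArg MulOpposite.op (he.mul_left j b hb)

theorem leftSimple_exists (he : IsBasic 𝒜 e χ) {j : Fin n} (x : LeftSimple 𝒜 (e j)) :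
    ∃ c : k, x = c • (Submodule.Quotient.mk ⟨e j, Submodule.mem_span_singleton_self _⟩ :
      LeftSimple 𝒜 (e j)) := by
  obtain ⟨⟨x, hx⟩, rfl⟩ := Submodule.Quotient.mk_surjective _ x
  obtain ⟨b, rfl⟩ := Submodule.mem_span_singleton.1 hx
  refine ⟨χ j (component 𝒜 0 b), (Submodule.Quotient.eq _).2 ?_⟩
  show b * e j - χ j (component 𝒜 0 b) • e j ∈ tailIdeal 𝒜 1
  rw [← he.mul_right j _ (component_mem 𝒜 0 b), ← sub_mul]
  have h := sub_truncation_mem 𝒜 1 b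
  rw [truncation_succ, truncation_apply, Finset.range_zero, Finset.sum_empty, zero_add] at h
  exact (tailIdeal 𝒜 1).mul_mem_right _ h

theorem eq_zero_of_mem_leftSimpleGrading {j : Fin n} {i : ℤ} (hi : i ≠ 0)
    {x : LeftSimple 𝒜 (e j)} (hx : x ∈ leftSimpleGrading 𝒜 (e j) i) : x = 0 := by
  obtain ⟨⟨z, hz'⟩, hz, rfl⟩ := hx
  refine (Submodule.Quotient.mk_eq_zero _).2 ?_
  show z ∈ tailIdeal 𝒜 1
  have hz2 : z ∈ intGrading 𝒜 i := hz
  rcases mem_intGrading_cases hz2 with rfl | ⟨n, rfl, h⟩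
  · exact Submodule.zero_mem _
  · exact mem_tailIdeal_of_mem 𝒜 h (by
      have : n ≠ 0 := by exact_mod_cast hi
      omega)

/-- The left simple module is a line in degree zero, spanned by the class of the idempotent, so its
shift by `s j` is a line in degree `-s j`. -/
theorem isExtConcentrated_of_isGeneralizedGorenstein (he : IsBasic 𝒜 e χ) {N : ℕ}
    {σ : Equiv.Perm (Fin n)} {s : Fin n → ℤ} (hB : IsGeneralizedGorenstein 𝒜 e N σ s) :
    IsExtConcentrated 𝒜 e N s where
  of_ne := hB.ext_of_ne
  of_degree_ne j ℓ hℓ := by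
    obtain ⟨φ, -⟩ := hB.ext_iso j
    have : Subsingleton (leftSimpleGrading 𝒜 (e (σ j)) (s j + ℓ)) :=
      subsingleton_of_forall_eq 0 fun x =>
        Subtype.ext (eq_zero_of_mem_leftSimpleGrading (by omega) x.2)
    exact (φ ℓ).toEquiv.subsingleton
  exists_gen j := by
    obtain ⟨φ, -⟩ := hB.ext_iso j
    have hmem : (Submodule.Quotient.mk ⟨e (σ j), Submodule.mem_span_singleton_self _⟩ :
        LeftSimple 𝒜 (e (σ j))) ∈ leftSimpleGrading 𝒜 (e (σ j)) (s j + -s j) := by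
      rw [add_neg_cancel]
      exact ⟨⟨e (σ j), Submodule.mem_span_singleton_self _⟩, he.mem (σ j), rfl⟩
    refine ⟨(φ (-s j)).symm ⟨_, hmem⟩, ?_, fun x => ?_⟩
    · rw [Ne, LinearEquiv.map_eq_zero_iff]
      intro h
      have h1 : (⟨e (σ j), Submodule.mem_span_singleton_self _⟩ : Submodule.span B {e (σ j)}) ∈
          Submodule.submoduleOf (tailIdeal 𝒜 1) (Submodule.span B {e (σ j)}) :=
        (Submodule.Quotient.mk_eq_zero _).1 (congrArg Subtype.val h)
      have h2 : component 𝒜 0 (e (σ j)) = 0 := h1 0 (by omega)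
      rw [component_of_mem (he.mem _)] at h2
      exact he.ne_zero _ h2
    · obtain ⟨c, hc⟩ := leftSimple_exists he (φ (-s j) x : LeftSimple 𝒜 (e (σ j)))
      refine ⟨c, ?_⟩
      rw [← map_smul, LinearEquiv.eq_symm_apply]
      exact Subtype.ext hc

/-- The bound is uniform in `r` because layers of degree `t` involve `Ext(S_j, B)` only in degrees
`m + t ≥ m`, and from `∑ |s j| + 1` on these exceed every `-s j`. -/
theorem IsExtConcentrated.exists_bound {N : ℕ} {s : Fin n → ℤ} (hG : IsExtConcentrated 𝒜 e N s)
    (he : IsBasic 𝒜 e χ) (hfin : ∀ i, FiniteDimensional k (𝒜 i)) :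
    ∃ c : ℤ, ∀ (q r : ℕ) (m : ℤ), c ≤ m → Subsingleton (QuotExt 𝒜 r q m) := by
  refine ⟨∑ j, |s j| + 1, fun q r m hm => ?_⟩
  refine GExt.subsingleton_quot he hfin gradedAction_intGrading fun t _ j => ?_
  by_cases hq : q = N
  · subst hq
    refine hG.of_degree_ne j _ ?_
    have h1 : |s j| ≤ ∑ j, |s j| :=
      Finset.single_le_sum (f := fun j => |s j|) (fun i _ => abs_nonneg _) (Finset.mem_univ j)
    have h2 := neg_le_abs (s j)
    omega
  · exact hG.of_ne j q _ hq

/-- The χ-condition for the module `B` bounds `Ext^q(B / B_{≥ 1}, B)`, hence its summands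
`Ext^q(S_j, B)`, and dévissage gives all `r` at once. The bound depends on `q`, so only finitely
many `q` are treated together. -/
theorem exists_bound_of_chiCondition (he : IsBasic 𝒜 e χ) (hfin : ∀ i, FiniteDimensional k (𝒜 i))
    (hχ : ChiCondition 𝒜) (N : ℕ) :
    ∃ c : ℤ, ∀ q ≤ N, ∀ (r : ℕ) (m : ℤ), c ≤ m → Subsingleton (QuotExt 𝒜 r q m) := by
  have hM : IsGradedRightModule 𝒜 (intGrading 𝒜) :=
    ⟨isInternal_intGrading 𝒜, gradedAction_intGrading⟩
  have hf : Module.Finite Bᵐᵒᵖ B := Module.Finite.of_surjective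
    ({ toFun := unop, map_add' := fun _ _ => rfl, map_smul' := fun _ _ => rfl } :
      Bᵐᵒᵖ →ₗ[Bᵐᵒᵖ] B) unop_surjective
  choose c hc using hχ B (intGrading 𝒜) hM hf
  refine ⟨∑ q ∈ Finset.range (N + 1), |c q|, fun q hq r m hm => ?_⟩
  refine GExt.subsingleton_quot he hfin gradedAction_intGrading fun t _ j => ?_
  have h1 : |c q| ≤ ∑ q ∈ Finset.range (N + 1), |c q| :=
    Finset.single_le_sum (f := fun q => |c q|) (fun i _ => abs_nonneg _)
      (Finset.mem_range.2 (by omega))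
  have h2 := le_abs_self (c q)
  have h3 := le_abs_self (m + t)
  have := hc q (m + t) (by omega)
  exact GExt.subsingleton_simple he j

end Basic

/-! ### Transfer of vanishing to the opposite algebra. -/

section Opposite

variable {k B : Type*} [Field k] [Ring B] [Algebra k B] {𝒜 : ℕ → Submodule k B} [GradedAlgebra 𝒜]

theorem iSup_eq_top_of_surjective {M M' : Type*} [AddCommGroup M] [Module k M] [AddCommGroup M']
    [Module k M'] {ℳ : ℤ → Submodule k M} {ℳ' : ℤ → Submodule k M'} (f : M →ₗ[k] M')
    (hf : Function.Surjective f) (h : ∀ i, ∀ x ∈ ℳ i, f x ∈ ℳ' i) (htop : ⨆ i, ℳ i = ⊤) :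
    ⨆ i, ℳ' i = ⊤ := by
  rw [eq_top_iff, ← LinearMap.range_eq_top.2 hf, LinearMap.range_eq_map, ← htop, Submodule.map_iSup]
  exact iSup_mono fun i => Submodule.map_le_iff_le_comap.2 (h i)

variable (𝒜) in
theorem iSup_subGrading_tail (r : ℕ) :
    ⨆ i, subGrading (intGrading 𝒜) (toRight (tailIdeal 𝒜 r)) i = ⊤ :=
  iSup_eq_top_of_surjective _ (fun x => ⟨_, (isGradedSplit_tail 𝒜 r).ρ_ι x⟩)
    (isGradedSplit_tail 𝒜 r).ρ_mem (iSup_intGrading 𝒜)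

variable (𝒜) in
theorem iSup_quotIdealGrading (I : Ideal B) [I.IsTwoSided] : ⨆ i, quotIdealGrading 𝒜 I i = ⊤ :=
  iSup_eq_top_of_surjective ((toRight I).mkQ.restrictScalars k)
    (Submodule.Quotient.mk_surjective _) (fun _ x hx => ⟨x, hx, rfl⟩) (iSup_intGrading 𝒜)

variable (𝒜) in
theorem subGrading_tail_eq_bot (r : ℕ) (i : ℤ) (hi : i < r) :
    subGrading (intGrading 𝒜) (toRight (tailIdeal 𝒜 r)) i = ⊥ := by
  rw [Submodule.eq_bot_iff]
  rintro ⟨x, hx⟩ hx'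
  refine Subtype.ext ?_
  have h : x ∈ intGrading 𝒜 i := hx'
  rcases mem_intGrading_cases h with h0 | ⟨m, rfl, hm⟩
  · exact h0
  · show x = 0
    rw [← component_of_mem hm]
    exact hx m (by exact_mod_cast hi)

theorem unop_mem_intGrading {i : ℤ} {x : Bᵐᵒᵖ} (hx : x ∈ intGrading (opGrading 𝒜) i) :
    x.unop ∈ intGrading 𝒜 i := by
  cases i with
  | ofNat i =>
    obtain ⟨y, hy, rfl⟩ := hx
    exact hy
  | negSucc i =>
    have : x = 0 := hx
    rw [this]
    exact Submodule.zero_mem _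

theorem op_mem_intGrading {i : ℤ} {x : B} (hx : x ∈ intGrading 𝒜 i) :
    op x ∈ intGrading (opGrading 𝒜) i := by
  cases i with
  | ofNat i => exact ⟨x, hx, rfl⟩
  | negSucc i =>
    have : x = 0 := hx
    rw [this]
    exact Submodule.zero_mem _

theorem gradedAction_intGrading_opGrading : GradedAction 𝒜 (intGrading (opGrading 𝒜)) :=
  fun n i b m hb hm =>
    op_mem_intGrading (gradedAction_intGrading n i b m.unop hb (unop_mem_intGrading hm))

/-- The opposite algebra as a right module is isomorphic to the regular right module. -/
theorem GExt.subsingleton_op {M : Type*} [AddCommGroup M] [Module k M] [Module Bᵐᵒᵖ M]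
    [IsScalarTower k Bᵐᵒᵖ M] {ℳ : ℤ → Submodule k M} {q : ℕ} {ℓ : ℤ}
    (h : Subsingleton (GExt 𝒜 ℳ (intGrading 𝒜) q ℓ)) :
    Subsingleton (GExt 𝒜 ℳ (intGrading (opGrading 𝒜)) q ℓ) :=
  GExt.subsingleton_of_retract_right (N := Bᵐᵒᵖ) (N' := B)
    (β := { toFun := unop, map_add' := fun _ _ => rfl, map_smul' := fun _ _ => rfl })
    (β' := { toFun := op, map_add' := fun _ _ => rfl, map_smul' := fun _ _ => rfl })
    (fun _ _ hx => unop_mem_intGrading hx) (fun _ _ hx => op_mem_intGrading hx) (fun _ => rfl)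

theorem iSup_grading (𝒜 : ℕ → Submodule k B) [GradedAlgebra 𝒜] : ⨆ i, 𝒜 i = ⊤ :=
  (DirectSum.Decomposition.isInternal 𝒜).submodule_iSup_eq_top

/-- Vanishing of `Ext` over `B` implies vanishing of `Ext` over `Bᵐᵒᵖ`. -/
theorem subsingleton_quotExt_opGrading {n r t : ℕ} {ℓ : ℤ}
    (h₁ : ∀ p ≤ n, ∀ m, (t : ℤ) + ℓ ≤ m → Subsingleton (QuotExt (opGrading 𝒜) r p m))
    (h₂ : ∀ q m, (r : ℤ) + ℓ ≤ m → Subsingleton (QuotExt 𝒜 t q m))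
    (h₃ : Subsingleton (QuotExt 𝒜 t n ℓ)) : Subsingleton (QuotExt (opGrading 𝒜) r n ℓ) :=
  -- The coefficient bimodule is `Bᵐᵒᵖ`, regular over itself on one side and isomorphic to the right
  -- module `B` on the other. The ideals `A_{≥ r}` of `A = Bᵐᵒᵖ` and `B_{≥ t}` supply the lower
  -- degree bounds.
  GExt.subsingleton_of_comparison (isGradedSplit_tail (opGrading 𝒜) r) (isGradedSplit_tail 𝒜 t)
    (gradedAction_intGrading.sub _) (gradedAction_quotIdealGrading _)
    (gradedAction_intGrading.sub _) (gradedAction_quotIdealGrading _) gradedAction_intGrading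
    gradedAction_intGrading_opGrading (iSup_grading _) (iSup_grading 𝒜)
    (iSup_subGrading_tail _ r) (iSup_subGrading_tail _ t) (iSup_quotIdealGrading _ _)
    (iSup_quotIdealGrading _ _) (iSupIndep_intGrading _) (subGrading_tail_eq_bot _ r)
    (subGrading_tail_eq_bot _ t) h₁ (fun q m hm => GExt.subsingleton_op (h₂ q m hm))
    (GExt.subsingleton_op h₃)

end Opposite

/-! ### Cofinality of the powers of `B_{≥ 1}` with the ideals `B_{≥ r}`. -/

section Powers

variable {k B : Type*} [Field k] [Ring B] [Algebra k B] (𝒜 : ℕ → Submodule k B) [GradedAlgebra 𝒜]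

theorem component_mul (i : ℕ) (x y : B) : component 𝒜 i (x * y)
    = ∑ p ∈ Finset.HasAntidiagonal.antidiagonal i, component 𝒜 p.1 x * component 𝒜 p.2 y := by
  rw [component_apply, DirectSum.decompose_mul, DirectSum.coe_mul_apply_eq_sum_antidiagonal]
  rfl

theorem tailIdeal_pow_le (t : ℕ) : tailIdeal 𝒜 1 ^ t ≤ tailIdeal 𝒜 t := by
  induction t with
  | zero => exact fun x _ i hi => absurd hi (Nat.not_lt_zero i)
  | succ t ih =>
    rw [Submodule.pow_succ]
    refine Ideal.mul_le.2 fun x hx y hy => ?_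
    rw [mem_tailIdeal]
    intro i hi
    rw [component_mul]
    refine Finset.sum_eq_zero fun p hp => ?_
    have hp' := Finset.HasAntidiagonal.mem_antidiagonal.1 hp
    by_cases h : p.2 < 1
    · rw [(mem_tailIdeal 𝒜).1 hy _ h, mul_zero]
    · rw [(mem_tailIdeal 𝒜).1 (ih hx) _ (by omega), zero_mul]

theorem exists_component_eq_zero (x : B) : ∃ D, ∀ i ≥ D, component 𝒜 i x = 0 := by
  classical
  refine ⟨(DirectSum.decompose 𝒜 x).support.sup id + 1, fun i hi => ?_⟩
  rw [component_apply]
  by_contra h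
  have hmem : i ∈ (DirectSum.decompose 𝒜 x).support := by
    rw [DFinsupp.mem_support_iff]
    intro h0
    rw [h0] at h
    exact h rfl
  have := Finset.le_sup (f := id) hmem
  simp only [id] at this
  omega

theorem mem_of_component_mem {I : Ideal B} {x : B} (h : ∀ i, component 𝒜 i x ∈ I) : x ∈ I := by
  classical
  rw [← DirectSum.sum_support_decompose 𝒜 x]
  exact Ideal.sum_mem _ fun i _ => h i

theorem component_mem_tailIdeal {r : ℕ} {x : B} (hx : x ∈ tailIdeal 𝒜 r) (j : ℕ) :
    component 𝒜 j x ∈ tailIdeal 𝒜 r := by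
  by_cases h : r ≤ j
  · exact mem_tailIdeal_of_mem 𝒜 (component_mem 𝒜 j x) h
  · rw [(mem_tailIdeal 𝒜).1 hx j (by omega)]
    exact Submodule.zero_mem _

/-- `B` need not be generated in degree one, so finite generation is used: if finitely many `g`
generate the left ideal `B_{≥ u}`, an element of sufficiently high degree is a combination of
components of the `g` with coefficients of positive degree. It therefore lies in the product of
`B_{≥ 1}` with the power already reached. -/
theorem exists_tailIdeal_le_pow [IsNoetherianRing B] (r : ℕ) :
    ∃ u, tailIdeal 𝒜 u ≤ tailIdeal 𝒜 1 ^ r := by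
  classical
  induction r with
  | zero => exact ⟨0, by rw [Submodule.pow_zero, Ideal.one_eq_top]; exact le_top⟩
  | succ r ih =>
    obtain ⟨u, hu⟩ := ih
    obtain ⟨S, hS⟩ := IsNoetherian.noetherian (tailIdeal 𝒜 u)
    choose D hD using exists_component_eq_zero 𝒜
    have hSu : ∀ g ∈ S, g ∈ tailIdeal 𝒜 u := fun g hg => by
      rw [← hS]
      exact Submodule.subset_span hg
    refine ⟨u + S.sup D, fun x hx => mem_of_component_mem 𝒜 fun i => ?_⟩
    by_cases hi : i < u + S.sup D
    · rw [(mem_tailIdeal 𝒜).1 hx i hi]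
      exact Submodule.zero_mem _
    have hxu : x ∈ Submodule.span B (S : Set B) := by
      rw [hS]
      exact tailIdeal_antitone 𝒜 (Nat.le_add_right _ _) hx
    obtain ⟨c, -, rfl⟩ := Submodule.mem_span_finset.1 hxu
    rw [map_sum]
    refine Ideal.sum_mem _ fun g hg => ?_
    rw [smul_eq_mul, component_mul]
    refine Ideal.sum_mem _ fun p hp => ?_
    have hp' := Finset.HasAntidiagonal.mem_antidiagonal.1 hp
    have hDg : D g ≤ S.sup D := Finset.le_sup hg
    -- A coefficient of degree zero would need a component of `g` of degree `i ≥ D g`, and there is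
    -- none.
    by_cases h : p.1 = 0
    · rw [hD g p.2 (by omega), mul_zero]
      exact Submodule.zero_mem _
    · have hc := mem_tailIdeal_of_mem 𝒜 (component_mem 𝒜 p.1 (c g)) (r := 1) (by omega)
      rcases r with _ | r
      · rw [zero_add, Submodule.pow_one]
        exact (tailIdeal 𝒜 1).mul_mem_right _ hc
      · rw [Submodule.pow_succ' _ r.succ_ne_zero]
        exact Ideal.mul_mem_mul hc (hu (component_mem_tailIdeal 𝒜 (hSu g hg) _))

/-- For large `t` the projection `B / 𝔲^t → B / 𝔲^r` factors through `B / B_{≥ t}`, so the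
transition map on `Ext` factors through a zero group. Vanishing from some `r₀` on suffices, which is
all that the opposite side provides. -/
theorem powCohomology_subsingleton [IsNoetherianRing B] {q : ℕ} {ℓ : ℤ} {r₀ : ℕ}
    (h : ∀ r ≥ r₀, Subsingleton (QuotExt 𝒜 r q ℓ)) : Subsingleton (PowCohomology 𝒜 q ℓ) := by
  refine subsingleton_of_forall_eq 0 fun x => ?_
  obtain ⟨r, ξ, rfl⟩ := Module.DirectLimit.exists_of x
  obtain ⟨u, hu⟩ := exists_tailIdeal_le_pow 𝒜 r
  let t := max r (max u r₀)
  have ht : tailIdeal 𝒜 t ≤ tailIdeal 𝒜 1 ^ r := (tailIdeal_antitone 𝒜 (by omega)).trans hu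
  have hrt : r ≤ t := le_max_left _ _
  rw [← Module.DirectLimit.of_f (hij := hrt)]
  have hz : transition 𝒜 (fun r => tailIdeal 𝒜 1 ^ r) (fun _ _ h => Ideal.pow_le_pow_right h)
      (intGrading 𝒜) q ℓ r t hrt ξ = 0 := by
    have := h t (by omega)
    have h0 : GExt.map (quotFactor (tailIdeal 𝒜 t) (tailIdeal 𝒜 1 ^ r) ht) LinearMap.id
      (quotFactor_mem 𝒜 _ _ ht) (id_mem (intGrading 𝒜)) (ℓ' := ℓ) (by ring) q ξ = 0 :=
      Subsingleton.elim (α := QuotExt 𝒜 t q ℓ) _ _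
    have h1 := GExt.map_map (quotFactor_mem 𝒜 _ _ ht) (id_mem (intGrading 𝒜)) (ℓ' := ℓ) (by ring)
      (quotFactor_mem 𝒜 _ _ (tailIdeal_pow_le 𝒜 t)) (id_mem (intGrading 𝒜)) (ℓ'' := ℓ) (by ring)
      (quotFactor_mem 𝒜 (tailIdeal 𝒜 1 ^ t) (tailIdeal 𝒜 1 ^ r) (Ideal.pow_le_pow_right hrt))
      (id_mem (intGrading 𝒜)) (by ring) (fun m => by
        obtain ⟨y, rfl⟩ := Submodule.Quotient.mk_surjective _ m
        rfl) (fun _ => rfl) q ξ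
    rw [h0, map_zero] at h1
    exact h1.symm
  rw [hz, map_zero]

end Powers

end GradedExt

/-! ### Assembly of the vanishing, the duality and the Cohen–Macaulay property. -/

open GradedExt

theorem lemma3p3 {k : Type*} [Field k] [IsAlgClosed k] [CharZero k]
    {B : Type*} [Ring B] [Algebra k B] [IsNoetherianRing B] [IsNoetherianRing Bᵐᵒᵖ]
    (𝒜 : ℕ → Submodule k B) [GradedAlgebra 𝒜] (hfin : ∀ i, FiniteDimensional k (𝒜 i))
    (n : ℕ) (ε : (Fin n → k) ≃ₐ[k] 𝒜 0)
    (e : Fin n → B) (he : ∀ b, e b = (ε (Pi.single b 1) : B))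
    (hχ : ChiCondition 𝒜) (hχop : ChiCondition (GradedExt.opGrading 𝒜))
    (N : ℕ) (σ : Equiv.Perm (Fin n)) (s : Fin n → ℤ)
    (hB : IsGeneralizedGorenstein 𝒜 e N σ s) :
    (∀ i : ℕ, i ≠ N → ∀ ℓ : ℤ, Subsingleton (TailCohomology 𝒜 i ℓ)) ∧
    (∃ φ : (ℓ : ℤ) → TailCohomology 𝒜 N ℓ ≃ₗ[k] ((b : Fin n) → matlisDual 𝒜 (e b) (s b + ℓ)),
      ∀ (ℓ : ℤ) (a : ℕ) (r : B) (hr : r ∈ 𝒜 a) (x : TailCohomology 𝒜 N ℓ) (b : Fin n)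
        (y : ↥(Submodule.span B {e b})),
        (φ (ℓ + a) (GradedExt.LocalCohomology.act 𝒜 _ _ _ N ℓ a r hr x) b : Module.Dual k _) y
          = (φ ℓ x b : Module.Dual k _) (r • y)) ∧
    IsASCohenMacaulay 𝒜 := by
  obtain ⟨χ, hb⟩ := exists_isBasic ε he
  have hG := isExtConcentrated_of_isGeneralizedGorenstein hb hB
  refine ⟨fun i hi ℓ => tailCohomology_subsingleton fun r => hG.subsingleton_quot hb hfin r hi ℓ,
    hG.exists_matlis_equiv hb hfin, N, fun i hi => ?_⟩
  have hi' : i ≠ N := by exact_mod_cast hi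
  refine ⟨fun ℓ => powCohomology_subsingleton 𝒜 (r₀ := 0) fun r _ =>
    hG.subsingleton_quot hb hfin r hi' ℓ, fun ℓ => ?_⟩
  have hfin' : ∀ i, FiniteDimensional k (opGrading 𝒜 i) := fun i => by
    have := hfin i
    exact Module.Finite.map _ _
  obtain ⟨c, hc⟩ := hG.exists_bound hb hfin
  obtain ⟨c', hc'⟩ := exists_bound_of_chiCondition hb.op hfin' hχop i
  -- For fixed `i` and `ℓ`, the choice `t = (c' - ℓ).toNat` gives `t + ℓ ≥ c'`, and `r ≥ (c -
  -- ℓ).toNat` gives `r + ℓ ≥ c`; these are the ranges in which the two error terms are acyclic.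
  refine powCohomology_subsingleton (opGrading 𝒜) (r₀ := (c - ℓ).toNat) fun r hr =>
    subsingleton_quotExt_opGrading (t := (c' - ℓ).toNat) (fun p hp m hm => hc' p hp r m (by omega))
      (fun q m hm => hc q _ m (by omega)) (hG.subsingleton_quot hb hfin _ hi' ℓ)

end
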